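/- Let $\alpha>-1$, $0<c<1$, $\mathbb N=\{0,1,2,\dots\}$, $\mathbb D=\{z\in\mathbb C:|z|<1\}$, and let $\mathcal A(\mathbb D)$ be the space of analytic functions on $\mathbb D$ with the topology of locally uniform convergence and its Borel $\sigma$-algebra. Let $N_{\mathbb C}(0,1)$ be the law of $(X+iY)/\sqrt2$ with $X,Y$ independent real standard normal variables. For $f\in\ell^2(\mathbb N,\mathbb C)$ and $z\in\mathbb D$ put $$\ell_{\mathbb D}^{(\alpha)}f(z)=\sum_{x\in\mathbb N}\overline{f(x)}\sqrt{\frac{\Gamma(x+\alpha+1)}{x!}}\;z^x .$$ For $k,x\in\mathbb N$ let $M_k(x)={}_2F_1(-k,-x;\alpha+1;1-1/c)$ be the Meixner polynomials, which are orthogonal on $\mathbb N$ for the negative binomial weight $w(x)=(1-c)^{\alpha+1}\frac{\Gamma(x+\alpha+1)}{\Gamma(\alpha+1)\,x!}c^x$ with $\sum_x w(x)M_k(x)^2=\frac{k!\,\Gamma(\alpha+1)}{c^k\,\Gamma(k+\alpha+1)}$, and let $$f_k(x)=\sqrt{w(x)}\,M_k(x)\Big/\sqrt{\frac{k!\,\Gamma(\alpha+1)}{c^k\,\Gamma(k+\alpha+1)}}$$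 be the Meixner functions of parameters $\alpha$ and $c$. Let $\Theta$ be the completion of $\ell^2(\mathbb N,\mathbb C)$ for the norm $\|f\|_\Theta^2=\sum_k\frac{|\langle f_k,f\rangle|^2}{1+k^2}$. A white noise $\xi$ associated with $(f_k)$ is a random element of $\Theta$ that is almost surely the sum in $\Theta$ of a series $\sum_k\xi_kf_k$ with $\xi_k$ i.i.d. of law $N_{\mathbb C}(0,1)$. Theorem. The series defining $\ell_{\mathbb D}^{(\alpha)}f(z)$ converges for all $f\in\ell^2(\mathbb N,\mathbb C)$ and $z\in\mathbb D$; the $(f_k)$ form an orthonormal basis of $\ell^2(\mathbb N,\mathbb C)$; and $\ell_{\mathbb D}^{(\alpha)}$ extends in a unique way to a continuous map from $\Theta$ to $\mathcal A(\mathbb D)$, still written $\ell_{\mathbb D}^{(\alpha)}$. For every white noise $\xi$ associated with the Meixner functions $(f_k)$, the random analytic function $\ell_{\mathbb D}^{(\alpha)}\xi$ has the law on $\mathcal A(\mathbb D)$ of the hyperbolic Gaussian analytic function $$\mathsf{GAF}_{\mathbb D}^{(\alpha)}(z)=\sum_{k=0}^\infty\zeta_k\sqrt{\frac{\Gamma(k+\alpha+1)}{k!}}\;z^k,\qquad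 \zeta_k\ \text{i.i.d. of law } N_{\mathbb C}(0,1).$$ For every $k\in\mathbb N$ and $z\in\mathbb D$, $$\ell_{\mathbb D}^{(\alpha)}f_k(z)=\sqrt{\frac{\Gamma(k+\alpha+1)}{k!}}\,(1-c)^{(\alpha+1)/2}\,(\sqrt c-z)^k\,(1-\sqrt c\,z)^{-\alpha-1-k}$$ (principal branch of the power). If $\alpha=0$, the zero set of $\ell_{\mathbb D}^{(0)}\xi$ is a determinantal point process on $\mathbb D$ with respect to Lebesgue measure, with kernel the Bergman kernel $K_{\mathbb D}(z,w)=\frac1{\pi(1-z\overline w)^2}$: it is almost surely locally finite in $\mathbb D$, and for every $k\ge1$ and every bounded measurable $\psi:\mathbb D^k\to\mathbb R$ that vanishes outside a compact subset of $\mathbb D^k$, $$\mathbb E\Big[\sum_{x_1,\dots,x_k\ \text{pairwise distinct zeros}}\psi(x_1,\dots,x_k)\Big]=\int_{\mathbb D^k}\psi(z_1,\dots,z_k)\det\big[K_{\mathbb D}(z_i,z_j)\big]_{i,j=1}^k\,d^2z_1\cdots d^2z_k .$$ -/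

import Mathlib

open MeasureTheory ProbabilityTheory
open scoped ENNReal

noncomputable section

/-! ### The space of analytic functions on the unit disc -/

/-- The open unit disc. -/
abbrev unitDisc : Set ℂ := Metric.ball (0 : ℂ) 1

/-- The space `𝒜(𝔻)` of analytic functions on the unit disc: the continuous functions on `𝔻` that
are restrictions of functions complex differentiable on the open set `𝔻`. -/
def AnalyticDisc : Type :=
  {g : C(unitDisc, ℂ) // ∃ G : ℂ → ℂ, DifferentiableOn ℂ G unitDisc ∧ ∀ z : unitDisc, g z = G z}

namespace AnalyticDisc

instance : CoeFun AnalyticDisc (fun _ => unitDisc → ℂ) := ⟨fun g => g.1⟩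

/-- The topology of locally uniform convergence on `𝔻` (the compact-open topology). -/
instance : TopologicalSpace AnalyticDisc :=
  inferInstanceAs (TopologicalSpace
    {g : C(unitDisc, ℂ) // ∃ G : ℂ → ℂ, DifferentiableOn ℂ G unitDisc ∧ ∀ z : unitDisc, g z = G z})

instance : MeasurableSpace AnalyticDisc := borel AnalyticDisc

instance : BorelSpace AnalyticDisc := ⟨rfl⟩

instance : Zero AnalyticDisc := ⟨⟨0, 0, differentiableOn_const 0, fun _ => rfl⟩⟩

/-- The set of zeros in the disc. -/
def zeros (g : AnalyticDisc) : Set ℂ := Subtype.val '' {z : unitDisc | g z = 0}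

end AnalyticDisc

/-! ### Standard complex Gaussian variables and the hyperbolic GAF -/

/-- The law `N_ℂ(0,1)`: the law of `(X + iY)/√2` with `X`, `Y` independent real standard normal
variables. -/
def stdComplexGaussian : Measure ℂ :=
  ((gaussianReal 0 1).prod (gaussianReal 0 1)).map
    (fun p : ℝ × ℝ => ((p.1 : ℂ) + (p.2 : ℂ) * Complex.I) / ((Real.sqrt 2 : ℝ) : ℂ))

instance : IsProbabilityMeasure stdComplexGaussian :=
  Measure.isProbabilityMeasure_map (by fun_prop)

/-- The weight `√(Γ(k+α+1)/k!)`. -/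
def gammaCoeff (α : ℝ) (k : ℕ) : ℝ := Real.sqrt (Real.Gamma (k + α + 1) / k.factorial)

open Classical in
/-- The sum `∑ₖ aₖ √(Γ(k+α+1)/k!) zᵏ` as an element of `𝒜(𝔻)`, for a sequence `a` such that the
series converges on `𝔻` to an analytic function (and `0` for the other sequences, which form a null
set for i.i.d. `N_ℂ(0,1)` coefficients). -/
def hyperbolicSeries (α : ℝ) (a : ℕ → ℂ) : AnalyticDisc :=
  if h : ∃ g : AnalyticDisc,
      ∀ z : unitDisc, HasSum (fun k => a k * (gammaCoeff α k : ℂ) * (z : ℂ) ^ k) (g z)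
  then h.choose else 0

/-- The law on `𝒜(𝔻)` of the hyperbolic Gaussian analytic function of parameter `α`, that is of
`∑ₖ ξₖ √(Γ(k+α+1)/k!) zᵏ` with `ξₖ` i.i.d. `N_ℂ(0,1)`. -/
def hyperbolicGAFLaw (α : ℝ) : Measure AnalyticDisc :=
  (Measure.infinitePi (fun _ : ℕ => stdComplexGaussian)).map (hyperbolicSeries α)

/-! ### The discrete transform -/

/-- The term of index `x` of the series that defines `ℓ_𝔻^{(α)} f (z)`. -/
def diskTransformTerm (α : ℝ) (f : ℕ → ℂ) (z : ℂ) (x : ℕ) : ℂ :=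
  (starRingEnd ℂ) (f x) * (gammaCoeff α x : ℂ) * z ^ x

/-- The transform `ℓ_𝔻^{(α)} f (z) = ∑ₓ conj (f x) √(Γ(x+α+1)/x!) zˣ`. -/
def diskTransform (α : ℝ) (f : ℕ → ℂ) (z : ℂ) : ℂ := ∑' x, diskTransformTerm α f z x

/-! ### Meixner polynomials and functions -/

/-- The Meixner polynomial `M_k(x; α+1, c) = ₂F₁(-k, -x; α+1; 1 - 1/c)`. -/
def meixnerPoly (α c : ℝ) (k : ℕ) (x : ℝ) : ℝ :=
  ∑ j ∈ Finset.range (k + 1),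
    (ascPochhammer ℝ j).eval (-(k : ℝ)) * (ascPochhammer ℝ j).eval (-x) /
      ((ascPochhammer ℝ j).eval (α + 1) * j.factorial) * (1 - 1 / c) ^ j

/-- The negative binomial weight `(1-c)^{α+1} cˣ Γ(x+α+1) / (Γ(α+1) x!)` on `ℕ`. -/
def meixnerWeight (α c : ℝ) (x : ℕ) : ℝ :=
  (1 - c) ^ (α + 1) * c ^ x * Real.Gamma (x + α + 1) / (Real.Gamma (α + 1) * x.factorial)

/-- The Meixner function `f_k(x) = √(w(x)) M_k(x) / ‖M_k‖_{L²(w)}`, where `w` is the negative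
binomial weight and `‖M_k‖²_{L²(w)} = k! Γ(α+1) / (cᵏ Γ(k+α+1))`. -/
def meixnerFunction (α c : ℝ) (k x : ℕ) : ℝ :=
  Real.sqrt (meixnerWeight α c x) * meixnerPoly α c k x /
    Real.sqrt (k.factorial * Real.Gamma (α + 1) / (c ^ k * Real.Gamma (k + α + 1)))

/-! ### White noise -/

/-- The Hilbert space `ℓ²(ℕ, ℂ)`. -/
abbrev EllTwo : Type := lp (fun _ : ℕ => ℂ) 2

/-- The space `Θ` in which the white noise associated with an orthonormal basis `(f_k)` lives: the
completion of `ℓ²(ℕ, ℂ)` for the norm `‖f‖²_Θ = ∑ₖ |⟨f_k, f⟩|² / (1 + k²)`. It is realised as the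
space of the square-summable sequences of the normalised coordinates `⟨f_k, f⟩ / √(1 + k²)`; see
`noiseEmbedding`, `norm_noiseEmbedding_sq` and `denseRange_noiseEmbedding`. -/
abbrev NoiseSpace : Type := lp (fun _ : ℕ => ℂ) 2

theorem memℓp_noise (a : EllTwo) :
    Memℓp (fun k : ℕ => a k / ((Real.sqrt (1 + (k : ℝ) ^ 2) : ℝ) : ℂ)) 2 := by
  have ha := a.2
  have h2 : (0 : ℝ) < (2 : ℝ≥0∞).toReal := by norm_num
  rw [memℓp_gen_iff h2]
  refine Summable.of_nonneg_of_le (fun k => by positivity) (fun k => ?_) ((memℓp_gen_iff h2).1 ha)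
  refine Real.rpow_le_rpow (norm_nonneg _) ?_ h2.le
  rw [norm_div, Complex.norm_real, Real.norm_eq_abs, abs_of_nonneg (Real.sqrt_nonneg _)]
  refine div_le_self (norm_nonneg _) ?_
  rw [Real.one_le_sqrt]
  nlinarith [sq_nonneg (k : ℝ)]

/-- The inclusion of `ℓ²(ℕ, ℂ)` in `Θ`. -/
def noiseEmbedding (b : HilbertBasis ℕ ℂ EllTwo) (f : EllTwo) : NoiseSpace :=
  ⟨fun k => b.repr f k / ((Real.sqrt (1 + (k : ℝ) ^ 2) : ℝ) : ℂ), memℓp_noise (b.repr f)⟩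

theorem norm_noiseEmbedding_sq (b : HilbertBasis ℕ ℂ EllTwo) (f : EllTwo) :
    ‖noiseEmbedding b f‖ ^ 2 = ∑' k : ℕ, ‖inner ℂ (b k) f‖ ^ 2 / (1 + (k : ℝ) ^ 2) := by
  have h2 : (0 : ℝ) < (2 : ℝ≥0∞).toReal := by norm_num
  have h := lp.norm_rpow_eq_tsum h2 (noiseEmbedding b f)
  simp only [ENNReal.toReal_ofNat, Real.rpow_ofNat] at h
  rw [h]
  refine tsum_congr fun k => ?_
  have : noiseEmbedding b f k = b.repr f k / ((Real.sqrt (1 + (k : ℝ) ^ 2) : ℝ) : ℂ) := rfl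
  rw [this, b.repr_apply_apply, norm_div, div_pow, Complex.norm_real, Real.norm_eq_abs, sq_abs,
    Real.sq_sqrt (by positivity)]

theorem denseRange_noiseEmbedding (b : HilbertBasis ℕ ℂ EllTwo) :
    DenseRange (noiseEmbedding b) := by
  intro a
  have h := lp.hasSum_single (E := fun _ : ℕ => ℂ) (p := 2) (by norm_num) a
  refine mem_closure_of_tendsto h (Filter.Eventually.of_forall fun s => ?_)
  refine ⟨b.repr.symm (∑ k ∈ s, lp.single 2 k
    (a k * ((Real.sqrt (1 + (k : ℝ) ^ 2) : ℝ) : ℂ))), ?_⟩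
  ext i
  have hi : ((Real.sqrt (1 + (i : ℝ) ^ 2) : ℝ) : ℂ) ≠ 0 := by
    rw [Complex.ofReal_ne_zero]; positivity
  change b.repr (b.repr.symm _) i / _ = _
  rw [LinearIsometryEquiv.apply_symm_apply]
  rw [lp.coeFn_sum, lp.coeFn_sum, Finset.sum_apply, Finset.sum_apply, Finset.sum_div]
  refine Finset.sum_congr rfl fun k _ => ?_
  by_cases hk : i = k
  · subst hk
    simp [hi]
  · simp [Pi.single_eq_of_ne hk]

/-- A white noise associated with the orthonormal basis `(f_k)`, defined on a probability space
`(Ω, P)`: a random element of `Θ` that is almost surely the sum in `Θ` of the random series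
`∑ₖ ξₖ f_k`, with `ξₖ` i.i.d. `N_ℂ(0,1)`. -/
def IsWhiteNoise {Ω : Type*} [MeasurableSpace Ω] (b : HilbertBasis ℕ ℂ EllTwo) (P : Measure Ω)
    (ξ : Ω → NoiseSpace) : Prop :=
  ∃ ζ : ℕ → Ω → ℂ, (∀ k, Measurable (ζ k)) ∧ iIndepFun ζ P ∧
    (∀ k, P.map (ζ k) = stdComplexGaussian) ∧
    ∀ᵐ ω ∂P, HasSum (fun k => ζ k ω • noiseEmbedding b (b k)) (ξ ω)

/-- `L : Θ → 𝒜(𝔻)` is a continuous extension to `Θ` of the transform `ℓ_𝔻^{(α)}` of `ℓ²(ℕ, ℂ)`. -/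
def IsTransformExtension (α : ℝ) (b : HilbertBasis ℕ ℂ EllTwo) (L : NoiseSpace → AnalyticDisc) :
    Prop :=
  Continuous L ∧
    ∀ (f : EllTwo) (z : unitDisc), L (noiseEmbedding b f) z = diskTransform α (fun x => f x) z

/-! ### Determinantal point processes -/

/-- The random set `Z` is a (simple) determinantal point process on `D ⊆ ℂ` with kernel `K` with
respect to Lebesgue measure: it is almost surely locally finite in `D`, and for every `k ≥ 1` its
`k`-th joint intensity is `det [K(z_i, z_j)] d²z_1 ⋯ d²z_k`, as tested on bounded measurable
functions `ψ` supported in a compact subset of `Dᵏ`. -/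
structure IsDeterminantalPointProcess {Ω : Type*} [MeasurableSpace Ω] (P : Measure Ω) (D : Set ℂ)
    (K : ℂ → ℂ → ℂ) (Z : Ω → Set ℂ) : Prop where
  subset : ∀ᵐ ω ∂P, Z ω ⊆ D
  locally_finite : ∀ᵐ ω ∂P, ∀ C : Set ℂ, IsCompact C → C ⊆ D → (Z ω ∩ C).Finite
  joint_intensities : ∀ k : ℕ, 1 ≤ k → ∀ ψ : (Fin k → ℂ) → ℝ, Measurable ψ →
    (∃ M : ℝ, ∀ z, |ψ z| ≤ M) →
    (∃ C : Set (Fin k → ℂ), IsCompact C ∧ C ⊆ {z | ∀ i, z i ∈ D} ∧ ∀ z, z ∉ C → ψ z = 0) →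
    Integrable (fun ω =>
        ∑' x : {x : Fin k → ℂ // Function.Injective x ∧ ∀ i, x i ∈ Z ω}, ψ x.1) P ∧
      ((∫ ω, ∑' x : {x : Fin k → ℂ // Function.Injective x ∧ ∀ i, x i ∈ Z ω}, ψ x.1 ∂P : ℝ) : ℂ) =
        ∫ z in {z : Fin k → ℂ | ∀ i, z i ∈ D},
          (ψ z : ℂ) * (Matrix.of fun i j => K (z i) (z j)).det

/-- The Bergman kernel of the unit disc. -/
def bergmanKernel (z w : ℂ) : ℂ := 1 / (Real.pi * (1 - z * (starRingEnd ℂ) w) ^ 2)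

end

noncomputable section

theorem HasSum.of_apply_eq {ι E : Type*} [AddCommMonoid E] [TopologicalSpace E]
    {f g : ι → E} {a : E}
    (h : HasSum f a) (hfg : ∀ i, g i = f i) : HasSum g a := by
  rwa [funext hfg]

/-! ### Binomial series with Gamma coefficients -/

theorem Real.Gamma_nat_add {s : ℝ} (hs : 0 < s) (n : ℕ) :
    Real.Gamma (n + s) = (ascPochhammer ℝ n).eval s * Real.Gamma s := by
  induction n with
  | zero => simp
  | succ n ih =>
    have h : ((n + 1 : ℕ) : ℝ) + s = (n + s) + 1 := by push_cast; ring
    rw [h, Real.Gamma_add_one (by positivity), ih, ascPochhammer_succ_eval]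
    ring

theorem hasSum_gamma_mul_pow {s : ℝ} (hs : 0 < s) {y : ℂ} (hy : ‖y‖ < 1) :
    HasSum (fun n : ℕ => ((Real.Gamma (n + s) / n.factorial : ℝ) : ℂ) * y ^ n)
      (Real.Gamma s * (1 - y) ^ (-(s : ℂ))) := by
  have h := (Complex.one_div_one_sub_cpow_hasFPowerSeriesOnBall_zero (s : ℂ)).hasSum
    (y := y) (by simpa [Metric.mem_eball, edist_zero_right, ← ofReal_norm] using hy)
  simp only [FormalMultilinearSeries.ofScalars_apply_eq, zero_add, smul_eq_mul] at h
  have h2 := h.mul_left (Real.Gamma s : ℂ)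
  rw [one_div, ← Complex.cpow_neg] at h2
  refine h2.of_apply_eq fun n => ?_
  have hn : (n.factorial : ℂ) ≠ 0 := by exact_mod_cast n.factorial_ne_zero
  have h3 := Ring.factorial_nsmul_multichoose_eq_ascPochhammer (s : ℂ) n
  rw [Polynomial.ascPochhammer_smeval_cast, Polynomial.ascPochhammer_smeval_eq_eval,
    nsmul_eq_mul] at h3
  have h4 : Ring.choose ((s : ℂ) + n - 1) n = Ring.multichoose (s : ℂ) n := by
    rw [Ring.choose]
    congr 1
    ring
  have h5 : (((ascPochhammer ℝ n).eval s : ℝ) : ℂ) = (ascPochhammer ℂ n).eval (s : ℂ) := by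
    rw [← ascPochhammer_map Complex.ofRealHom n]
    exact (Polynomial.eval_map_apply Complex.ofRealHom _).symm
  rw [h4, Real.Gamma_nat_add hs]
  push_cast
  rw [h5, ← h3]
  field_simp

theorem Real.Gamma_nat_add_div_factorial_mul_choose (s : ℝ) (m j : ℕ) :
    Real.Gamma ((m + j : ℕ) + s) / (m + j).factorial * (m + j).choose j =
      Real.Gamma (m + (s + j)) / m.factorial / j.factorial := by
  have h := Nat.add_choose_mul_factorial_mul_factorial m j
  have h' : ((m + j).choose j : ℝ) * m.factorial * j.factorial = (m + j).factorial := by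
    rw [← h, ← Nat.choose_symm_add]; push_cast; ring
  have h1 : ((m + j).factorial : ℝ) ≠ 0 := by positivity
  have h2 : (m.factorial : ℝ) ≠ 0 := by positivity
  have h3 : (j.factorial : ℝ) ≠ 0 := by positivity
  have h4 : ((m + j : ℕ) : ℝ) + s = m + (s + j) := by push_cast; ring
  rw [h4]
  field_simp
  rw [← h']
  ring

theorem hasSum_gamma_mul_choose_mul_pow {s : ℝ} (hs : 0 < s) (j : ℕ) {y : ℂ} (hy : ‖y‖ < 1) :
    HasSum (fun n : ℕ => ((Real.Gamma (n + s) / n.factorial : ℝ) : ℂ) * n.choose j * y ^ n)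
      (((Real.Gamma (s + j) / j.factorial : ℝ) : ℂ) * y ^ j * (1 - y) ^ (-((s : ℂ) + j))) := by
  rw [← hasSum_nat_add_iff' j]
  have h0 : ∑ i ∈ Finset.range j,
      ((Real.Gamma (i + s) / i.factorial : ℝ) : ℂ) * i.choose j * y ^ i = 0 :=
    Finset.sum_eq_zero fun i hi => by
      rw [Nat.choose_eq_zero_of_lt (Finset.mem_range.1 hi)]; simp
  rw [h0, sub_zero]
  have hsj : (0 : ℝ) < s + j := by positivity
  have h := (hasSum_gamma_mul_pow hsj hy).mul_left (((1 / j.factorial : ℝ) : ℂ) * y ^ j)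
  have hv : ((Real.Gamma (s + j) / j.factorial : ℝ) : ℂ) * y ^ j * (1 - y) ^ (-((s : ℂ) + j)) =
      ((1 / j.factorial : ℝ) : ℂ) * y ^ j *
        (Real.Gamma (s + j) * (1 - y) ^ (-((s + j : ℝ) : ℂ))) := by
    push_cast
    ring
  rw [hv]
  refine h.of_apply_eq fun m => ?_
  · rw [pow_add]
    have := Real.Gamma_nat_add_div_factorial_mul_choose s m j
    have h' : ((Real.Gamma ((m + j : ℕ) + s) / (m + j).factorial : ℝ) : ℂ) * (m + j).choose j =
      ((Real.Gamma (m + (s + j)) / m.factorial / j.factorial : ℝ) : ℂ) := by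
      rw [← this]; push_cast; ring
    rw [h']
    push_cast
    ring

/-! ### Meixner sums -/

/-- The symmetric form `∑ⱼ C(k,j) C(x,j) j! eʲ / (s)ⱼ` of `₂F₁(-k, -x; s; e)`. -/
def meixnerSum (s e : ℝ) (k x : ℕ) : ℝ :=
  ∑ j ∈ Finset.range (k + 1),
    (k.choose j : ℝ) * x.choose j * (j.factorial * e ^ j / (ascPochhammer ℝ j).eval s)

theorem meixnerSum_comm (s e : ℝ) (k x : ℕ) : meixnerSum s e k x = meixnerSum s e x k := by
  have key : ∀ k x N : ℕ, k ≤ N → meixnerSum s e k x = ∑ j ∈ Finset.range (N + 1),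
      (k.choose j : ℝ) * x.choose j * (j.factorial * e ^ j / (ascPochhammer ℝ j).eval s) := by
    intro k x N hN
    refine Finset.sum_subset (by simpa using hN) fun j _ hj => ?_
    rw [Nat.choose_eq_zero_of_lt (by simpa [Nat.lt_succ_iff] using hj)]
    simp
  rw [key k x (max k x) (le_max_left _ _), key x k (max k x) (le_max_right _ _)]
  exact Finset.sum_congr rfl fun j _ => by ring

theorem abs_meixnerSum_le {s : ℝ} (hs : 0 < s) (e : ℝ) (k x : ℕ) :
    |meixnerSum s e k x| ≤ meixnerSum s |e| k x := by
  refine (Finset.abs_sum_le_sum_abs _ _).trans (le_of_eq (Finset.sum_congr rfl fun j _ => ?_))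
  have : 0 < (ascPochhammer ℝ j).eval s := ascPochhammer_pos j s hs
  rw [abs_mul, abs_mul, abs_div, abs_mul, abs_pow, abs_of_pos this]
  simp

theorem ascPochhammer_eval_neg_natCast (k j : ℕ) :
    (ascPochhammer ℝ j).eval (-(k : ℝ)) = (-1) ^ j * (j.factorial * k.choose j) := by
  rw [ascPochhammer_eval_neg_eq_descPochhammer, descPochhammer_eval_eq_descFactorial,
    Nat.descFactorial_eq_factorial_mul_choose]
  push_cast; ring

theorem meixnerPoly_eq_meixnerSum (α c : ℝ) (k x : ℕ) :
    meixnerPoly α c k x = meixnerSum (α + 1) (1 - 1 / c) k x := by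
  refine Finset.sum_congr rfl fun j _ => ?_
  rw [ascPochhammer_eval_neg_natCast, ascPochhammer_eval_neg_natCast]
  have h : (j.factorial : ℝ) ≠ 0 := by positivity
  have h2 : ((-1 : ℝ) ^ j) * (-1) ^ j = 1 := by rw [← mul_pow]; simp
  rw [mul_comm ((ascPochhammer ℝ j).eval (α + 1)), ← div_div]
  have : (-1 : ℝ) ^ j * (j.factorial * k.choose j) *
      ((-1) ^ j * (j.factorial * x.choose j)) / j.factorial =
    j.factorial * k.choose j * x.choose j := by
    field_simp
    linear_combination ((k.choose j : ℝ) * x.choose j) * h2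
  rw [this]
  ring

theorem hasSum_gamma_mul_meixnerSum {s : ℝ} (hs : 0 < s) (e : ℝ) (k : ℕ) {y : ℂ} (hy : ‖y‖ < 1) :
    HasSum (fun x : ℕ => ((Real.Gamma (x + s) / x.factorial : ℝ) : ℂ) * meixnerSum s e k x * y ^ x)
      (Real.Gamma s * (1 - y) ^ (-(s : ℂ)) * (1 + e * (y / (1 - y))) ^ k) := by
  have hy1 : 1 - y ≠ 0 := by
    intro h
    rw [sub_eq_zero] at h
    rw [← h] at hy
    simp at hy
  have h : ∀ j ∈ Finset.range (k + 1), HasSum (fun x : ℕ =>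
      ((k.choose j * (j.factorial * e ^ j / (ascPochhammer ℝ j).eval s) : ℝ) : ℂ) *
        (((Real.Gamma (x + s) / x.factorial : ℝ) : ℂ) * x.choose j * y ^ x))
      (((k.choose j * (j.factorial * e ^ j / (ascPochhammer ℝ j).eval s) : ℝ) : ℂ) *
        (((Real.Gamma (s + j) / j.factorial : ℝ) : ℂ) * y ^ j * (1 - y) ^ (-((s : ℂ) + j)))) :=
    fun j _ => (hasSum_gamma_mul_choose_mul_pow hs j hy).mul_left _
  convert hasSum_sum h using 1
  · ext x
    simp only [meixnerSum]
    push_cast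
    rw [Finset.mul_sum, Finset.sum_mul]
    exact Finset.sum_congr rfl fun j _ => by ring
  · rw [add_comm (1 : ℂ), add_pow, Finset.mul_sum]
    refine Finset.sum_congr rfl fun j _ => ?_
    have hp : ((ascPochhammer ℝ j).eval s : ℝ) ≠ 0 := (ascPochhammer_pos j s hs).ne'
    have hf : (j.factorial : ℝ) ≠ 0 := by positivity
    have hc : ((k.choose j * (j.factorial * e ^ j / (ascPochhammer ℝ j).eval s) : ℝ) : ℂ) *
        ((Real.Gamma (s + j) / j.factorial : ℝ) : ℂ) = k.choose j * e ^ j * Real.Gamma s := by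
      rw [add_comm s, Real.Gamma_nat_add hs, ← Complex.ofReal_mul]
      have : (k.choose j * (j.factorial * e ^ j / (ascPochhammer ℝ j).eval s) : ℝ) *
        ((ascPochhammer ℝ j).eval s * Real.Gamma s / j.factorial) = k.choose j * e ^ j *
            Real.Gamma s := by
        field_simp
      rw [this]; push_cast; ring
    rw [neg_add, Complex.cpow_add _ _ hy1, Complex.cpow_neg _ (j : ℂ), Complex.cpow_natCast]
    rw [mul_pow, div_pow, one_pow, mul_one]
    linear_combination (-(y ^ j * (1 - y) ^ (-(s : ℂ)) * ((1 - y) ^ j)⁻¹)) * hc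

/-! ### The coefficients of the transform -/

theorem Gamma_nat_add_pos {α : ℝ} (hα : -1 < α) (k : ℕ) : 0 < Real.Gamma (k + α + 1) :=
  Real.Gamma_pos_of_pos (by have : (0 : ℝ) ≤ k := k.cast_nonneg; linarith)

theorem gammaCoeff_pos {α : ℝ} (hα : -1 < α) (k : ℕ) : 0 < gammaCoeff α k :=
  Real.sqrt_pos.2 (div_pos (Gamma_nat_add_pos hα k) (by positivity))

theorem gammaCoeff_sq {α : ℝ} (hα : -1 < α) (k : ℕ) :
    gammaCoeff α k ^ 2 = Real.Gamma (k + (α + 1)) / k.factorial := by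
  rw [gammaCoeff, Real.sq_sqrt, add_assoc]
  exact (div_pos (Gamma_nat_add_pos hα k) (by positivity)).le

theorem gammaCoeff_zero (k : ℕ) : gammaCoeff 0 k = 1 := by
  rw [gammaCoeff, add_zero, Real.Gamma_nat_eq_factorial, div_self (by positivity), Real.sqrt_one]

theorem hasSum_gammaCoeff_sq_mul_pow {α : ℝ} (hα : -1 < α) {y : ℂ} (hy : ‖y‖ < 1) :
    HasSum (fun n : ℕ => (gammaCoeff α n : ℂ) ^ 2 * y ^ n)
      (Real.Gamma (α + 1) * (1 - y) ^ (-((α + 1 : ℝ) : ℂ))) := by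
  refine (hasSum_gamma_mul_pow (by linarith : 0 < α + 1) hy).of_apply_eq fun n => ?_
  rw [← gammaCoeff_sq hα]
  push_cast; rfl

/-- The vector `(√(Γ(x+α+1)/x!) zˣ)ₓ` of `ℓ²` against which the transform is taken. -/
def transformVector (α : ℝ) (z : ℂ) (x : ℕ) : ℂ := gammaCoeff α x * z ^ x

theorem summable_gammaCoeff_sq_mul_pow {α : ℝ} (hα : -1 < α) {r : ℝ} (h0 : 0 ≤ r) (h1 : r < 1) :
    Summable (fun n : ℕ => gammaCoeff α n ^ 2 * r ^ n) := by
  have h := (hasSum_gammaCoeff_sq_mul_pow hα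
    (y := (r : ℂ)) (by rwa [Complex.norm_real, Real.norm_eq_abs, abs_of_nonneg h0])).summable
  rw [← Complex.summable_ofReal]
  refine h.congr fun n => ?_
  push_cast; rfl

theorem memℓp_transformVector {α : ℝ} (hα : -1 < α) {z : ℂ} (hz : ‖z‖ < 1) :
    Memℓp (transformVector α z) 2 := by
  rw [memℓp_gen_iff (by norm_num)]
  refine (summable_gammaCoeff_sq_mul_pow hα (sq_nonneg ‖z‖)
    (by nlinarith [norm_nonneg z])).congr fun n => ?_
  rw [transformVector, norm_mul, Complex.norm_real, norm_pow, ENNReal.toReal_ofNat, Real.rpow_ofNat,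
    mul_pow, Real.norm_eq_abs, sq_abs, ← pow_mul, ← pow_mul, mul_comm n]

/-- `transformVector` as an element of `ℓ²`. -/
def transformKernel {α : ℝ} (hα : -1 < α) {z : ℂ} (hz : ‖z‖ < 1) : EllTwo :=
  ⟨transformVector α z, memℓp_transformVector hα hz⟩

theorem hasSum_diskTransformTerm {α : ℝ} (hα : -1 < α) (f : EllTwo) {z : ℂ} (hz : ‖z‖ < 1) :
    HasSum (diskTransformTerm α (fun x => f x) z) (inner ℂ f (transformKernel hα hz)) := by
  refine (lp.hasSum_inner f (transformKernel hα hz)).of_apply_eq fun x => ?_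
  simp [diskTransformTerm, transformKernel, transformVector]
  ring

theorem diskTransform_eq_inner {α : ℝ} (hα : -1 < α) (f : EllTwo) {z : ℂ} (hz : ‖z‖ < 1) :
    diskTransform α (fun x => f x) z = inner ℂ f (transformKernel hα hz) :=
  (hasSum_diskTransformTerm hα f hz).tsum_eq

/-! ### The Möbius factors -/

/-- The involution `(√c - z) / (1 - √c z)` of the disc. -/
def discInvolution (c : ℝ) (z : ℂ) : ℂ := ((Real.sqrt c : ℝ) - z) / (1 - (Real.sqrt c : ℝ) * z)

/-- The multiplier `(1-c)^{(α+1)/2} (1 - √c z)^{-α-1}`. -/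
def discMultiplier (α c : ℝ) (z : ℂ) : ℂ :=
  (((1 - c) ^ ((α + 1) / 2) : ℝ) : ℂ) * (1 - (Real.sqrt c : ℝ) * z) ^ (-((α + 1 : ℝ) : ℂ))

section
variable {α c : ℝ}

theorem one_sub_sqrt_mul_ne_zero (hc0 : 0 < c) (hc1 : c < 1) {z : ℂ} (hz : ‖z‖ < 1) :
    1 - ((Real.sqrt c : ℝ) : ℂ) * z ≠ 0 := by
  intro h
  have h1 : ‖((Real.sqrt c : ℝ) : ℂ) * z‖ = 1 := by
    rw [← sub_eq_zero.1 h]; simp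
  rw [norm_mul, Complex.norm_real, Real.norm_eq_abs, abs_of_nonneg (Real.sqrt_nonneg _)] at h1
  have h2 : Real.sqrt c < 1 := by rw [Real.sqrt_lt' one_pos]; simpa using hc1
  nlinarith [norm_nonneg z, Real.sqrt_pos.2 hc0]

theorem norm_discInvolution_lt_one (hc0 : 0 < c) (hc1 : c < 1) {z : ℂ} (hz : ‖z‖ < 1) :
    ‖discInvolution c z‖ < 1 := by
  have hne := one_sub_sqrt_mul_ne_zero hc0 hc1 hz
  rw [discInvolution, norm_div, div_lt_one (norm_pos_iff.2 hne)]
  refine lt_of_pow_lt_pow_left₀ 2 (norm_nonneg _) ?_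
  rw [← Complex.normSq_eq_norm_sq, ← Complex.normSq_eq_norm_sq, Complex.normSq_apply,
    Complex.normSq_apply]
  have h3 : z.re * z.re + z.im * z.im < 1 := by
    rw [← Complex.normSq_apply, Complex.normSq_eq_norm_sq]; nlinarith [norm_nonneg z]
  have h4 : Real.sqrt c * Real.sqrt c = c := Real.mul_self_sqrt hc0.le
  simp
  nlinarith

theorem meixnerFunction_eq (hα : -1 < α) (hc0 : 0 < c) (hc1 : c < 1) (k x : ℕ) :
    meixnerFunction α c k x = (1 - c) ^ ((α + 1) / 2) / Real.Gamma (α + 1) *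
      (Real.sqrt c ^ k * gammaCoeff α k) * (Real.sqrt c ^ x * gammaCoeff α x) *
      meixnerSum (α + 1) (1 - 1 / c) k x := by
  have hG : 0 < Real.Gamma (α + 1) := Real.Gamma_pos_of_pos (by linarith)
  have hgk := gammaCoeff_pos hα k
  have hgx := gammaCoeff_pos hα x
  have hs : 0 < Real.sqrt c := Real.sqrt_pos.2 hc0
  have h1c : 0 < 1 - c := by linarith
  have hr : 0 < (1 - c) ^ ((α + 1) / 2) := Real.rpow_pos_of_pos h1c _
  have h1 : Real.sqrt (meixnerWeight α c x) =
      (1 - c) ^ ((α + 1) / 2) * Real.sqrt c ^ x * gammaCoeff α x / Real.sqrt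
          (Real.Gamma (α + 1)) := by
    rw [Real.sqrt_eq_iff_mul_self_eq_of_pos (by positivity)]
    have e1 : (1 - c) ^ ((α + 1) / 2) * (1 - c) ^ ((α + 1) / 2) = (1 - c) ^ (α + 1) := by
      rw [← Real.rpow_add h1c]; ring_nf
    have e2 : Real.sqrt c ^ x * Real.sqrt c ^ x = c ^ x := by
      rw [← mul_pow, Real.mul_self_sqrt hc0.le]
    have e3 : Real.Gamma (x + α + 1) = gammaCoeff α x ^ 2 * x.factorial := by
      rw [gammaCoeff_sq hα x, add_assoc]; field_simp
    have e4 := Real.sq_sqrt hG.le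
    have h5 : 0 < Real.sqrt (Real.Gamma (α + 1)) := Real.sqrt_pos.2 hG
    rw [meixnerWeight, e3, ← e1, ← e2]
    field_simp
    rw [e4]
  have h2 : Real.sqrt (k.factorial * Real.Gamma (α + 1) / (c ^ k * Real.Gamma (k + α + 1))) =
      Real.sqrt (Real.Gamma (α + 1)) / (Real.sqrt c ^ k * gammaCoeff α k) := by
    rw [Real.sqrt_eq_iff_mul_self_eq_of_pos (by positivity)]
    have e2 : Real.sqrt c ^ k * Real.sqrt c ^ k = c ^ k := by
      rw [← mul_pow, Real.mul_self_sqrt hc0.le]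
    have e3 : Real.Gamma (k + α + 1) = gammaCoeff α k ^ 2 * k.factorial := by
      rw [gammaCoeff_sq hα k, add_assoc]; field_simp
    have e4 := Real.sq_sqrt hG.le
    rw [e3, ← e2]
    field_simp
    rw [e4]
  rw [meixnerFunction, h1, h2, meixnerPoly_eq_meixnerSum]
  have e4 := Real.sq_sqrt hG.le
  have h5 : 0 < Real.sqrt (Real.Gamma (α + 1)) := Real.sqrt_pos.2 hG
  field_simp
  rw [e4]
  field_simp

theorem meixnerFunction_comm (hα : -1 < α) (hc0 : 0 < c) (hc1 : c < 1) (k x : ℕ) :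
    meixnerFunction α c k x = meixnerFunction α c x k := by
  rw [meixnerFunction_eq hα hc0 hc1, meixnerFunction_eq hα hc0 hc1, meixnerSum_comm]
  ring

theorem hasSum_meixnerFunction_mul (hα : -1 < α) (hc0 : 0 < c) (hc1 : c < 1) (k : ℕ) {z : ℂ}
    (hz : ‖z‖ < 1) :
    HasSum (fun x => (meixnerFunction α c k x : ℂ) * (gammaCoeff α x * z ^ x))
      (gammaCoeff α k * discInvolution c z ^ k * discMultiplier α c z) := by
  have hG : (Real.Gamma (α + 1) : ℂ) ≠ 0 :=
    Complex.ofReal_ne_zero.2 (Real.Gamma_pos_of_pos (by linarith)).ne'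
  have hs : 0 < Real.sqrt c := Real.sqrt_pos.2 hc0
  have hs' : ((Real.sqrt c : ℝ) : ℂ) ≠ 0 := Complex.ofReal_ne_zero.2 hs.ne'
  have hs2 : ((Real.sqrt c : ℝ) : ℂ) ^ 2 = c := by
    rw [← Complex.ofReal_pow, Real.sq_sqrt hc0.le]
  have hne := one_sub_sqrt_mul_ne_zero hc0 hc1 hz
  have hy : ‖((Real.sqrt c : ℝ) : ℂ) * z‖ < 1 := by
    rw [norm_mul, Complex.norm_real, Real.norm_eq_abs, abs_of_nonneg hs.le]
    have h2 : Real.sqrt c < 1 := by rw [Real.sqrt_lt' one_pos]; simpa using hc1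
    nlinarith [norm_nonneg z]
  have h := (hasSum_gamma_mul_meixnerSum (by linarith : 0 < α + 1) (1 - 1 / c) k hy).mul_left
    (((1 - c) ^ ((α + 1) / 2) / Real.Gamma (α + 1) * (Real.sqrt c ^ k * gammaCoeff α k) : ℝ) : ℂ)
  have hv : (gammaCoeff α k * discInvolution c z ^ k * discMultiplier α c z : ℂ) =
      (((1 - c) ^ ((α + 1) / 2) / Real.Gamma (α + 1) * (Real.sqrt c ^ k * gammaCoeff α k) :
          ℝ) : ℂ) *
      (Real.Gamma (α + 1) * (1 - ((Real.sqrt c : ℝ) : ℂ) * z) ^ (-((α + 1 : ℝ) : ℂ)) *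
        (1 + ((1 - 1 / c : ℝ) : ℂ) * (((Real.sqrt c : ℝ) : ℂ) * z /
          (1 - ((Real.sqrt c : ℝ) : ℂ) * z))) ^ k) := by
    have h1 : discInvolution c z = (Real.sqrt c : ℝ) * (1 + ((1 - 1 / c : ℝ) : ℂ) *
        (((Real.sqrt c : ℝ) : ℂ) * z / (1 - ((Real.sqrt c : ℝ) : ℂ) * z))) := by
      rw [discInvolution]
      push_cast
      rw [← hs2]
      field_simp
      ring
    rw [h1, discMultiplier, mul_pow]
    push_cast
    field_simp
  rw [hv]
  refine h.of_apply_eq fun x => ?_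
  rw [← gammaCoeff_sq hα, meixnerFunction_eq hα hc0 hc1, mul_pow]
  push_cast
  ring

theorem diskTransform_meixnerFunction (hα : -1 < α) (hc0 : 0 < c) (hc1 : c < 1) (k : ℕ) {z : ℂ}
    (hz : ‖z‖ < 1) :
    diskTransform α (fun x => (meixnerFunction α c k x : ℂ)) z =
      gammaCoeff α k * discInvolution c z ^ k * discMultiplier α c z := by
  rw [← (hasSum_meixnerFunction_mul hα hc0 hc1 k hz).tsum_eq]
  refine tsum_congr fun x => ?_
  rw [diskTransformTerm, Complex.conj_ofReal]
  ring

theorem gammaCoeff_mul_discInvolution_pow (hc0 : 0 < c) (hc1 : c < 1) (k : ℕ) {z : ℂ}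
    (hz : ‖z‖ < 1) :
    gammaCoeff α k * discInvolution c z ^ k * discMultiplier α c z =
      (gammaCoeff α k : ℂ) * (((1 - c) ^ ((α + 1) / 2) : ℝ) : ℂ) *
        ((Real.sqrt c : ℝ) - z) ^ k *
          (1 - (Real.sqrt c : ℝ) * z) ^ (-(α : ℂ) - 1 - (k : ℂ)) := by
  have hne := one_sub_sqrt_mul_ne_zero hc0 hc1 hz
  rw [discInvolution, discMultiplier, Complex.cpow_sub _ _ hne, Complex.cpow_natCast, div_pow]
  have : -((α + 1 : ℝ) : ℂ) = -(α : ℂ) - 1 := by push_cast; ring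
  rw [this]
  ring

end

section
variable {α c : ℝ}

/-! ### Orthonormality and completeness of the Meixner functions -/

theorem hasSum_gamma_mul_meixnerSum_real {s : ℝ} (hs : 0 < s) (e : ℝ) (k : ℕ) {y : ℝ}
    (hy0 : 0 ≤ y) (hy : y < 1) :
    HasSum (fun x : ℕ => Real.Gamma (x + s) / x.factorial * meixnerSum s e k x * y ^ x)
      (Real.Gamma s * (1 - y) ^ (-s) * (1 + e * (y / (1 - y))) ^ k) := by
  have h := hasSum_gamma_mul_meixnerSum hs e k (y := (y : ℂ))
    (by rwa [Complex.norm_real, Real.norm_eq_abs, abs_of_nonneg hy0])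
  rw [← Complex.hasSum_ofReal]
  convert h using 1
  · ext x; push_cast; rfl
  · push_cast
    rw [Complex.ofReal_cpow (by linarith)]
    push_cast
    rfl

theorem meixnerSum_nonneg {s : ℝ} (hs : 0 < s) {e : ℝ} (he : 0 ≤ e) (k x : ℕ) :
    0 ≤ meixnerSum s e k x := by
  refine Finset.sum_nonneg fun j _ => ?_
  have : 0 < (ascPochhammer ℝ j).eval s := ascPochhammer_pos j s hs
  positivity

theorem exists_abs_meixnerFunction_le (hα : -1 < α) (hc0 : 0 < c) (hc1 : c < 1) :
    ∃ A : ℝ, 0 ≤ A ∧ ∀ k x : ℕ, |meixnerFunction α c k x| ≤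
      A * (Real.sqrt c ^ k * gammaCoeff α k) * (Real.sqrt c ^ x * gammaCoeff α x) *
      meixnerSum (α + 1) (1 / c - 1) k x := by
  have hG : 0 < Real.Gamma (α + 1) := Real.Gamma_pos_of_pos (by linarith)
  have h1c : 0 < 1 - c := by linarith
  have hr : 0 < (1 - c) ^ ((α + 1) / 2) := Real.rpow_pos_of_pos h1c _
  refine ⟨(1 - c) ^ ((α + 1) / 2) / Real.Gamma (α + 1), by positivity, fun k x => ?_⟩
  have hgk := gammaCoeff_pos hα k
  have hgx := gammaCoeff_pos hα x
  have hs : 0 < Real.sqrt c := Real.sqrt_pos.2 hc0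
  rw [meixnerFunction_eq hα hc0 hc1, abs_mul, abs_of_pos (by positivity)]
  refine mul_le_mul_of_nonneg_left ?_ (by positivity)
  have h := abs_meixnerSum_le (by linarith : 0 < α + 1) (1 - 1 / c) k x
  have h2 : (1 : ℝ) ≤ 1 / c := by rw [le_div_iff₀ hc0]; linarith
  have h3 : |1 - 1 / c| = 1 / c - 1 := by rw [abs_of_nonpos (by linarith), neg_sub]
  rwa [h3] at h

theorem summable_sqrt_pow_gammaCoeff_sq_mul (hα : -1 < α) (hc0 : 0 < c) (k : ℕ)
    {r : ℝ} (hr0 : 0 ≤ r) (hr : c * r < 1) :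
    Summable fun x : ℕ => (Real.sqrt c ^ x * gammaCoeff α x) ^ 2 *
      meixnerSum (α + 1) (1 / c - 1) k x * r ^ x := by
  refine (hasSum_gamma_mul_meixnerSum_real (by linarith : 0 < α + 1) (1 / c - 1) k
    (y := c * r) (by positivity) hr).summable.congr fun x => ?_
  rw [← gammaCoeff_sq hα, mul_pow, mul_pow, ← pow_mul, mul_comm x 2, pow_mul, Real.sq_sqrt hc0.le]
  ring

theorem summable_meixnerFunction_double (hα : -1 < α) (hc0 : 0 < c) (hc1 : c < 1) (k : ℕ) {w : ℝ}
    (hw : |w| < 1 / 2) :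
    Summable fun p : ℕ × ℕ => meixnerFunction α c k p.1 *
      (meixnerFunction α c p.2 p.1 * (gammaCoeff α p.2 * w ^ p.2)) := by
  obtain ⟨A, hA, hAb⟩ := exists_abs_meixnerFunction_le hα hc0 hc1
  have hs : 0 < Real.sqrt c := Real.sqrt_pos.2 hc0
  have hs1 : Real.sqrt c < 1 := by rw [Real.sqrt_lt' one_pos]; simpa using hc1
  have he : (0 : ℝ) < 1 / c - 1 := by rw [sub_pos, lt_div_iff₀ hc0]; linarith
  have hg := fun k => gammaCoeff_pos hα k
  set s := α + 1
  have hs0 : 0 < s := by show 0 < α + 1; linarith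
  have hM := fun k x => meixnerSum_nonneg hs0 he.le k x
  set y := Real.sqrt c * |w| with hy
  have hy0 : 0 ≤ y := by positivity
  have hyw : y < 1 / 2 := by nlinarith [abs_nonneg w]
  set ρ := 1 + (1 / c - 1) * (y / (1 - y)) with hρ
  have hyy : y / (1 - y) < 1 := by rw [div_lt_one (by linarith)]; linarith
  have hyy0 : 0 ≤ y / (1 - y) := div_nonneg hy0 (by linarith)
  have hρ0 : 0 ≤ ρ := by positivity
  have hρ1 : c * ρ < 1 := by
    have : ρ < 1 / c := by nlinarith
    rwa [lt_div_iff₀ hc0, mul_comm] at this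
  have hin : ∀ x, HasSum (fun l : ℕ => A * (Real.sqrt c ^ k * gammaCoeff α k) *
      (Real.sqrt c ^ x * gammaCoeff α x) * meixnerSum s (1 / c - 1) k x *
      (A * (Real.sqrt c ^ x * gammaCoeff α x) *
      (Real.Gamma (l + s) / l.factorial * meixnerSum s (1 / c - 1) x l * y ^ l)))
      (A * (Real.sqrt c ^ k * gammaCoeff α k) *
      (Real.sqrt c ^ x * gammaCoeff α x) * meixnerSum s (1 / c - 1) k x *
      (A * (Real.sqrt c ^ x * gammaCoeff α x) *
      (Real.Gamma s * (1 - y) ^ (-s) * ρ ^ x))) := fun x =>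
    ((hasSum_gamma_mul_meixnerSum_real hs0 (1 / c - 1) x hy0 (by linarith)).mul_left _).mul_left _
  refine Summable.of_norm_bounded (g := fun p : ℕ × ℕ => A * (Real.sqrt c ^ k * gammaCoeff α k) *
      (Real.sqrt c ^ p.1 * gammaCoeff α p.1) * meixnerSum s (1 / c - 1) k p.1 *
      (A * (Real.sqrt c ^ p.1 * gammaCoeff α p.1) *
      (Real.Gamma (p.2 + s) / p.2.factorial * meixnerSum s (1 / c - 1) p.1 p.2 * y ^ p.2))) ?_ ?_
  · rw [summable_prod_of_nonneg]
    · refine ⟨fun x => (hin x).summable, ?_⟩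
      simp_rw [fun x => (hin x).tsum_eq]
      refine ((summable_sqrt_pow_gammaCoeff_sq_mul hα hc0 k hρ0 hρ1).mul_left
        (A * (Real.sqrt c ^ k * gammaCoeff α k) * A * (Real.Gamma s * (1 - y) ^ (-s)))).congr
        fun x => ?_
      ring
    · intro p
      have h1 := hM k p.1
      have h2 := hM p.1 p.2
      have h3 := hg k
      have h4 := hg p.1
      have h5 : 0 < Real.Gamma (p.2 + s) := Real.Gamma_pos_of_pos (by positivity)
      positivity
  · intro p
    have h1 := hAb k p.1
    have h2 := hAb p.1 p.2
    rw [Real.norm_eq_abs, abs_mul]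
    refine mul_le_mul h1 ?_ (abs_nonneg _) ((abs_nonneg _).trans h1)
    rw [meixnerFunction_comm hα hc0 hc1, ← gammaCoeff_sq hα, abs_mul, abs_mul, abs_of_pos (hg p.2),
        abs_pow,
      hy, mul_pow]
    refine (mul_le_mul_of_nonneg_right h2 (mul_nonneg (hg _).le (by positivity))).trans
        (le_of_eq ?_)
    ring

theorem hasSum_meixnerFunction_mul_real (hα : -1 < α) (hc0 : 0 < c) (hc1 : c < 1) (k : ℕ) {z : ℝ}
    (hz : |z| < 1) :
    HasSum (fun x => meixnerFunction α c k x * (gammaCoeff α x * z ^ x))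
      (gammaCoeff α k * ((Real.sqrt c - z) / (1 - Real.sqrt c * z)) ^ k *
        ((1 - c) ^ ((α + 1) / 2) * (1 - Real.sqrt c * z) ^ (-(α + 1)))) := by
  have h := hasSum_meixnerFunction_mul hα hc0 hc1 k (z := (z : ℂ))
    (by rwa [Complex.norm_real, Real.norm_eq_abs])
  have hs1 : Real.sqrt c < 1 := by rw [Real.sqrt_lt' one_pos]; simpa using hc1
  have hpos : 0 < 1 - Real.sqrt c * z := by
    have := abs_lt.1 hz
    nlinarith [Real.sqrt_nonneg c]
  rw [← Complex.hasSum_ofReal]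
  convert h using 1
  · ext x; push_cast; rfl
  · rw [discInvolution, discMultiplier]
    push_cast
    rw [Complex.ofReal_cpow hpos.le]
    push_cast
    rfl

theorem discInvolution_real (hc0 : 0 < c) (hc1 : c < 1) {w : ℝ} (hw : |w| < 1) :
    |(Real.sqrt c - w) / (1 - Real.sqrt c * w)| < 1 := by
  have h := norm_discInvolution_lt_one hc0 hc1 (z := (w : ℂ))
    (by rwa [Complex.norm_real, Real.norm_eq_abs])
  rw [discInvolution] at h
  rwa [← Real.norm_eq_abs, ← Complex.norm_real, Complex.ofReal_div, Complex.ofReal_sub,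
      Complex.ofReal_sub,
    Complex.ofReal_mul, Complex.ofReal_one]

theorem tsum_meixnerFunction_mul (hα : -1 < α) (hc0 : 0 < c) (hc1 : c < 1) (k l : ℕ) :
    HasSum (fun x => meixnerFunction α c k x * meixnerFunction α c l x)
        (if k = l then 1 else 0) := by
  have hg := fun k => (gammaCoeff_pos hα k).ne'
  have hsum : ∀ l, Summable fun x => meixnerFunction α c k x * meixnerFunction α c l x := by
    intro l
    have h := summable_meixnerFunction_double hα hc0 hc1 k (w := 1 / 4) (by norm_num [abs_of_pos])
    have h2 := h.comp_injective (i := fun x : ℕ => (x, l)) (fun a b hab => by simpa using hab)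
    refine (h2.mul_right (gammaCoeff α l * (1 / 4) ^ l)⁻¹).congr fun x => ?_
    have := hg l
    simp only [Function.comp]
    field_simp
  have hs1 : Real.sqrt c < 1 := by rw [Real.sqrt_lt' one_pos]; simpa using hc1
  have key : ∀ w : ℝ, |w| < 1 / 2 → HasSum (fun l => w ^ l •
      (gammaCoeff α l * ∑' x, meixnerFunction α c k x * meixnerFunction α c l x))
      (gammaCoeff α k * w ^ k) := by
    intro w hw
    have hd := summable_meixnerFunction_double hα hc0 hc1 k hw
    have hw1 : |w| < 1 := by linarith
    have hpos : 0 < 1 - Real.sqrt c * w := by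
      have := abs_lt.1 hw1
      nlinarith [Real.sqrt_nonneg c]
    set φ := (Real.sqrt c - w) / (1 - Real.sqrt c * w) with hφ
    have h1 : ∀ x, HasSum (fun l => meixnerFunction α c k x *
        (meixnerFunction α c l x * (gammaCoeff α l * w ^ l)))
        (meixnerFunction α c k x * (gammaCoeff α x * φ ^ x *
        ((1 - c) ^ ((α + 1) / 2) * (1 - Real.sqrt c * w) ^ (-(α + 1))))) := by
      intro x
      simp_rw [fun l => meixnerFunction_comm hα hc0 hc1 l x]
      exact (hasSum_meixnerFunction_mul_real hα hc0 hc1 x hw1).mul_left _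
    have h2 := hd.hasSum.prod_fiberwise h1
    have h3 := (hasSum_meixnerFunction_mul_real hα hc0 hc1 k
        (discInvolution_real hc0 hc1 hw1)).mul_right
      ((1 - c) ^ ((α + 1) / 2) * (1 - Real.sqrt c * w) ^ (-(α + 1)))
    have h4 := h3.unique (h2.of_apply_eq fun x => by rw [hφ]; ring)
    have h5 : (Real.sqrt c - (Real.sqrt c - w) / (1 - Real.sqrt c * w)) /
        (1 - Real.sqrt c * ((Real.sqrt c - w) / (1 - Real.sqrt c * w))) = w := by
      have e := Real.sq_sqrt hc0.le
      have : 1 - Real.sqrt c * ((Real.sqrt c - w) / (1 - Real.sqrt c * w)) =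
        (1 - c) / (1 - Real.sqrt c * w) := by
        rw [← e]; simp only [Real.sqrt_sq (Real.sqrt_nonneg c)]; field_simp; ring
      rw [this, div_eq_iff (div_ne_zero (by linarith) hpos.ne')]
      field_simp
      linear_combination (-w) * e
    have h6 : ((1 - c) ^ ((α + 1) / 2) * (1 - Real.sqrt c *
          ((Real.sqrt c - w) / (1 - Real.sqrt c * w))) ^ (-(α + 1))) *
        ((1 - c) ^ ((α + 1) / 2) * (1 - Real.sqrt c * w) ^ (-(α + 1))) = 1 := by
      have e := Real.sq_sqrt hc0.le
      have : 1 - Real.sqrt c * ((Real.sqrt c - w) / (1 - Real.sqrt c * w)) =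
        (1 - c) / (1 - Real.sqrt c * w) := by
        rw [← e]; simp only [Real.sqrt_sq (Real.sqrt_nonneg c)]; field_simp; ring
      rw [this, mul_mul_mul_comm, ← Real.mul_rpow (div_nonneg (by linarith) hpos.le) hpos.le,
        div_mul_cancel₀ _ hpos.ne', ← Real.rpow_add (by linarith), ← Real.rpow_add (by linarith)]
      simp
    rw [mul_assoc, h5, h6, mul_one] at h4
    rw [h4]
    refine ((Equiv.prodComm ℕ ℕ).hasSum_iff.2 hd.hasSum).prod_fiberwise fun l => ?_
    have h7 := (hsum l).hasSum.mul_left (w ^ l * gammaCoeff α l)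
    rw [smul_eq_mul, ← mul_assoc]
    exact h7.of_apply_eq fun x => by simp; ring
  have hp1 : HasFPowerSeriesAt (fun w : ℝ => gammaCoeff α k * w ^ k)
      (FormalMultilinearSeries.ofScalars ℝ fun l => 
        gammaCoeff α l * ∑' x, meixnerFunction α c k x * meixnerFunction α c l x) 0 := by
    rw [hasFPowerSeriesAt_iff]
    filter_upwards [Metric.ball_mem_nhds (0 : ℝ) (by norm_num : (0 : ℝ) < 1 / 2)] with w hw
    simp only [FormalMultilinearSeries.coeff_ofScalars, zero_add]
    exact key w (by simpa using hw)
  have hp2 : HasFPowerSeriesAt (fun w : ℝ => gammaCoeff α k * w ^ k)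
      (FormalMultilinearSeries.ofScalars ℝ fun l => if k = l then gammaCoeff α k else 0) 0 := by
    rw [hasFPowerSeriesAt_iff]
    filter_upwards with w
    simp only [FormalMultilinearSeries.coeff_ofScalars, zero_add]
    refine (hasSum_ite_eq k (gammaCoeff α k * w ^ k)).of_apply_eq fun l => ?_
    by_cases h1 : k = l
    · subst h1; simp [mul_comm]
    · simp [h1, Ne.symm h1]
  have h := hp1.eq_formalMultilinearSeries hp2
  have h2 := congrArg (fun p => FormalMultilinearSeries.coeff p l) h
  simp only [FormalMultilinearSeries.coeff_ofScalars] at h2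
  have h3 : ∑' x, meixnerFunction α c k x * meixnerFunction α c l x = if k = l then 1 else 0 := by
    split_ifs at h2 ⊢ with hkl
    · subst hkl
      exact mul_left_cancel₀ (hg k) (by rw [h2, mul_one])
    · exact (mul_eq_zero.1 h2).resolve_left (hg l)
  rw [← h3]
  exact (hsum l).hasSum

/-- The Meixner function as an element of `ℓ²`. -/
def meixnerVector (hα : -1 < α) (hc0 : 0 < c) (hc1 : c < 1) (k : ℕ) : EllTwo :=
  ⟨fun x => (meixnerFunction α c k x : ℂ), by
    refine (memℓp_gen_iff (by norm_num)).2 ?_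
    refine (tsum_meixnerFunction_mul hα hc0 hc1 k k).summable.congr fun x => ?_
    rw [Complex.norm_real, ENNReal.toReal_ofNat, Real.rpow_ofNat, Real.norm_eq_abs, sq_abs, sq]⟩

theorem orthonormal_meixnerVector (hα : -1 < α) (hc0 : 0 < c) (hc1 : c < 1) :
    Orthonormal ℂ (meixnerVector hα hc0 hc1) := by
  rw [orthonormal_iff_ite]
  intro k l
  have h1 := lp.hasSum_inner (𝕜 := ℂ) (meixnerVector hα hc0 hc1 k) (meixnerVector hα hc0 hc1 l)
  have h2 := Complex.hasSum_ofReal.2 (tsum_meixnerFunction_mul hα hc0 hc1 k l)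
  rw [h1.unique (h2.of_apply_eq fun x => ?_)]
  · split_ifs <;> simp
  · simp [meixnerVector]
    ring

theorem Orthonormal.norm_sub_sum_sq {E ι : Type*} [NormedAddCommGroup E] [InnerProductSpace ℂ E]
    {v : ι → E} (hv : Orthonormal ℂ v) (e : E) (s : Finset ι) :
    ‖e - ∑ k ∈ s, inner ℂ (v k) e • v k‖ ^ 2 = ‖e‖ ^ 2 - ∑ k ∈ s, ‖inner ℂ (v k) e‖ ^ 2 := by
  have h1 : ∀ v : E, ((‖v‖ ^ 2 : ℝ) : ℂ) = inner ℂ v v := fun v => by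
    rw [inner_self_eq_norm_sq_to_K]; push_cast; rfl
  rw [← Complex.ofReal_inj, h1, inner_sub_left, inner_sub_right, inner_sub_right, hv.inner_sum,
    Complex.ofReal_sub, h1, sum_inner, inner_sum]
  simp_rw [inner_smul_left, inner_smul_right]
  push_cast
  simp_rw [← Complex.conj_mul', inner_conj_symm]
  simp only [fun k => mul_comm (inner ℂ e (v k)) (inner ℂ (v k) e)]
  ring

theorem single_mem_closure_span_meixnerVector (hα : -1 < α) (hc0 : 0 < c) (hc1 : c < 1) (x : ℕ) :
    (lp.single 2 x (1 : ℂ) : EllTwo) ∈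
      (Submodule.span ℂ (Set.range (meixnerVector hα hc0 hc1))).topologicalClosure := by
  have ho := orthonormal_meixnerVector hα hc0 hc1
  have hco : ∀ k, inner ℂ (meixnerVector hα hc0 hc1 k) (lp.single 2 x (1 : ℂ) : EllTwo) =
      (meixnerFunction α c k x : ℂ) := by
    intro k
    rw [lp.inner_single_right]
    simp [meixnerVector]
  have hn : ∀ n : ℕ, ‖(lp.single 2 x (1 : ℂ) : EllTwo) - ∑ k ∈ Finset.range n,
      (meixnerFunction α c k x : ℂ) • meixnerVector hα hc0 hc1 k‖ ^ 2 =
      1 - ∑ k ∈ Finset.range n, meixnerFunction α c x k * meixnerFunction α c x k := by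
    intro n
    have h1 := ho.norm_sub_sum_sq (lp.single 2 x (1 : ℂ)) (Finset.range n)
    simp_rw [hco] at h1
    rw [h1, lp.norm_single (by norm_num)]
    simp [sq, fun k => meixnerFunction_comm hα hc0 hc1 x k]
  have ht : Filter.Tendsto (fun n => ∑ k ∈ Finset.range n,
      (meixnerFunction α c k x : ℂ) • meixnerVector hα hc0 hc1 k) Filter.atTop
      (nhds (lp.single 2 x (1 : ℂ) : EllTwo)) := by
    rw [tendsto_iff_norm_sub_tendsto_zero]
    have h := (tsum_meixnerFunction_mul hα hc0 hc1 x x).tendsto_sum_nat.const_sub 1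
    simp only [if_true, sub_self] at h
    simp_rw [← hn] at h
    have h2 := (Real.continuous_sqrt.tendsto 0).comp h
    simp only [Real.sqrt_zero] at h2
    refine h2.congr fun n => ?_
    simp only [Function.comp, Real.sqrt_sq (norm_nonneg _)]
    rw [norm_sub_rev]
  refine mem_closure_of_tendsto ht (Filter.Eventually.of_forall fun n => ?_)
  exact Submodule.sum_mem _ fun k _ => Submodule.smul_mem _ _ (Submodule.subset_span ⟨k, rfl⟩)

theorem top_le_closure_span_meixnerVector (hα : -1 < α) (hc0 : 0 < c) (hc1 : c < 1) :
    ⊤ ≤ (Submodule.span ℂ (Set.range (meixnerVector hα hc0 hc1))).topologicalClosure := by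
  intro f _
  have h := lp.hasSum_single (E := fun _ : ℕ => ℂ) (p := 2) (by norm_num) f
  refine (Submodule.isClosed_topologicalClosure _).mem_of_tendsto h
    (Filter.Eventually.of_forall fun s => Submodule.sum_mem _ fun x _ => ?_)
  have : (lp.single 2 x (f x) : EllTwo) = f x • (lp.single 2 x (1 : ℂ) : EllTwo) := by
    rw [← lp.single_smul, smul_eq_mul, mul_one]
  rw [this]
  exact Submodule.smul_mem _ _ (single_mem_closure_span_meixnerVector hα hc0 hc1 x)

/-- The orthonormal basis of Meixner functions. -/
def meixnerBasis (hα : -1 < α) (hc0 : 0 < c) (hc1 : c < 1) : HilbertBasis ℕ ℂ EllTwo :=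
  HilbertBasis.mk (orthonormal_meixnerVector hα hc0 hc1)
    (top_le_closure_span_meixnerVector hα hc0 hc1)

theorem meixnerBasis_apply (hα : -1 < α) (hc0 : 0 < c) (hc1 : c < 1) (k x : ℕ) :
    meixnerBasis hα hc0 hc1 k x = (meixnerFunction α c k x : ℂ) := by
  rw [meixnerBasis, HilbertBasis.coe_mk]
  rfl

end

namespace AnalyticDisc

/-! ### Analytic functions on the disc as a Polish space -/

/-- Extension by zero to the plane. -/
def extend (g : AnalyticDisc) (z : ℂ) : ℂ :=
  Function.extend (Subtype.val : unitDisc → ℂ) g 0 z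

theorem extend_coe (g : AnalyticDisc) (z : unitDisc) : g.extend z = g z :=
  Subtype.val_injective.extend_apply _ _ z

theorem extend_of_mem (g : AnalyticDisc) {z : ℂ} (hz : z ∈ unitDisc) : g.extend z = g ⟨z, hz⟩ :=
  extend_coe g ⟨z, hz⟩

theorem differentiableOn_extend (g : AnalyticDisc) : DifferentiableOn ℂ g.extend unitDisc := by
  obtain ⟨G, hG, h⟩ := g.2
  refine hG.congr fun z hz => ?_
  rw [extend_of_mem g hz]
  exact h ⟨z, hz⟩

/-- The restriction to the disc of a function holomorphic on the disc. -/
def ofDifferentiableOn (G : ℂ → ℂ) (hG : DifferentiableOn ℂ G unitDisc) : AnalyticDisc :=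
  ⟨⟨fun z => G z, hG.continuousOn.domRestrict⟩, G, hG, fun _ => rfl⟩

@[ext]
theorem ext {g h : AnalyticDisc} (H : ∀ z : unitDisc, g z = h z) : g = h :=
  Subtype.ext (ContinuousMap.ext H)

theorem zero_apply (z : unitDisc) : (0 : AnalyticDisc) z = 0 := rfl

instance : LocallyCompactSpace unitDisc := Metric.isOpen_ball.locallyCompactSpace

theorem isClosed_setOf_analytic : IsClosed {g : C(unitDisc, ℂ) |
    ∃ G : ℂ → ℂ, DifferentiableOn ℂ G unitDisc ∧ ∀ z : unitDisc, g z = G z} := by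
  set S := {g : C(unitDisc, ℂ) |
    ∃ G : ℂ → ℂ, DifferentiableOn ℂ G unitDisc ∧ ∀ z : unitDisc, g z = G z} with hS
  rw [← closure_subset_iff_isClosed]
  intro g hg
  have hne : (nhdsWithin g S).NeBot := mem_closure_iff_nhdsWithin_neBot.1 hg
  set E : C(unitDisc, ℂ) → ℂ → ℂ := fun g z =>
    Function.extend (Subtype.val : unitDisc → ℂ) g 0 z with hE
  have hEc : ∀ (g : C(unitDisc, ℂ)) (z : unitDisc), E g z = g z := fun g z =>
    Subtype.val_injective.extend_apply _ _ z
  have ht : TendstoLocallyUniformlyOn E (E g) (nhdsWithin g S) unitDisc := by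
    have h1 : TendstoLocallyUniformly (fun (i : C(unitDisc, ℂ)) a => i a) g (nhdsWithin g S) :=
      ContinuousMap.tendsto_iff_tendstoLocallyUniformly.1
        (Filter.tendsto_id.mono_left nhdsWithin_le_nhds : Filter.Tendsto id (nhdsWithin g S)
            (nhds g))
    rw [tendstoLocallyUniformlyOn_iff_tendstoLocallyUniformly_comp_coe]
    refine (h1.congr (G := fun i (a : unitDisc) => E i a) fun i => ?_).congr_right ?_
    · intro a; exact (hEc i a).symm
    · intro a; exact (hEc g a).symm
  refine ⟨E g, ht.differentiableOn ?_ Metric.isOpen_ball, fun z => (hEc g z).symm⟩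
  filter_upwards [self_mem_nhdsWithin] with i hi
  obtain ⟨G, hG, h⟩ := hi
  refine hG.congr fun z hz => ?_
  rw [← h ⟨z, hz⟩]
  exact hEc i ⟨z, hz⟩

instance : PolishSpace AnalyticDisc := by
  have h1 : PolishSpace C(unitDisc, ℂ) := inferInstance
  exact isClosed_setOf_analytic.polishSpace

/-- Evaluation is jointly continuous. -/
theorem continuous_eval : Continuous fun p : AnalyticDisc × unitDisc => p.1 p.2 :=
  (ContinuousEval.continuous_eval (F := C(unitDisc, ℂ))).comp
    ((continuous_subtype_val.comp continuous_fst).prodMk continuous_snd)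

theorem continuous_eval_const (z : unitDisc) : Continuous fun g : AnalyticDisc => g z :=
  continuous_eval.comp (continuous_id.prodMk continuous_const)

theorem measurable_eval_const (z : unitDisc) : Measurable fun g : AnalyticDisc => g z :=
  (continuous_eval_const z).measurable

theorem measurableEmbedding_denseSeq : MeasurableEmbedding
    (fun (g : AnalyticDisc) (n : ℕ) => g (TopologicalSpace.denseSeq unitDisc n)) := by
  refine Continuous.measurableEmbedding
    (continuous_pi fun n => continuous_eval_const _) fun g h hgh => ?_
  refine Subtype.ext (ContinuousMap.coe_injective ?_)
  exact (TopologicalSpace.denseRange_denseSeq unitDisc).equalizer g.1.continuous h.1.continuous hgh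

theorem measurable_of_eval {Ω : Type*} [MeasurableSpace Ω] {F : Ω → AnalyticDisc}
    (h : ∀ z : unitDisc, Measurable fun ω => F ω z) : Measurable F :=
  measurableEmbedding_denseSeq.measurable_comp_iff.1 (measurable_pi_lambda _ fun _ => h _)

theorem aemeasurable_of_eval {Ω : Type*} [MeasurableSpace Ω] {P : Measure Ω} {F : Ω → AnalyticDisc}
    (h : ∀ z : unitDisc, AEMeasurable (fun ω => F ω z) P) : AEMeasurable F P :=
  measurableEmbedding_denseSeq.aemeasurable_comp_iff.1 (aemeasurable_pi_lambda _ fun _ => h _)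

theorem _root_.MeasureTheory.Measure.ext_of_integral_cexp_re_sum {ι : Type*} [Fintype ι]
    [DecidableEq ι] {m m' : Measure (ι → ℂ)} [IsFiniteMeasure m] [IsFiniteMeasure m']
    (h : ∀ t : ι → ℂ, ∫ x, Complex.exp (((∑ i, t i * x i).re : ℝ) * Complex.I) ∂m =
      ∫ x, Complex.exp (((∑ i, t i * x i).re : ℝ) * Complex.I) ∂m') : m = m' := by
  refine Measure.ext_of_charFunDual (funext fun L => ?_)
  set t : ι → ℂ := fun i => L (Pi.single i 1) - L (Pi.single i Complex.I) * Complex.I with ht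
  have hL : ∀ x : ι → ℂ, L x = (∑ i, t i * x i).re := by
    intro x
    have hx : x = ∑ i, ((x i).re • (Pi.single i 1 : ι → ℂ) +
        (x i).im • (Pi.single i Complex.I : ι → ℂ)) := by
      ext j
      rw [Finset.sum_apply, Finset.sum_eq_single j]
      · simp [Complex.re_add_im]
      · intro b _ hb
        simp [Pi.single_eq_of_ne hb.symm]
      · simp
    conv_lhs => rw [hx]
    rw [map_sum, Complex.re_sum]
    refine Finset.sum_congr rfl fun i _ => ?_
    simp [ht]
    ring
  simp_rw [charFunDual_apply, hL]
  exact h t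

/-- The characteristic functional of a measure on `𝒜(𝔻)`. -/
def charFunctional {ι : Type*} [Fintype ι] (m : Measure AnalyticDisc) (z : ι → unitDisc)
    (t : ι → ℂ) : ℂ :=
  ∫ g : AnalyticDisc, Complex.exp (((∑ i, t i * g (z i)).re : ℝ) * Complex.I) ∂m

theorem measure_ext_of_charFunctional {m m' : Measure AnalyticDisc} [IsFiniteMeasure m]
    [IsFiniteMeasure m'] (h : ∀ (I : Finset ℕ) (z : I → unitDisc) (t : I → ℂ),
      charFunctional m z t = charFunctional m' z t) : m = m' := by
  set e := fun (g : AnalyticDisc) (n : ℕ) => g (TopologicalSpace.denseSeq unitDisc n) with he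
  have hem := measurableEmbedding_denseSeq
  suffices hm : m.map e = m'.map e by rw [← hem.comap_map m, ← hem.comap_map m', ← he, hm]
  have hem' : Measurable e := hem.measurable
  have : IsFiniteMeasure (m'.map e) := Measure.isFiniteMeasure_map m' e
  refine IsProjectiveLimit.unique (P := fun I => (m'.map e).map I.restrict) (fun I => ?_)
    (fun I => rfl)
  have : IsFiniteMeasure (m.map e) := Measure.isFiniteMeasure_map m e
  have hr : Measurable (fun x : ℕ → ℂ => I.restrict x) := Finset.measurable_restrict I
  have : IsFiniteMeasure ((m.map e).map I.restrict) := Measure.isFiniteMeasure_map _ _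
  have : IsFiniteMeasure ((m'.map e).map I.restrict) := Measure.isFiniteMeasure_map _ _
  refine Measure.ext_of_integral_cexp_re_sum fun t => ?_
  have key : ∀ m : Measure AnalyticDisc, ∫ x, Complex.exp (((∑ i, t i * x i).re : ℝ) * Complex.I)
      ∂((m.map e).map I.restrict) =
      charFunctional m (fun i : I => TopologicalSpace.denseSeq unitDisc i) t := by
    intro m
    rw [Measure.map_map hr hem', integral_map (hr.comp hem').aemeasurable
      (Continuous.aestronglyMeasurable (by fun_prop))]
    rfl
  rw [key, key]
  exact h I _ _

end AnalyticDisc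

/-! ### Series of analytic functions indexed by the noise space -/

theorem summable_sqrt_mul_gammaCoeff_mul_pow {α : ℝ} (hα : -1 < α) {r : ℝ} (h0 : 0 ≤ r)
    (h1 : r < 1) : Summable fun k : ℕ => Real.sqrt (1 + (k : ℝ) ^ 2) * gammaCoeff α k * r ^ k := by
  have hr : ‖r‖ < 1 := by rwa [Real.norm_eq_abs, abs_of_nonneg h0]
  refine Summable.of_nonneg_of_le
    (fun k => mul_nonneg (mul_nonneg (Real.sqrt_nonneg _) (gammaCoeff_pos hα k).le) (by positivity))
    (fun k => ?_) (((summable_geometric_of_lt_one h0 h1).add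
      (summable_pow_mul_geometric_of_norm_lt_one 2 hr)).add
      (summable_gammaCoeff_sq_mul_pow hα h0 h1))
  have h2 := Real.sq_sqrt (by positivity : 0 ≤ 1 + (k : ℝ) ^ 2)
  have h3 := gammaCoeff_pos hα k
  have h4 := Real.sqrt_nonneg (1 + (k : ℝ) ^ 2)
  have h5 : 0 ≤ r ^ k := by positivity
  have h6 : Real.sqrt (1 + (k : ℝ) ^ 2) * gammaCoeff α k ≤ 1 + (k : ℝ) ^ 2 +
      gammaCoeff α k ^ 2 := by
    nlinarith [sq_nonneg (Real.sqrt (1 + (k : ℝ) ^ 2) - gammaCoeff α k)]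
  calc _ ≤ (1 + (k : ℝ) ^ 2 + gammaCoeff α k ^ 2) * r ^ k := mul_le_mul_of_nonneg_right h6 h5
    _ = _ := by ring

/-- The terms `√(Γ(k+α+1)/k!) φ(z)ᵏ m(z)`. -/
def seriesTerm (α : ℝ) (φ m : ℂ → ℂ) (k : ℕ) (z : ℂ) : ℂ := gammaCoeff α k * φ z ^ k * m z

/-- A holomorphic self-map of the disc and a holomorphic multiplier. -/
structure IsDiscPair (φ m : ℂ → ℂ) : Prop where
  differentiableOn_map : DifferentiableOn ℂ φ unitDisc
  mapsTo : ∀ z ∈ unitDisc, ‖φ z‖ < 1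
  differentiableOn_multiplier : DifferentiableOn ℂ m unitDisc

/-- The sum `∑ₖ conj(yₖ) √(1+k²) √(Γ(k+α+1)/k!) φ(z)ᵏ m(z)`. -/
def noiseSum (α : ℝ) (φ m : ℂ → ℂ) (y : NoiseSpace) (z : ℂ) : ℂ :=
  ∑' k : ℕ, (starRingEnd ℂ) (y k) * ((Real.sqrt (1 + (k : ℝ) ^ 2) : ℝ) * seriesTerm α φ m k z)

section
variable {α : ℝ} {φ m : ℂ → ℂ}

theorem IsDiscPair.differentiableOn_seriesTerm (h : IsDiscPair φ m) (k : ℕ) :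
    DifferentiableOn ℂ (seriesTerm α φ m k) unitDisc :=
  ((h.differentiableOn_map.pow k).const_mul _).mul h.differentiableOn_multiplier

theorem IsDiscPair.exists_bound (h : IsDiscPair φ m) (hα : -1 < α) {z₀ : ℂ} (hz₀ : z₀ ∈ unitDisc) :
    ∃ U : Set ℂ, IsOpen U ∧ z₀ ∈ U ∧ U ⊆ unitDisc ∧ ∃ u : ℕ → ℝ, Summable u ∧
      ∀ k : ℕ, ∀ z ∈ U, ‖((Real.sqrt (1 + (k : ℝ) ^ 2) : ℝ) : ℂ) * seriesTerm α φ m k z‖ ≤ u k := by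
  obtain ⟨r, hr1, hr2⟩ := exists_between (h.mapsTo z₀ hz₀)
  have hr0 : 0 ≤ r := (norm_nonneg _).trans hr1.le
  have hD : IsOpen unitDisc := Metric.isOpen_ball
  have c1 : ∀ᶠ z in nhds z₀, ‖φ z‖ < r :=
    (h.differentiableOn_map.continuousOn.continuousAt
        (hD.mem_nhds hz₀)).norm.eventually_lt_const hr1
  have c2 : ∀ᶠ z in nhds z₀, ‖m z‖ < ‖m z₀‖ + 1 :=
    (h.differentiableOn_multiplier.continuousOn.continuousAt
      (hD.mem_nhds hz₀)).norm.eventually_lt_const (lt_add_one _)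
  obtain ⟨U, hU, hUo, hzU⟩ := eventually_nhds_iff.1 ((c1.and c2).and (hD.eventually_mem hz₀))
  refine ⟨U, hUo, hzU, fun z hz => (hU z hz).2, _,
    (summable_sqrt_mul_gammaCoeff_mul_pow hα hr0 hr2).mul_right (‖m z₀‖ + 1), fun k z hz => ?_⟩
  rw [seriesTerm, norm_mul, norm_mul, norm_mul, norm_pow, Complex.norm_real, Complex.norm_real,
    Real.norm_eq_abs, Real.norm_eq_abs, abs_of_nonneg (Real.sqrt_nonneg _),
    abs_of_pos (gammaCoeff_pos hα k), ← mul_assoc, ← mul_assoc]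
  have h1 := (hU z hz).1.1.le
  have h2 := (hU z hz).1.2.le
  have h3 := gammaCoeff_pos hα k
  gcongr

theorem IsDiscPair.summable_noise (h : IsDiscPair φ m) (hα : -1 < α) (y : NoiseSpace) {z : ℂ}
    (hz : z ∈ unitDisc) : Summable fun k : ℕ => (starRingEnd ℂ) (y k) *
      ((Real.sqrt (1 + (k : ℝ) ^ 2) : ℝ) * seriesTerm α φ m k z) := by
  obtain ⟨U, -, hzU, -, u, hu, hb⟩ := h.exists_bound hα hz
  refine Summable.of_norm_bounded (hu.mul_left ‖y‖) fun k => ?_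
  rw [norm_mul, RCLike.norm_conj]
  exact mul_le_mul (lp.norm_apply_le_norm (by norm_num) y k) (hb k z hzU) (norm_nonneg _)
    (norm_nonneg _)

theorem IsDiscPair.differentiableOn_noiseSum (h : IsDiscPair φ m) (hα : -1 < α) (y : NoiseSpace) :
    DifferentiableOn ℂ (noiseSum α φ m y) unitDisc := by
  intro z₀ hz₀
  obtain ⟨U, hU, hzU, hUD, u, hu, hb⟩ := h.exists_bound hα hz₀
  refine DifferentiableAt.differentiableWithinAt ?_
  refine DifferentiableOn.differentiableAt (s := U) ?_ (hU.mem_nhds hzU)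
  refine Complex.differentiableOn_tsum_of_summable_norm (hu.mul_left ‖y‖)
    (fun k => ((h.differentiableOn_seriesTerm k).mono hUD).const_mul _ |>.const_mul _) hU
    fun k z hz => ?_
  rw [norm_mul, RCLike.norm_conj]
  exact mul_le_mul (lp.norm_apply_le_norm (by norm_num) y k) (hb k z hz) (norm_nonneg _)
    (norm_nonneg _)

/-- `noiseSum` as an analytic function on the disc. -/
def IsDiscPair.noiseSeries (h : IsDiscPair φ m) (hα : -1 < α) (y : NoiseSpace) : AnalyticDisc :=
  AnalyticDisc.ofDifferentiableOn _ (h.differentiableOn_noiseSum hα y)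

theorem IsDiscPair.hasSum_noiseSeries (h : IsDiscPair φ m) (hα : -1 < α) (y : NoiseSpace)
    (z : unitDisc) : HasSum (fun k : ℕ => (starRingEnd ℂ) (y k) *
      ((Real.sqrt (1 + (k : ℝ) ^ 2) : ℝ) * seriesTerm α φ m k z)) (h.noiseSeries hα y z) :=
  (h.summable_noise hα y z.2).hasSum

theorem IsDiscPair.continuous_noiseSeries (h : IsDiscPair φ m) (hα : -1 < α) :
    Continuous (h.noiseSeries hα) := by
  refine Continuous.subtype_mk (ContinuousMap.continuous_of_continuous_uncurry _ ?_) _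
  rw [continuous_iff_continuousAt]
  rintro ⟨y₀, z₀⟩
  obtain ⟨U, hU, hzU, hUD, u, hu, hb⟩ := h.exists_bound hα z₀.2
  have hV : IsOpen (Metric.ball y₀ 1 ×ˢ ((↑) ⁻¹' U : Set unitDisc) : Set (NoiseSpace × unitDisc)) :=
    Metric.isOpen_ball.prod (hU.preimage continuous_subtype_val)
  refine ContinuousOn.continuousAt (s := Metric.ball y₀ 1 ×ˢ ((↑) ⁻¹' U : Set unitDisc)) ?_
    (hV.mem_nhds ⟨Metric.mem_ball_self one_pos, hzU⟩)
  refine continuousOn_tsum (u := fun k => (‖y₀‖ + 1) * u k) (fun k => ?_) (hu.mul_left _) ?_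
  · refine ContinuousOn.mul ?_ (continuousOn_const.mul ?_)
    · refine Continuous.continuousOn (Complex.continuous_conj.comp ?_)
      exact (lp.evalCLM ℂ (fun _ : ℕ => ℂ) 2 k).continuous.comp continuous_fst
    · refine Continuous.continuousOn ?_
      exact (h.differentiableOn_seriesTerm k).continuousOn.domRestrict.comp continuous_snd
  · rintro k ⟨y, z⟩ ⟨hy, hz⟩
    rw [norm_mul, RCLike.norm_conj]
    refine mul_le_mul ((lp.norm_apply_le_norm (by norm_num) y k).trans ?_) (hb k z hz)
      (norm_nonneg _) (by positivity)
    have := norm_sub_norm_le y y₀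
    have h2 : ‖y - y₀‖ < 1 := by simpa [dist_eq_norm] using hy
    linarith

end

theorem isDiscPair_id : IsDiscPair (fun z => z) (fun _ => 1) where
  differentiableOn_map := differentiableOn_id
  mapsTo z hz := by simpa using hz
  differentiableOn_multiplier := differentiableOn_const _

theorem isDiscPair_discInvolution {c : ℝ} (α : ℝ) (hc0 : 0 < c) (hc1 : c < 1) :
    IsDiscPair (discInvolution c) (discMultiplier α c) where
  differentiableOn_map := by
    intro z hz
    have := one_sub_sqrt_mul_ne_zero hc0 hc1 (z := z) (by simpa using hz)
    unfold discInvolution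
    exact ((by fun_prop : DifferentiableAt ℂ (fun z : ℂ => ((Real.sqrt c : ℝ) : ℂ) - z) z).div
      (by fun_prop) this).differentiableWithinAt
  mapsTo z hz := norm_discInvolution_lt_one hc0 hc1 (by simpa using hz)
  differentiableOn_multiplier := by
    intro z hz
    have hz' : ‖z‖ < 1 := by simpa using hz
    have hs : (1 - ((Real.sqrt c : ℝ) : ℂ) * z) ∈ Complex.slitPlane := by
      refine Or.inl ?_
      have h1 : ‖((Real.sqrt c : ℝ) : ℂ) * z‖ < 1 := by
        rw [norm_mul, Complex.norm_real, Real.norm_eq_abs, abs_of_nonneg (Real.sqrt_nonneg _)]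
        have h2 : Real.sqrt c < 1 := by rw [Real.sqrt_lt' one_pos]; simpa using hc1
        nlinarith [norm_nonneg z, Real.sqrt_nonneg c]
      have h2 := (Complex.re_le_norm (((Real.sqrt c : ℝ) : ℂ) * z))
      rw [Complex.sub_re, Complex.one_re]
      linarith
    unfold discMultiplier
    exact (((by fun_prop : DifferentiableAt ℂ (fun z : ℂ => 1 - ((Real.sqrt c : ℝ) : ℂ) * z) z).cpow_const
      hs).const_mul _).differentiableWithinAt

/-! ### The extension of the transform -/

section
variable {α c : ℝ}

/-- The extension of the transform to the noise space of the Meixner basis. -/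
def noiseTransform (hα : -1 < α) (hc0 : 0 < c) (hc1 : c < 1) : NoiseSpace → AnalyticDisc :=
  (isDiscPair_discInvolution α hc0 hc1).noiseSeries hα

theorem inner_meixnerBasis_transformKernel (hα : -1 < α) (hc0 : 0 < c) (hc1 : c < 1) (k : ℕ) {z : ℂ}
    (hz : ‖z‖ < 1) : inner ℂ (meixnerBasis hα hc0 hc1 k) (transformKernel hα hz) =
      seriesTerm α (discInvolution c) (discMultiplier α c) k z := by
  rw [← diskTransform_eq_inner hα, seriesTerm, ← diskTransform_meixnerFunction hα hc0 hc1 k hz]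
  simp_rw [meixnerBasis_apply]

theorem isTransformExtension_noiseTransform (hα : -1 < α) (hc0 : 0 < c) (hc1 : c < 1) :
    IsTransformExtension α (meixnerBasis hα hc0 hc1) (noiseTransform hα hc0 hc1) := by
  refine ⟨IsDiscPair.continuous_noiseSeries _ hα, fun f z => ?_⟩
  have hz : ‖(z : ℂ)‖ < 1 := mem_ball_zero_iff.1 z.2
  rw [diskTransform_eq_inner hα f hz]
  refine (IsDiscPair.hasSum_noiseSeries _ hα _ z).unique ?_
  refine ((meixnerBasis hα hc0 hc1).hasSum_inner_mul_inner f (transformKernel hα hz)).of_apply_eq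
    fun k => ?_
  have h : noiseEmbedding (meixnerBasis hα hc0 hc1) f k =
    (meixnerBasis hα hc0 hc1).repr f k / ((Real.sqrt (1 + (k : ℝ) ^ 2) : ℝ) : ℂ) := rfl
  have hk : ((Real.sqrt (1 + (k : ℝ) ^ 2) : ℝ) : ℂ) ≠ 0 := by
    rw [Complex.ofReal_ne_zero]; positivity
  rw [h, inner_meixnerBasis_transformKernel, HilbertBasis.repr_apply_apply, map_div₀,
      inner_conj_symm,
    Complex.conj_ofReal]
  field_simp

theorem IsTransformExtension.unique {b : HilbertBasis ℕ ℂ EllTwo} {L L' : NoiseSpace → AnalyticDisc}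
    (h : IsTransformExtension α b L) (h' : IsTransformExtension α b L') : L' = L :=
  (denseRange_noiseEmbedding b).equalizer h'.1 h.1
    (funext fun f => AnalyticDisc.ext fun z => (h'.2 f z).trans (h.2 f z).symm)

end

/-! ### Standard complex Gaussian variables -/

theorem integral_cexp_inner_stdComplexGaussian (t : ℂ) :
    ∫ z, Complex.exp ((inner ℝ z t : ℝ) * Complex.I) ∂stdComplexGaussian =
      Complex.exp (-‖t‖ ^ 2 / 4) := by
  have h2 : (Real.sqrt 2) ≠ 0 := by positivity
  rw [stdComplexGaussian, integral_map (by fun_prop) (by fun_prop)]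
  have h : ∀ p : ℝ × ℝ, Complex.exp ((inner ℝ (((p.1 : ℂ) + (p.2 : ℂ) * Complex.I) /
      ((Real.sqrt 2 : ℝ) : ℂ)) t : ℝ) * Complex.I) =
      Complex.exp (((t.re / Real.sqrt 2 : ℝ) : ℂ) * (p.1 : ℂ) * Complex.I) *
      Complex.exp (((t.im / Real.sqrt 2 : ℝ) : ℂ) * (p.2 : ℂ) * Complex.I) := by
    intro p
    rw [← Complex.exp_add]
    congr 1
    have : inner ℝ (((p.1 : ℂ) + (p.2 : ℂ) * Complex.I) / ((Real.sqrt 2 : ℝ) : ℂ)) t =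
      t.re / Real.sqrt 2 * p.1 + t.im / Real.sqrt 2 * p.2 := by
      rw [Complex.inner, Complex.mul_re, Complex.conj_re, Complex.conj_im, Complex.div_ofReal_re,
        Complex.div_ofReal_im]
      simp
      ring
    rw [this]
    push_cast
    ring
  simp_rw [h]
  rw [integral_prod_mul (fun x : ℝ => Complex.exp (((t.re / Real.sqrt 2 : ℝ) : ℂ) * (x : ℂ) * Complex.I))
    (fun x : ℝ => Complex.exp (((t.im / Real.sqrt 2 : ℝ) : ℂ) * (x : ℂ) * Complex.I)),
    ← charFun_apply_real, ← charFun_apply_real, charFun_gaussianReal, charFun_gaussianReal,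
    ← Complex.exp_add]
  congr 1
  have h3 : (Real.sqrt 2 : ℂ) ^ 2 = 2 := by
    rw [← Complex.ofReal_pow, Real.sq_sqrt (by norm_num)]; norm_num
  rw [← Complex.ofReal_pow ‖t‖, Complex.sq_norm, Complex.normSq_apply]
  push_cast
  rw [div_pow, div_pow, h3]
  ring

theorem integral_cexp_re_mul_stdComplexGaussian (t : ℂ) :
    ∫ z, Complex.exp (((t * z).re : ℝ) * Complex.I) ∂stdComplexGaussian =
      Complex.exp (-‖t‖ ^ 2 / 4) := by
  rw [← RCLike.norm_conj, ← integral_cexp_inner_stdComplexGaussian]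
  congr! 4 with z
  rw [Complex.inner, ← Complex.conj_re]
  simp

theorem integral_exp_neg_norm_sq : ∫ z : ℂ, Real.exp (-‖z‖ ^ 2) / Real.pi = 1 := by
  have h := Complex.integral_rpow_mul_exp_neg_rpow (p := 2) (q := 0) (by norm_num) (by norm_num)
  simp only [Real.rpow_zero, one_mul, Real.rpow_ofNat] at h
  rw [integral_div, h]
  simp

theorem integrable_exp_neg_norm_sq : Integrable fun z : ℂ => Real.exp (-‖z‖ ^ 2) / Real.pi := by
  by_contra h
  have := integral_exp_neg_norm_sq
  rw [integral_undef h] at this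
  exact zero_ne_one this

theorem integral_cexp_neg_norm_sq_add (s : ℝ) (hs : 0 < s) (a : ℂ) (w : ℂ) :
    ∫ z : ℂ, Complex.exp (-s * (‖z‖ : ℂ) ^ 2 + a * (inner ℝ w z : ℝ)) =
      Real.pi / s * Complex.exp (a ^ 2 * (‖w‖ : ℂ) ^ 2 / (4 * s)) := by
  have h := GaussianFourier.integral_cexp_neg_mul_sq_norm_add (b := (s : ℂ)) (V := ℂ)
    (by simpa using hs) a w
  rw [h]
  simp

theorem stdComplexGaussian_eq_withDensity : stdComplexGaussian =
    (volume : Measure ℂ).withDensity fun z => ENNReal.ofReal (Real.exp (-‖z‖ ^ 2) / Real.pi) := by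
  have : IsFiniteMeasure ((volume : Measure ℂ).withDensity fun z =>
    ENNReal.ofReal (Real.exp (-‖z‖ ^ 2) / Real.pi)) :=
    isFiniteMeasure_withDensity_ofReal integrable_exp_neg_norm_sq.2
  refine Measure.ext_of_charFun (funext fun t => ?_)
  rw [charFun_apply, charFun_apply, integral_cexp_inner_stdComplexGaussian,
    integral_withDensity_eq_integral_toReal_smul (by fun_prop) (by simp)]
  have h := integral_cexp_neg_norm_sq_add 1 one_pos Complex.I t
  have h2 : ∀ z : ℂ, (ENNReal.ofReal (Real.exp (-‖z‖ ^ 2) / Real.pi)).toReal •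
      Complex.exp ((inner ℝ z t : ℝ) * Complex.I) =
      (1 / Real.pi : ℂ) * Complex.exp (-(1 : ℝ) * (‖z‖ : ℂ) ^ 2 + Complex.I *
          (inner ℝ t z : ℝ)) := by
    intro z
    rw [ENNReal.toReal_ofReal (by positivity), Complex.exp_add, Complex.real_smul,
      real_inner_comm]
    push_cast
    ring_nf
  simp_rw [h2]
  rw [integral_const_mul, h]
  have hpi : (Real.pi : ℂ) ≠ 0 := Complex.ofReal_ne_zero.2 Real.pi_ne_zero
  simp only [Complex.ofReal_one, div_one, mul_one]
  rw [← mul_assoc, one_div, inv_mul_cancel₀ hpi, one_mul, Complex.I_sq]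
  ring_nf

theorem lintegral_stdComplexGaussian {f : ℂ → ℝ≥0∞} (hf : Measurable f) :
    ∫⁻ z, f z ∂stdComplexGaussian =
      ∫⁻ z, ENNReal.ofReal (Real.exp (-‖z‖ ^ 2) / Real.pi) * f z := by
  rw [stdComplexGaussian_eq_withDensity, lintegral_withDensity_eq_lintegral_mul _ (by fun_prop) hf]
  rfl

theorem integral_stdComplexGaussian {E : Type*} [NormedAddCommGroup E] [NormedSpace ℝ E]
    (f : ℂ → E) :
    ∫ z, f z ∂stdComplexGaussian = ∫ z : ℂ, (Real.exp (-‖z‖ ^ 2) / Real.pi) • f z := by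
  rw [stdComplexGaussian_eq_withDensity,
    integral_withDensity_eq_integral_toReal_smul (by fun_prop) (by simp)]
  congr! 2 with z
  rw [ENNReal.toReal_ofReal (by positivity)]

instance : NullSingletonClass stdComplexGaussian := by
  rw [stdComplexGaussian_eq_withDensity]; infer_instance

theorem integral_norm_pow_stdComplexGaussian (p : ℕ) :
    ∫ z, ‖z‖ ^ (2 * p) ∂stdComplexGaussian = p.factorial := by
  rw [integral_stdComplexGaussian]
  have h := Complex.integral_rpow_mul_exp_neg_rpow (p := 2) (q := (2 * p : ℕ)) (by norm_num)
    (by have : (0 : ℝ) ≤ (2 * p : ℕ) := Nat.cast_nonneg _; linarith)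
  simp only [Real.rpow_natCast, Real.rpow_ofNat] at h
  have h2 : ∀ z : ℂ, (Real.exp (-‖z‖ ^ 2) / Real.pi) • ‖z‖ ^ (2 * p) =
    Real.pi⁻¹ * (‖z‖ ^ (2 * p) * Real.exp (-‖z‖ ^ 2)) := fun z => by
    rw [smul_eq_mul]; ring
  simp_rw [h2]
  rw [integral_const_mul, h]
  have h3 : (((2 * p : ℕ) : ℝ) + 2) / 2 = p + 1 := by push_cast; ring
  rw [h3, Real.Gamma_nat_eq_factorial]
  have := Real.pi_ne_zero
  field_simp

theorem integrable_norm_pow_stdComplexGaussian (p : ℕ) :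
    Integrable (fun z : ℂ => ‖z‖ ^ (2 * p)) stdComplexGaussian := by
  by_contra h
  have := integral_norm_pow_stdComplexGaussian p
  rw [integral_undef h] at this
  have h2 := p.factorial_pos
  rw [eq_comm, Nat.cast_eq_zero] at this
  omega

theorem map_rotation_stdComplexGaussian (u : ℂ) (hu : ‖u‖ = 1) :
    stdComplexGaussian.map (fun z => u * z) = stdComplexGaussian := by
  have : IsProbabilityMeasure (stdComplexGaussian.map (fun z => u * z)) :=
    Measure.isProbabilityMeasure_map (by fun_prop)
  refine Measure.ext_of_charFun (funext fun t => ?_)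
  rw [charFun_apply, charFun_apply, integral_map (by fun_prop) (by fun_prop)]
  have h : ∀ z, inner ℝ (u * z) t = inner ℝ z ((starRingEnd ℂ) u * t) := fun z => by
    simp only [Complex.inner]
    congr 1
    rw [map_mul]; ring
  simp_rw [h]
  rw [integral_cexp_inner_stdComplexGaussian, integral_cexp_inner_stdComplexGaussian, norm_mul,
    RCLike.norm_conj, hu, one_mul]

theorem map_conj_stdComplexGaussian :
    stdComplexGaussian.map (starRingEnd ℂ) = stdComplexGaussian := by
  have hm : Measurable (starRingEnd ℂ) := Complex.continuous_conj.measurable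
  have : IsProbabilityMeasure (stdComplexGaussian.map (starRingEnd ℂ)) :=
    Measure.isProbabilityMeasure_map hm.aemeasurable
  refine Measure.ext_of_charFun (funext fun t => ?_)
  rw [charFun_apply, charFun_apply, integral_map hm.aemeasurable (by fun_prop)]
  have h : ∀ z, inner ℝ ((starRingEnd ℂ) z) t = inner ℝ z ((starRingEnd ℂ) t) := fun z => by
    simp only [Complex.inner]
    rw [← Complex.conj_re]
    simp
  simp_rw [h]
  rw [integral_cexp_inner_stdComplexGaussian, integral_cexp_inner_stdComplexGaussian,
    RCLike.norm_conj]

theorem integral_pow_mul_conj_pow_stdComplexGaussian (p q : ℕ) :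
    ∫ z, z ^ p * (starRingEnd ℂ) z ^ q ∂stdComplexGaussian = if p =
        q then (p.factorial : ℂ) else 0 := by
  split_ifs with hpq
  · subst hpq
    have h : ∀ z : ℂ, z ^ p * (starRingEnd ℂ) z ^ p = ((‖z‖ ^ (2 * p) : ℝ) : ℂ) := fun z => by
      rw [← mul_pow, Complex.mul_conj, Complex.normSq_eq_norm_sq, pow_mul]
      push_cast; rfl
    simp_rw [h]
    rw [integral_complex_ofReal, integral_norm_pow_stdComplexGaussian]
    simp
  · set θ : ℝ := Real.pi / ((p : ℝ) - q) with hθ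
    have hpq' : ((p : ℝ) - q) ≠ 0 := sub_ne_zero.2 (by exact_mod_cast hpq)
    set u := Complex.exp (θ * Complex.I) with hu
    have h1 : u ^ p * (starRingEnd ℂ) u ^ q = -1 := by
      rw [hu, ← Complex.exp_conj, ← Complex.exp_nat_mul, ← Complex.exp_nat_mul, ← Complex.exp_add,
        ← Complex.exp_pi_mul_I]
      congr 1
      have h3 : (((p : ℝ) - q : ℝ) : ℂ) * θ = Real.pi := by
        rw [← Complex.ofReal_mul, hθ, mul_div_cancel₀ _ hpq']
      push_cast at h3
      simp only [map_mul, Complex.conj_ofReal, Complex.conj_I]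
      linear_combination Complex.I * h3
    have h2 : ∫ z, z ^ p * (starRingEnd ℂ) z ^ q ∂stdComplexGaussian =
        -∫ z, z ^ p * (starRingEnd ℂ) z ^ q ∂stdComplexGaussian := by
      conv_lhs => rw [← map_rotation_stdComplexGaussian u (Complex.norm_exp_ofReal_mul_I θ)]
      rw [integral_map (by fun_prop) (by fun_prop), ← integral_neg]
      congr! 2 with z
      rw [map_mul, mul_pow, mul_pow]
      linear_combination (z ^ p * (starRingEnd ℂ) z ^ q) * h1
    exact self_eq_neg.1 h2

/-! ### Random series with independent complex Gaussian coefficients -/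

section
variable {Ω : Type*} [MeasurableSpace Ω] {P : Measure Ω} {a : ℕ → Ω → ℂ}

theorem integral_cexp_sum_gaussian (hm : ∀ k, Measurable (a k)) (hi : iIndepFun a P)
    (hl : ∀ k, P.map (a k) = stdComplexGaussian) (c : ℕ → ℂ) (s : Finset ℕ) :
    ∫ ω, Complex.exp (((∑ k ∈ s, a k ω * c k).re : ℝ) * Complex.I) ∂P =
      Complex.exp (-(∑ k ∈ s, ‖c k‖ ^ 2 : ℝ) / 4) := by
  have h : ∀ ω, Complex.exp (((∑ k ∈ s, a k ω * c k).re : ℝ) * Complex.I) =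
      ∏ k : s, Complex.exp (((c k * a k ω).re : ℝ) * Complex.I) := fun ω => by
    rw [← Complex.exp_sum, ← Finset.sum_mul, Complex.re_sum, Finset.sum_coe_sort s
      (fun k => (((c k * a k ω).re : ℝ) : ℂ))]
    push_cast
    simp_rw [mul_comm (c _)]
  simp_rw [h]
  have hi' : iIndepFun (fun k : s => a k) P := hi.precomp Subtype.val_injective
  rw [hi'.integral_fun_prod_comp (𝓧 := fun _ : s => ℂ) (f := fun (k : s) (z : ℂ) => Complex.exp
      (((c k * z).re : ℝ) * Complex.I))
    (fun k => (hm k).aemeasurable) (fun k => by fun_prop)]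
  have h2 : ∀ k : s, ∫ ω, Complex.exp (((c k * a k ω).re : ℝ) * Complex.I) ∂P =
      Complex.exp (-‖c k‖ ^ 2 / 4) := fun k => by
    rw [← integral_cexp_re_mul_stdComplexGaussian, ← hl k, integral_map (hm k).aemeasurable
      (by fun_prop)]
  simp_rw [h2]
  rw [← Complex.exp_sum, Finset.sum_coe_sort s (fun k => (-(‖c k‖ : ℂ) ^ 2 / 4))]
  push_cast
  rw [← Finset.sum_div, Finset.sum_neg_distrib]

theorem integral_cexp_series_gaussian [IsProbabilityMeasure P] (hm : ∀ k, Measurable (a k))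
    (hi : iIndepFun a P)
    (hl : ∀ k, P.map (a k) = stdComplexGaussian) (c : EllTwo) {X : Ω → ℂ}
    (hX : ∀ᵐ ω ∂P, HasSum (fun k => a k ω * c k) (X ω)) :
    ∫ ω, Complex.exp (((X ω).re : ℝ) * Complex.I) ∂P = Complex.exp (-‖c‖ ^ 2 / 4) := by
  have h2 : (0 : ℝ) < (2 : ℝ≥0∞).toReal := by norm_num
  have hn := lp.hasSum_norm h2 c
  simp only [ENNReal.toReal_ofNat, Real.rpow_ofNat] at hn
  have t1 : Filter.Tendsto (fun n => ∫ ω, Complex.exp (((∑ k ∈ Finset.range n,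
      a k ω * c k).re : ℝ) * Complex.I) ∂P) Filter.atTop
      (nhds (∫ ω, Complex.exp (((X ω).re : ℝ) * Complex.I) ∂P)) := by
    refine tendsto_integral_of_dominated_convergence (fun _ => 1) (fun n => ?_)
      (integrable_const _) (fun n => ?_) ?_
    · refine Measurable.aestronglyMeasurable ?_
      have := fun k => hm k
      fun_prop
    · refine Filter.Eventually.of_forall fun ω => ?_
      rw [Complex.norm_exp_ofReal_mul_I]
    · filter_upwards [hX] with ω hω
      have hc : Continuous fun z : ℂ => Complex.exp ((z.re : ℝ) * Complex.I) := by fun_prop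
      exact (hc.tendsto _).comp hω.tendsto_sum_nat
  have t2 : Filter.Tendsto (fun n => Complex.exp (-(∑ k ∈ Finset.range n, ‖c k‖ ^ 2 : ℝ) / 4))
      Filter.atTop (nhds (Complex.exp (-‖c‖ ^ 2 / 4))) := by
    have hc : Continuous fun x : ℝ => Complex.exp (-(x : ℂ) / 4) := by fun_prop
    have := (hc.tendsto _).comp hn.tendsto_sum_nat
    simp only [Complex.ofReal_pow] at this
    exact this
  refine tendsto_nhds_unique t1 (t2.congr fun n => ?_)
  rw [integral_cexp_sum_gaussian hm hi hl]

theorem ae_summable_gaussian_sq (hm : ∀ k, Measurable (a k))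
    (hl : ∀ k, P.map (a k) = stdComplexGaussian) :
    ∀ᵐ ω ∂P, Summable fun k => ‖a k ω‖ ^ 2 / (1 + (k : ℝ) ^ 2) := by
  have h1 : ∀ k, ∫⁻ ω, ENNReal.ofReal (‖a k ω‖ ^ 2 / (1 + (k : ℝ) ^ 2)) ∂P =
      ENNReal.ofReal (1 / (1 + (k : ℝ) ^ 2)) := fun k => by
    have hI : Integrable (fun z : ℂ => ‖z‖ ^ 2 / (1 + (k : ℝ) ^ 2)) stdComplexGaussian := by
      simpa using (integrable_norm_pow_stdComplexGaussian 1).div_const _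
    rw [← lintegral_map (f := fun z : ℂ => ENNReal.ofReal (‖z‖ ^ 2 / (1 + (k : ℝ) ^ 2)))
        (by fun_prop) (hm k),
      hl k, ← ofReal_integral_eq_lintegral_ofReal hI
        (Filter.Eventually.of_forall fun z => by positivity), integral_div]
    have := integral_norm_pow_stdComplexGaussian 1
    simp only [mul_one] at this
    rw [this]; simp
  have h2 : ∫⁻ ω, ∑' k, ENNReal.ofReal (‖a k ω‖ ^ 2 / (1 + (k : ℝ) ^ 2)) ∂P ≠ ⊤ := by
    rw [lintegral_tsum fun k => ?_]
    · simp_rw [h1]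
      refine Summable.tsum_ofReal_ne_top ?_
      refine Summable.of_nonneg_of_le (fun k => by positivity) (fun k => ?_)
        ((summable_nat_add_iff 1).2 (Real.summable_one_div_nat_pow.2 one_lt_two) |>.mul_left 2)
      push_cast
      rw [mul_one_div, div_le_div_iff₀ (by positivity) (by positivity)]
      nlinarith [sq_nonneg ((k : ℝ) - 1)]
    · have := hm k
      fun_prop
  have h3 : AEMeasurable (fun ω => ∑' k, ENNReal.ofReal (‖a k ω‖ ^ 2 / (1 + (k : ℝ) ^ 2))) P := by
    refine Measurable.aemeasurable (Measurable.tsum fun k => ?_)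
    have := hm k
    fun_prop
  filter_upwards [ae_lt_top' h3 h2] with ω hω
  refine (ENNReal.summable_toReal hω.ne).congr fun k => ?_
  rw [ENNReal.toReal_ofReal (by positivity)]

theorem aemeasurable_gaussianSeries (hm : ∀ k, Measurable (a k)) {V : unitDisc → EllTwo}
    {F : Ω → AnalyticDisc} (hF : ∀ᵐ ω ∂P, ∀ z, HasSum (fun k => a k ω * V z k) (F ω z)) :
    AEMeasurable F P := by
  refine AnalyticDisc.aemeasurable_of_eval fun z => ?_
  refine aemeasurable_of_tendsto_metrizable_ae Filter.atTop
    (f := fun n ω => ∑ k ∈ Finset.range n, a k ω * V z k) (fun n => ?_) ?_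
  · have := fun k => hm k
    fun_prop
  · filter_upwards [hF] with ω hω
    exact (hω z).tendsto_sum_nat

theorem charFunctional_gaussianSeries [IsProbabilityMeasure P] (hm : ∀ k, Measurable (a k))
    (hi : iIndepFun a P) (hl : ∀ k, P.map (a k) = stdComplexGaussian) {V : unitDisc → EllTwo}
    {F : Ω → AnalyticDisc} (hF : ∀ᵐ ω ∂P, ∀ z, HasSum (fun k => a k ω * V z k) (F ω z))
    {ι : Type*} [Fintype ι] (z : ι → unitDisc) (t : ι → ℂ) :
    AnalyticDisc.charFunctional (P.map F) z t = Complex.exp (-‖∑ i, t i • V (z i)‖ ^ 2 / 4) := by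
  have hmeas : Measurable fun g : AnalyticDisc =>
      Complex.exp (((∑ i, t i * g (z i)).re : ℝ) * Complex.I) := by
    have := fun i => AnalyticDisc.measurable_eval_const (z i)
    fun_prop
  rw [AnalyticDisc.charFunctional, integral_map (aemeasurable_gaussianSeries hm hF)
    hmeas.aestronglyMeasurable]
  refine integral_cexp_series_gaussian hm hi hl _ ?_
  filter_upwards [hF] with ω hω
  have h := hasSum_sum (s := Finset.univ) fun i _ => (hω (z i)).mul_left (t i)
  refine h.of_apply_eq fun k => ?_
  rw [lp.coeFn_sum, Finset.sum_apply, Finset.mul_sum]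
  refine Finset.sum_congr rfl fun i _ => ?_
  simp only [lp.coeFn_smul, Pi.smul_apply, smul_eq_mul]
  ring

end

/-! ### The law of the hyperbolic Gaussian analytic function -/

section
variable {α : ℝ}

/-- `transformKernel` at a point of the disc. -/
def discKernel (hα : -1 < α) (z : unitDisc) : EllTwo :=
  transformKernel hα (mem_ball_zero_iff.1 z.2)

theorem discKernel_apply (hα : -1 < α) (z : unitDisc) (k : ℕ) :
    discKernel hα z k = gammaCoeff α k * (z : ℂ) ^ k := rfl

theorem hasSum_hyperbolicSeries (hα : -1 < α) {a : ℕ → ℂ}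
    (ha : Summable fun k : ℕ => ‖a k‖ ^ 2 / (1 + (k : ℝ) ^ 2)) (z : unitDisc) :
    HasSum (fun k => a k * discKernel hα z k) (hyperbolicSeries α a z) := by
  have hmem : Memℓp (fun k : ℕ => (starRingEnd ℂ) (a k) / ((Real.sqrt (1 + (k : ℝ) ^ 2) : ℝ) :
      ℂ)) 2 := by
    rw [memℓp_gen_iff (by norm_num)]
    refine ha.congr fun k => ?_
    rw [norm_div, RCLike.norm_conj, Complex.norm_real, Real.norm_eq_abs, ENNReal.toReal_ofNat,
      Real.rpow_ofNat, div_pow, sq_abs, Real.sq_sqrt (by positivity)]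
  have hex : ∃ g : AnalyticDisc, ∀ z : unitDisc,
      HasSum (fun k => a k * (gammaCoeff α k : ℂ) * (z : ℂ) ^ k) (g z) := by
    refine ⟨isDiscPair_id.noiseSeries hα ⟨_, hmem⟩, fun z => ?_⟩
    refine (isDiscPair_id.hasSum_noiseSeries hα ⟨_, hmem⟩ z).of_apply_eq fun k => ?_
    have hk : ((Real.sqrt (1 + (k : ℝ) ^ 2) : ℝ) : ℂ) ≠ 0 := by
      rw [Complex.ofReal_ne_zero]; positivity
    simp only [seriesTerm, map_div₀, Complex.conj_conj, Complex.conj_ofReal]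
    field_simp
  rw [hyperbolicSeries, dif_pos hex]
  exact (hex.choose_spec z).of_apply_eq fun k => by rw [discKernel_apply, mul_assoc]

theorem iIndepFun_eval_infinitePi : iIndepFun (fun (k : ℕ) (a : ℕ → ℂ) => a k)
    (Measure.infinitePi fun _ : ℕ => stdComplexGaussian) :=
  iIndepFun_infinitePi (P := fun _ : ℕ => stdComplexGaussian) (X := fun _ z => z)
    fun _ => measurable_id

theorem map_eval_infinitePi_stdComplexGaussian (k : ℕ) :
    (Measure.infinitePi fun _ : ℕ => stdComplexGaussian).map (fun a : ℕ → ℂ => a k) =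
      stdComplexGaussian :=
  (measurePreserving_eval_infinitePi (fun _ : ℕ => stdComplexGaussian) k).map_eq

theorem ae_hasSum_hyperbolicSeries (hα : -1 < α) :
    ∀ᵐ a ∂(Measure.infinitePi fun _ : ℕ => stdComplexGaussian), ∀ z : unitDisc,
      HasSum (fun k => a k * discKernel hα z k) (hyperbolicSeries α a z) := by
  filter_upwards [ae_summable_gaussian_sq (a := fun (k : ℕ) (a : ℕ → ℂ) => a k)
    (fun k => measurable_pi_apply k) map_eval_infinitePi_stdComplexGaussian] with a ha
  exact hasSum_hyperbolicSeries hα ha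

theorem aemeasurable_hyperbolicSeries (hα : -1 < α) :
    AEMeasurable (hyperbolicSeries α) (Measure.infinitePi fun _ : ℕ => stdComplexGaussian) :=
  aemeasurable_gaussianSeries (fun k => measurable_pi_apply k) (ae_hasSum_hyperbolicSeries hα)

theorem isProbabilityMeasure_hyperbolicGAFLaw (hα : -1 < α) :
    IsProbabilityMeasure (hyperbolicGAFLaw α) :=
  Measure.isProbabilityMeasure_map (aemeasurable_hyperbolicSeries hα)

theorem charFunctional_hyperbolicGAFLaw (hα : -1 < α) {ι : Type*} [Fintype ι] (z : ι → unitDisc)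
    (t : ι → ℂ) : AnalyticDisc.charFunctional (hyperbolicGAFLaw α) z t =
      Complex.exp (-‖∑ i, t i • discKernel hα (z i)‖ ^ 2 / 4) :=
  charFunctional_gaussianSeries (a := fun (k : ℕ) (a : ℕ → ℂ) => a k)
    (fun k => measurable_pi_apply k) iIndepFun_eval_infinitePi
    map_eval_infinitePi_stdComplexGaussian (ae_hasSum_hyperbolicSeries hα) z t

/-! ### The law of the transform of white noise -/

section
variable {c : ℝ} {Ω : Type*} [MeasurableSpace Ω] {P : Measure Ω} {ξ : Ω → NoiseSpace}

theorem IsWhiteNoise.exists_hasSum_noiseTransform (hα : -1 < α) (hc0 : 0 < c) (hc1 : c < 1)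
    (hξ : IsWhiteNoise (meixnerBasis hα hc0 hc1) P ξ) :
    ∃ a : ℕ → Ω → ℂ, (∀ k, Measurable (a k)) ∧ iIndepFun a P ∧
      (∀ k, P.map (a k) = stdComplexGaussian) ∧ ∀ᵐ ω ∂P, ∀ z : unitDisc,
        HasSum (fun k => a k ω * (meixnerBasis hα hc0 hc1).repr (discKernel hα z) k)
          (noiseTransform hα hc0 hc1 (ξ ω) z) := by
  obtain ⟨ζ, hm, hi, hl, hs⟩ := hξ
  have hconj : Measurable (starRingEnd ℂ) := Complex.continuous_conj.measurable
  refine ⟨fun k ω => (starRingEnd ℂ) (ζ k ω), fun k => hconj.comp (hm k),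
    hi.comp (fun _ => starRingEnd ℂ) fun _ => hconj, fun k => ?_, ?_⟩
  · rw [← map_conj_stdComplexGaussian, ← hl k, Measure.map_map hconj (hm k)]
    rfl
  · filter_upwards [hs] with ω hω z
    have hcoord : ∀ i, ξ ω i = ζ i ω / ((Real.sqrt (1 + (i : ℝ) ^ 2) : ℝ) : ℂ) := by
      intro i
      have h1 := (lp.evalCLM ℂ (fun _ : ℕ => ℂ) 2 i).hasSum hω
      refine h1.unique ?_
      refine (hasSum_ite_eq i (ζ i ω / ((Real.sqrt (1 + (i : ℝ) ^ 2) : ℝ) : ℂ))).of_apply_eq fun k => ?_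
      have h2 : noiseEmbedding (meixnerBasis hα hc0 hc1) (meixnerBasis hα hc0 hc1 k) i =
        (meixnerBasis hα hc0 hc1).repr (meixnerBasis hα hc0 hc1 k) i /
          ((Real.sqrt (1 + (i : ℝ) ^ 2) : ℝ) : ℂ) := rfl
      change ζ k ω * noiseEmbedding (meixnerBasis hα hc0 hc1) (meixnerBasis hα hc0 hc1 k) i = _
      rw [h2, HilbertBasis.repr_self]
      by_cases hki : k = i
      · subst hki; simp [div_eq_mul_inv]
      · simp [hki]
    refine (IsDiscPair.hasSum_noiseSeries _ hα (ξ ω) z).of_apply_eq fun k => ?_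
    have hk : ((Real.sqrt (1 + (k : ℝ) ^ 2) : ℝ) : ℂ) ≠ 0 := by
      rw [Complex.ofReal_ne_zero]; positivity
    rw [hcoord, map_div₀, Complex.conj_ofReal, HilbertBasis.repr_apply_apply, discKernel,
      inner_meixnerBasis_transformKernel]
    field_simp

theorem aemeasurable_noiseTransform (hα : -1 < α) (hc0 : 0 < c) (hc1 : c < 1)
    (hξ : IsWhiteNoise (meixnerBasis hα hc0 hc1) P ξ) :
    AEMeasurable (fun ω => noiseTransform hα hc0 hc1 (ξ ω)) P := by
  obtain ⟨a, hm, -, -, hs⟩ := hξ.exists_hasSum_noiseTransform hα hc0 hc1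
  exact aemeasurable_gaussianSeries hm hs

theorem map_noiseTransform [IsProbabilityMeasure P] (hα : -1 < α) (hc0 : 0 < c) (hc1 : c < 1)
    (hξ : IsWhiteNoise (meixnerBasis hα hc0 hc1) P ξ) :
    P.map (fun ω => noiseTransform hα hc0 hc1 (ξ ω)) = hyperbolicGAFLaw α := by
  have hae := aemeasurable_noiseTransform hα hc0 hc1 hξ
  obtain ⟨a, hm, hi, hl, hs⟩ := hξ.exists_hasSum_noiseTransform hα hc0 hc1
  have := Measure.isProbabilityMeasure_map hae
  have := isProbabilityMeasure_hyperbolicGAFLaw hα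
  refine AnalyticDisc.measure_ext_of_charFunctional fun I z t => ?_
  rw [charFunctional_hyperbolicGAFLaw hα, charFunctional_gaussianSeries hm hi hl hs]
  have : ∑ i, t i • (meixnerBasis hα hc0 hc1).repr (discKernel hα (z i)) =
      (meixnerBasis hα hc0 hc1).repr (∑ i, t i • discKernel hα (z i)) := by
    simp
  rw [this, LinearIsometryEquiv.norm_map]

end
end

/-! ### The area formula for holomorphic functions -/

theorem abs_det_smulRight_eq_normSq (d : ℂ) :
    |((ContinuousLinearMap.toSpanSingleton ℂ d).restrictScalars ℝ).det| = ‖d‖ ^ 2 := by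
  have h : (((ContinuousLinearMap.toSpanSingleton ℂ d).restrictScalars ℝ : ℂ →L[ℝ] ℂ) : ℂ →ₗ[ℝ] ℂ) =
      LinearMap.mulLeft ℝ d := by
    ext x
    simp [mul_comm]
  rw [ContinuousLinearMap.det, h, ← Complex.normSq_eq_norm_sq]
  have := Algebra.norm_complex_apply d
  rw [Algebra.norm_apply] at this
  rw [← abs_of_nonneg (Complex.normSq_nonneg d), ← this]
  rfl

section
variable {U : Set ℂ} {g : ℂ → ℂ}

theorem hasFDerivWithinAt_real_of_differentiableOn (hU : IsOpen U) (hg : DifferentiableOn ℂ g U)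
    {s : Set ℂ} {x : ℂ} (hx : x ∈ U) :
    HasFDerivWithinAt g ((ContinuousLinearMap.toSpanSingleton ℂ (deriv g x)).restrictScalars ℝ) s x :=
  ((hg.differentiableAt (hU.mem_nhds hx)).hasDerivAt.hasFDerivAt.restrictScalars ℝ).hasFDerivWithinAt

/-- The area formula on a set where the function is injective. -/
theorem lintegral_sum_fiber_of_injOn (hU : IsOpen U) (hg : DifferentiableOn ℂ g U) {A : Set ℂ}
    (hA : MeasurableSet A) (hAU : A ⊆ U) (hinj : Set.InjOn g A) {Ψ : ℂ → ℝ≥0∞} (hΨ : Measurable Ψ) :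
    Measurable (fun u => ∑' x, (A ∩ g ⁻¹' {u}).indicator Ψ x) ∧
    ∫⁻ u, ∑' x, (A ∩ g ⁻¹' {u}).indicator Ψ x =
      ∫⁻ x in A, ENNReal.ofReal (‖deriv g x‖ ^ 2) * Ψ x := by
  have hd : ∀ x ∈ A, HasFDerivWithinAt g
      ((ContinuousLinearMap.toSpanSingleton ℂ (deriv g x)).restrictScalars ℝ) A x := fun x hx =>
    hasFDerivWithinAt_real_of_differentiableOn hU hg (hAU hx)
  have hemb := measurableEmbedding_of_fderivWithin hA hd hinj
  set S : ℂ → ℝ≥0∞ := fun u => ∑' x, (A ∩ g ⁻¹' {u}).indicator Ψ x with hS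
  have hS1 : ∀ x ∈ A, S (g x) = Ψ x := by
    intro x hx
    rw [hS]
    dsimp only
    rw [tsum_eq_single x, Set.indicator_of_mem (show x ∈ A ∩ g ⁻¹' {g x} from ⟨hx, rfl⟩)]
    intro y hy
    refine Set.indicator_of_notMem (fun h => hy ?_) _
    exact hinj h.1 hx h.2
  have hS0 : ∀ u, u ∉ g '' A → S u = 0 := by
    intro u hu
    refine ENNReal.tsum_eq_zero.2 fun x => Set.indicator_of_notMem (fun h => hu ?_) _
    exact ⟨x, h.1, h.2⟩
  have hSext : S = Function.extend (A.domRestrict g) (fun x : A => Ψ x) 0 := by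
    ext u
    by_cases hu : u ∈ g '' A
    · obtain ⟨x, hx, rfl⟩ := hu
      rw [hS1 x hx]
      exact (hemb.injective.extend_apply (fun x : A => Ψ x) 0 ⟨x, hx⟩).symm
    · rw [hS0 u hu, Function.extend_apply']
      · rfl
      · rintro ⟨x, hx⟩
        exact hu ⟨x, x.2, hx⟩
  refine ⟨?_, ?_⟩
  · rw [hSext]
    exact hemb.measurable_extend (hΨ.comp measurable_subtype_coe) measurable_zero
  · have h := lintegral_image_eq_lintegral_abs_det_fderiv_mul volume hA hd hinj S
    have h1 : ∫⁻ u, S u = ∫⁻ u in g '' A, S u := by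
      refine (setLIntegral_eq_of_support_subset fun u hu => ?_).symm
      by_contra h
      exact hu (hS0 u h)
    rw [h1, h]
    refine setLIntegral_congr_fun hA fun x hx => ?_
    simp only [abs_det_smulRight_eq_normSq, hS1 x hx]

/-- **Area formula** for a holomorphic function. -/
theorem lintegral_sum_fiber (hU : IsOpen U) (hg : DifferentiableOn ℂ g U) {Ψ : ℂ → ℝ≥0∞}
    (hΨ : Measurable Ψ) :
    ∫⁻ u, ∑' x, (U ∩ g ⁻¹' {u}).indicator Ψ x =
      ∫⁻ x in U, ENNReal.ofReal (‖deriv g x‖ ^ 2) * Ψ x := by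
  have hdc : ContinuousOn (deriv g) U := (hg.deriv hU).continuousOn
  set R : Set ℂ := U ∩ deriv g ⁻¹' {0}ᶜ with hR
  have hRo : IsOpen R := hdc.isOpen_inter_preimage hU isOpen_compl_singleton
  have hloc : ∀ x : R, ∃ V : Set ℂ, IsOpen V ∧ (x : ℂ) ∈ V ∧ V ⊆ R ∧ Set.InjOn g V := by
    rintro ⟨x, hx⟩
    have hs : HasStrictDerivAt g (deriv g x) x :=
      ((hg.analyticOnNhd hU) x hx.1).hasStrictDerivAt
    set e := (hs.hasStrictFDerivAt_equiv hx.2).toOpenPartialHomeomorph g with he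
    refine ⟨e.source ∩ R, e.open_source.inter hRo,
      ⟨(hs.hasStrictFDerivAt_equiv hx.2).mem_toOpenPartialHomeomorph_source, hx⟩,
      Set.inter_subset_right, ?_⟩
    exact (e.injOn.mono Set.inter_subset_left)
  choose V hVo hxV hVR hVi using hloc
  obtain ⟨T, hTc, hT⟩ := TopologicalSpace.isOpen_iUnion_countable V hVo
  have hVR' : ⋃ i, V i = R := Set.Subset.antisymm (Set.iUnion_subset hVR)
    fun x hx => Set.mem_iUnion.2 ⟨⟨x, hx⟩, hxV _⟩
  obtain ⟨f, hf⟩ := ((hTc.image V).insert ∅).exists_eq_range (Set.insert_nonempty _ _)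
  have hf1 : ∀ n, f n = ∅ ∨ ∃ i, V i = f n := by
    intro n
    have h : f n ∈ insert ∅ (V '' T) := by rw [hf]; exact ⟨n, rfl⟩
    rcases h with h | ⟨i, -, h⟩
    · exact Or.inl h
    · exact Or.inr ⟨i, h⟩
  have hfm : ∀ n, MeasurableSet (f n) := fun n => by
    rcases hf1 n with h | ⟨i, h⟩
    · rw [h]; exact MeasurableSet.empty
    · rw [← h]; exact (hVo i).measurableSet
  have hfi : ∀ n, Set.InjOn g (f n) := fun n => by
    rcases hf1 n with h | ⟨i, h⟩
    · rw [h]; exact Set.injOn_empty _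
    · rw [← h]; exact hVi i
  have hfR : ⋃ n, f n = R := by
    rw [← Set.sUnion_range, ← hf, Set.sUnion_insert, Set.empty_union, Set.sUnion_image, hT, hVR']
  set A := disjointed f with hA
  have hAm : ∀ n, MeasurableSet (A n) := fun n => MeasurableSet.disjointed hfm n
  have hAd : Pairwise (Function.onFun Disjoint A) := disjoint_disjointed f
  have hAR : ⋃ n, A n = R := by rw [hA, iUnion_disjointed, hfR]
  have hAU : ∀ n, A n ⊆ U := fun n =>
    (Set.subset_iUnion A n).trans (hAR.subset.trans Set.inter_subset_left)
  have hAi : ∀ n, Set.InjOn g (A n) := fun n => (hfi n).mono (disjointed_subset f n)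
  have hnull : volume (g '' (U ∩ deriv g ⁻¹' {0})) = 0 := by
    refine addHaar_image_eq_zero_of_det_fderivWithin_eq_zero volume (fun x hx =>
      hasFDerivWithinAt_real_of_differentiableOn hU hg hx.1) fun x hx => ?_
    rw [← abs_eq_zero, abs_det_smulRight_eq_normSq, hx.2, norm_zero, zero_pow two_ne_zero]
  have hfib : ∀ᵐ u, ∑' x, (U ∩ g ⁻¹' {u}).indicator Ψ x =
      ∑' n, ∑' x, (A n ∩ g ⁻¹' {u}).indicator Ψ x := by
    filter_upwards [measure_eq_zero_iff_ae_notMem.1 hnull] with u hu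
    rw [ENNReal.tsum_comm]
    refine tsum_congr fun x => ?_
    by_cases hx : x ∈ U ∩ g ⁻¹' {u}
    · have hxR : x ∈ R := ⟨hx.1, fun h0 => hu ⟨x, ⟨hx.1, h0⟩, hx.2⟩⟩
      rw [← hAR] at hxR
      obtain ⟨n, hn⟩ := Set.mem_iUnion.1 hxR
      rw [Set.indicator_of_mem hx, tsum_eq_single n, Set.indicator_of_mem (Set.mem_inter hn hx.2)]
      intro m hm
      refine Set.indicator_of_notMem (fun h => ?_) _
      exact Set.disjoint_left.1 (hAd hm) h.1 hn
    · rw [Set.indicator_of_notMem hx, eq_comm, ENNReal.tsum_eq_zero]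
      exact fun n => Set.indicator_of_notMem (fun h => hx ⟨hAU n h.1, h.2⟩) _
  rw [lintegral_congr_ae hfib, lintegral_tsum fun n =>
    (lintegral_sum_fiber_of_injOn hU hg (hAm n) (hAU n) (hAi n) hΨ).1.aemeasurable]
  simp_rw [fun n => (lintegral_sum_fiber_of_injOn hU hg (hAm n) (hAU n) (hAi n) hΨ).2]
  rw [← lintegral_iUnion hAm hAd, hAR, ← lintegral_indicator hRo.measurableSet,
    ← lintegral_indicator hU.measurableSet]
  refine lintegral_congr fun x => ?_
  by_cases hxR : x ∈ R
  · rw [Set.indicator_of_mem hxR, Set.indicator_of_mem hxR.1]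
  · rw [Set.indicator_of_notMem hxR]
    by_cases hxU : x ∈ U
    · have h0 : deriv g x = 0 := by
        by_contra h
        exact hxR ⟨hxU, h⟩
      rw [Set.indicator_of_mem hxU, h0]
      simp
    · rw [Set.indicator_of_notMem hxU]

end

/-! ### The zero set as a random measure -/

namespace AnalyticDisc

theorem mem_zeros_iff {g : AnalyticDisc} {z : ℂ} : z ∈ g.zeros ↔ z ∈ unitDisc ∧ g.extend z = 0 := by
  constructor
  · rintro ⟨w, hw, rfl⟩
    exact ⟨w.2, (extend_coe g w).trans hw⟩
  · rintro ⟨hz, h⟩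
    exact ⟨⟨z, hz⟩, (extend_of_mem g hz).symm.trans h, rfl⟩

open Classical in
/-- The zero set of a nonzero analytic function, and the empty set for the zero function. -/
def properZeros (g : AnalyticDisc) : Set ℂ := if g = 0 then ∅ else g.zeros

theorem properZeros_of_ne_zero {g : AnalyticDisc} (hg : g ≠ 0) : g.properZeros = g.zeros :=
  if_neg hg

theorem properZeros_zero : (0 : AnalyticDisc).properZeros = ∅ := if_pos rfl

theorem properZeros_subset (g : AnalyticDisc) : g.properZeros ⊆ unitDisc := by
  by_cases hg : g = 0
  · rw [hg, properZeros_zero]; exact Set.empty_subset _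
  · rw [properZeros_of_ne_zero hg]; exact fun z hz => (mem_zeros_iff.1 hz).1

theorem finite_zeros_inter {g : AnalyticDisc} (hg : g ≠ 0) {C : Set ℂ} (hC : IsCompact C)
    (hCD : C ⊆ unitDisc) : (g.zeros ∩ C).Finite := by
  by_contra hinf
  obtain ⟨z, hzC, hz⟩ := Set.Infinite.exists_accPt_of_subset_isCompact hinf hC Set.inter_subset_right
  have hf := accPt_iff_frequently_nhdsNE.1 hz
  have ha := g.differentiableOn_extend.analyticOnNhd Metric.isOpen_ball
  have h0 := ha.eqOn_zero_of_preconnected_of_frequently_eq_zero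
    (convex_ball (0 : ℂ) 1).isPreconnected (hCD hzC)
    (hf.mono fun w hw => (mem_zeros_iff.1 hw.1).2)
  exact hg (ext fun w => by rw [← extend_coe, h0 w.2]; rfl)

theorem finite_properZeros_inter (g : AnalyticDisc) {C : Set ℂ} (hC : IsCompact C)
    (hCD : C ⊆ unitDisc) : (g.properZeros ∩ C).Finite := by
  by_cases hg : g = 0
  · rw [hg, properZeros_zero, Set.empty_inter]; exact Set.finite_empty
  · rw [properZeros_of_ne_zero hg]; exact finite_zeros_inter hg hC hCD

theorem isClosed_exists_zeros {m : ℕ} {K : Set (Fin m → unitDisc)} (hK : IsCompact K) :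
    IsClosed {g : AnalyticDisc | ∃ x ∈ K, ∀ i, g (x i) = 0} := by
  have := isCompact_iff_compactSpace.1 hK
  have hcl : IsClosed {p : AnalyticDisc × K | ∀ i, p.1 (p.2.1 i) = 0} := by
    simp only [Set.ofPred_forall]
    refine isClosed_iInter fun i => isClosed_eq ?_ continuous_const
    exact continuous_eval.comp (continuous_fst.prodMk
      ((continuous_apply i).comp (continuous_subtype_val.comp continuous_snd)))
  convert isClosedMap_fst_of_compactSpace _ hcl using 1
  ext g
  constructor
  · rintro ⟨x, hx, h⟩
    exact ⟨(g, ⟨x, hx⟩), h, rfl⟩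
  · rintro ⟨⟨g', x⟩, h, rfl⟩
    exact ⟨x, x.2, h⟩

theorem natCast_le_encard_iff {β : Type*} (s : Set β) (m : ℕ) :
    (m : ℕ∞) ≤ s.encard ↔ ∃ x : Fin m → β, Function.Injective x ∧ ∀ i, x i ∈ s := by
  constructor
  · intro h
    obtain ⟨t, hts, ht⟩ := Set.exists_subset_encard_eq h
    have htf : t.Finite := Set.finite_of_encard_eq_coe ht
    have := htf.to_subtype
    have hn : Nat.card t = m := by
      rw [Nat.card_coe_set_eq, Set.ncard, ht]; rfl
    let e := Finite.equivFinOfCardEq hn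
    exact ⟨fun i => e.symm i, Subtype.val_injective.comp e.symm.injective,
      fun i => hts (e.symm i).2⟩
  · rintro ⟨x, hx, hxs⟩
    have h1 : (Set.range x).encard ≤ s.encard :=
      Set.encard_le_encard (Set.range_subset_iff.2 hxs)
    rw [← Set.image_univ, hx.injOn.encard_image, Set.encard_univ] at h1
    simpa using h1

theorem measurableSet_le_encard_zeros {C : Set ℂ} (hC : IsCompact C) (hCD : C ⊆ unitDisc) (m : ℕ) :
    MeasurableSet {g : AnalyticDisc | (m : ℕ∞) ≤ (g.zeros ∩ C).encard} := by
  set C' : Set unitDisc := (↑) ⁻¹' C with hC'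
  have hC'c : IsCompact C' :=
    Topology.IsInducing.subtypeVal.isCompact_preimage' hC (by rwa [Subtype.range_val])
  have h : {g : AnalyticDisc | (m : ℕ∞) ≤ (g.zeros ∩ C).encard} = ⋃ n : ℕ,
      {g : AnalyticDisc | ∃ x ∈ {x : Fin m → unitDisc | (∀ i, x i ∈ C') ∧
        ∀ i j, i ≠ j → 1 / ((n : ℝ) + 1) ≤ dist (x i) (x j)}, ∀ i, g (x i) = 0} := by
    ext g
    simp only [Set.mem_ofPred_eq, natCast_le_encard_iff, Set.mem_iUnion]
    constructor
    · rintro ⟨x, hx, hxz⟩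
      choose w hw using fun i => (hxz i).1
      have hwC : ∀ i, w i ∈ C' := fun i => by
        show ((w i : unitDisc) : ℂ) ∈ C
        rw [(hw i).2]; exact (hxz i).2
      have hwi : ∀ i j, i ≠ j → 0 < dist (w i) (w j) := fun i j hij => dist_pos.2 fun h =>
        hij (hx (by rw [← (hw i).2, ← (hw j).2, h]))
      have hev : ∀ᶠ n : ℕ in Filter.atTop, ∀ i j, i ≠ j →
          1 / ((n : ℝ) + 1) ≤ dist (w i) (w j) := by
        rw [Filter.eventually_all]
        intro i
        rw [Filter.eventually_all]
        intro j
        by_cases hij : i = j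
        · exact Filter.Eventually.of_forall fun n h => absurd hij h
        · filter_upwards [tendsto_one_div_add_atTop_nhds_zero_nat.eventually
            (gt_mem_nhds (hwi i j hij))] with n hn _
          exact hn.le
      obtain ⟨n, hn⟩ := hev.exists
      exact ⟨n, w, ⟨hwC, hn⟩, fun i => (hw i).1⟩
    · rintro ⟨n, w, ⟨hwC, hwd⟩, hw⟩
      refine ⟨fun i => w i, fun i j hij => ?_, fun i => ⟨⟨w i, hw i, rfl⟩, hwC i⟩⟩
      by_contra hne
      have h1 := hwd i j hne
      rw [Subtype.ext hij, dist_self] at h1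
      have : (0 : ℝ) < 1 / ((n : ℝ) + 1) := by positivity
      linarith
  rw [h]
  refine MeasurableSet.iUnion fun n => (isClosed_exists_zeros ?_).measurableSet
  have hpi : IsCompact {x : Fin m → unitDisc | ∀ i, x i ∈ C'} := by
    have := isCompact_univ_pi fun _ : Fin m => hC'c
    convert this using 1
    ext x; simp
  have hcl : IsClosed {x : Fin m → unitDisc |
      ∀ i j, i ≠ j → 1 / ((n : ℝ) + 1) ≤ dist (x i) (x j)} := ?_
  · exact hpi.inter_right hcl
  simp only [Set.ofPred_forall]
  refine isClosed_iInter fun i => isClosed_iInter fun j => isClosed_iInter fun _ => ?_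
  exact isClosed_le continuous_const ((continuous_apply i).dist (continuous_apply j))

/-- The counting measure of the zeros. -/
def zeroMeasure (g : AnalyticDisc) : Measure ℂ :=
  Measure.sum fun x : g.properZeros => Measure.dirac (x : ℂ)

theorem lintegral_zeroMeasure (g : AnalyticDisc) (f : ℂ → ℝ≥0∞) :
    ∫⁻ z, f z ∂g.zeroMeasure = ∑' z, g.properZeros.indicator f z := by
  rw [zeroMeasure, lintegral_sum_measure, ← tsum_subtype]
  simp_rw [lintegral_dirac]

theorem zeroMeasure_apply (g : AnalyticDisc) {C : Set ℂ} (hC : MeasurableSet C) :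
    g.zeroMeasure C = ((g.properZeros ∩ C).encard : ℝ≥0∞) := by
  rw [← lintegral_indicator_one hC, lintegral_zeroMeasure, ← ENNReal.tsum_set_one,
    tsum_subtype (g.properZeros ∩ C) (fun _ => (1 : ℝ≥0∞))]
  refine tsum_congr fun z => ?_
  rw [Set.inter_comm, Set.indicator_indicator, Set.inter_comm]
  rfl

theorem measurable_zeroMeasure_compact {C : Set ℂ} (hC : IsCompact C) (hCD : C ⊆ unitDisc) :
    Measurable fun g : AnalyticDisc => g.zeroMeasure C := by
  refine measurable_of_Ioi fun a => ?_
  have h : (fun g : AnalyticDisc => g.zeroMeasure C) ⁻¹' Set.Ioi a =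
      {0}ᶜ ∩ ⋃ m : {m : ℕ // a < m}, {g : AnalyticDisc | ((m : ℕ) : ℕ∞) ≤
          (g.zeros ∩ C).encard} := by
    ext g
    simp only [Set.mem_preimage, Set.mem_Ioi, zeroMeasure_apply g hC.measurableSet,
        Set.mem_inter_iff,
      Set.mem_compl_iff, Set.mem_singleton_iff, Set.mem_iUnion, Set.mem_ofPred_eq]
    constructor
    · intro h
      have hg : g ≠ 0 := by
        rintro rfl
        simp [properZeros_zero] at h
      refine ⟨hg, ?_⟩
      rw [properZeros_of_ne_zero hg] at h
      have hfin := finite_zeros_inter hg hC hCD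
      rw [hfin.encard_eq_coe_toFinset_card] at h ⊢
      exact ⟨⟨hfin.toFinset.card, by simpa using h⟩, le_rfl⟩
    · rintro ⟨hg, ⟨m, hm⟩, h⟩
      rw [properZeros_of_ne_zero hg]
      refine hm.trans_le ?_
      have := ENat.toENNReal_le.2 h
      simpa using this
  rw [h]
  exact (measurableSet_singleton 0).compl.inter
    (MeasurableSet.iUnion fun m => measurableSet_le_encard_zeros hC hCD m)

/-- The exhaustion of the disc by closed discs. -/
def closedDisc (n : ℕ) : Set ℂ := Metric.closedBall 0 (1 - 1 / ((n : ℝ) + 1))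

theorem isCompact_closedDisc (n : ℕ) : IsCompact (closedDisc n) := isCompact_closedBall _ _

theorem closedDisc_subset (n : ℕ) : closedDisc n ⊆ unitDisc :=
  Metric.closedBall_subset_ball (by
    have : (0 : ℝ) < 1 / ((n : ℝ) + 1) := by positivity
    linarith)

theorem monotone_closedDisc : Monotone closedDisc := fun m n hmn =>
  Metric.closedBall_subset_closedBall (by
    have : 1 / ((n : ℝ) + 1) ≤ 1 / ((m : ℝ) + 1) := by gcongr
    linarith)

theorem iUnion_closedDisc : ⋃ n, closedDisc n = unitDisc := by
  refine Set.Subset.antisymm (Set.iUnion_subset closedDisc_subset) fun z hz => ?_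
  have hz' : 0 < 1 - ‖z‖ := by have := mem_ball_zero_iff.1 hz; linarith
  obtain ⟨n, hn⟩ := (tendsto_one_div_add_atTop_nhds_zero_nat.eventually (gt_mem_nhds hz')).exists
  refine Set.mem_iUnion.2 ⟨n, mem_closedBall_zero_iff.2 ?_⟩
  linarith

open Classical in
/-- The counting measure of the zeros in `closedDisc n`, if there are at most `M` of them. -/
def truncatedZeroMeasure (n M : ℕ) (g : AnalyticDisc) : Measure ℂ :=
  if g.zeroMeasure (closedDisc n) ≤ M then g.zeroMeasure.restrict (closedDisc n) else 0

theorem truncatedZeroMeasure_univ_le (n M : ℕ) (g : AnalyticDisc) :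
    truncatedZeroMeasure n M g Set.univ ≤ M := by
  rw [truncatedZeroMeasure]
  split_ifs with h
  · simpa using h
  · simp

instance (n M : ℕ) (g : AnalyticDisc) : IsFiniteMeasure (truncatedZeroMeasure n M g) :=
  ⟨(truncatedZeroMeasure_univ_le n M g).trans_lt (ENNReal.natCast_lt_top M)⟩

theorem measurable_truncatedZeroMeasure (n M : ℕ) : Measurable (truncatedZeroMeasure n M) := by
  have key : ∀ C : Set ℂ, IsClosed C → Measurable fun g => truncatedZeroMeasure n M g C := by
    intro C hC
    classical
    have h : (fun g => truncatedZeroMeasure n M g C) = fun g : AnalyticDisc =>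
        if g.zeroMeasure (closedDisc n) ≤ M then g.zeroMeasure (C ∩ closedDisc n) else 0 := by
      ext g
      rw [truncatedZeroMeasure]
      split_ifs
      · rw [Measure.restrict_apply hC.measurableSet]
      · rfl
    rw [h]
    refine Measurable.ite ?_ ?_ measurable_const
    · exact measurableSet_le (measurable_zeroMeasure_compact (isCompact_closedDisc n)
        (closedDisc_subset n)) measurable_const
    · exact measurable_zeroMeasure_compact ((isCompact_closedDisc n).inter_left hC)
        (Set.inter_subset_right.trans (closedDisc_subset n))
  refine Measurable.measure_of_isPiSystem (S := {C | IsClosed C})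
    (BorelSpace.measurable_eq.trans borel_eq_generateFrom_isClosed) isPiSystem_isClosed key
    (key _ isClosed_univ)

/-- `truncatedZeroMeasure` as a kernel. -/
def truncatedZeroKernel (n M : ℕ) : Kernel AnalyticDisc ℂ :=
  ⟨truncatedZeroMeasure n M, measurable_truncatedZeroMeasure n M⟩

instance (n M : ℕ) : IsFiniteKernel (truncatedZeroKernel n M) :=
  ⟨⟨M, ENNReal.natCast_lt_top M, truncatedZeroMeasure_univ_le n M⟩⟩

theorem zeroMeasure_closedDisc_lt_top (g : AnalyticDisc) (n : ℕ) :
    g.zeroMeasure (closedDisc n) < ⊤ := by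
  rw [zeroMeasure_apply g (isCompact_closedDisc n).measurableSet,
    (g.finite_properZeros_inter (isCompact_closedDisc n)
      (closedDisc_subset n)).encard_eq_coe_toFinset_card]
  simp

theorem lintegral_zeroMeasure_eq_iSup (g : AnalyticDisc) (f : ℂ → ℝ≥0∞) :
    ∫⁻ z, f z ∂g.zeroMeasure = ⨆ n : ℕ, ⨆ M : ℕ, ∫⁻ z, f z ∂truncatedZeroKernel n M g := by
  have h1 : ∫⁻ z, f z ∂g.zeroMeasure = ∫⁻ z in ⋃ n, closedDisc n, f z ∂g.zeroMeasure := by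
    rw [iUnion_closedDisc, ← lintegral_indicator Metric.isOpen_ball.measurableSet,
      lintegral_zeroMeasure, lintegral_zeroMeasure, Set.indicator_indicator,
      Set.inter_eq_left.2 g.properZeros_subset]
  rw [h1, setLIntegral_iUnion_of_directed _ monotone_closedDisc.directed_le]
  refine iSup_congr fun n => le_antisymm ?_ (iSup_le fun M => ?_)
  · obtain ⟨M, hM⟩ := ENNReal.exists_nat_gt (g.zeroMeasure_closedDisc_lt_top n).ne
    refine le_iSup_of_le M (le_of_eq ?_)
    show _ = ∫⁻ z, f z ∂truncatedZeroMeasure n M g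
    rw [truncatedZeroMeasure, if_pos hM.le]
  · show ∫⁻ z, f z ∂truncatedZeroMeasure n M g ≤ _
    rw [truncatedZeroMeasure]
    split_ifs
    · exact le_rfl
    · simp

theorem measurable_tsum_properZeros {β : Type*} [MeasurableSpace β]
    {Ψ : (β × AnalyticDisc) × ℂ → ℝ≥0∞} (hΨ : Measurable Ψ) :
    Measurable fun p : β × AnalyticDisc =>
      ∑' z, p.2.properZeros.indicator (fun z => Ψ (p, z)) z := by
  simp_rw [← lintegral_zeroMeasure, lintegral_zeroMeasure_eq_iSup]
  refine Measurable.iSup fun n => Measurable.iSup fun M => ?_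
  exact hΨ.lintegral_kernel_prod_right' (κ := (truncatedZeroKernel n M).comap Prod.snd measurable_snd)

end AnalyticDisc

namespace AnalyticDisc

/-! ### Operations on analytic functions and their measurability -/

theorem measurable_extend : Measurable fun p : AnalyticDisc × ℂ => p.1.extend p.2 := by
  have hD : MeasurableSet ((Set.univ : Set AnalyticDisc) ×ˢ unitDisc) :=
    MeasurableSet.univ.prod Metric.isOpen_ball.measurableSet
  refine measurable_of_restrict_of_restrict_compl hD ?_ ?_
  · have h : ((Set.univ : Set AnalyticDisc) ×ˢ unitDisc).domRestrict
        (fun p : AnalyticDisc × ℂ => p.1.extend p.2) =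
        (fun p : AnalyticDisc × unitDisc => p.1 p.2) ∘ fun p => (p.1.1, ⟨p.1.2, p.2.2⟩) := by
      ext p
      exact extend_of_mem _ p.2.2
    rw [h]
    exact continuous_eval.measurable.comp (by fun_prop)
  · have h : ((Set.univ : Set AnalyticDisc) ×ˢ unitDisc)ᶜ.domRestrict
        (fun p : AnalyticDisc × ℂ => p.1.extend p.2) = fun _ => 0 := by
      ext p
      refine Function.extend_apply' _ _ _ ?_
      rintro ⟨z, hz⟩
      exact p.2 ⟨trivial, by rw [← hz]; exact z.2⟩
    rw [h]
    exact measurable_const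

theorem _root_.Measurable.discExtend {β : Type*} [MeasurableSpace β] {F : β → AnalyticDisc}
    {z : β → ℂ}
    (hF : Measurable F) (hz : Measurable z) : Measurable fun b => (F b).extend (z b) :=
  measurable_extend.comp (hF.prodMk hz)

/-- The function `z ↦ u + z H(z)`. -/
def addMul (u : ℂ) (H : AnalyticDisc) : AnalyticDisc :=
  ofDifferentiableOn (fun z => u + z * H.extend z)
    ((differentiableOn_id.mul H.differentiableOn_extend).const_add u)

theorem addMul_apply (u : ℂ) (H : AnalyticDisc) (z : unitDisc) :
    addMul u H z = u + z * H z := by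
  rw [← extend_coe H]; rfl

theorem extend_addMul (u : ℂ) (H : AnalyticDisc) {z : ℂ} (hz : z ∈ unitDisc) :
    (addMul u H).extend z = u + z * H.extend z := extend_of_mem _ hz

theorem measurable_addMul : Measurable fun p : ℂ × AnalyticDisc => addMul p.1 p.2 := by
  refine measurable_of_eval fun z => ?_
  simp_rw [addMul_apply]
  exact measurable_fst.add (((measurable_eval_const z).comp measurable_snd).const_mul _)

theorem _root_.Measurable.discAddMul {β : Type*} [MeasurableSpace β] {F : β → AnalyticDisc}
    {u : β → ℂ}
    (hu : Measurable u) (hF : Measurable F) : Measurable fun b => addMul (u b) (F b) :=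
  measurable_addMul.comp (hu.prodMk hF)

/-- The Blaschke factor `(z - w) / (1 - conj(w) z)`. -/
def _root_.blaschke (w z : ℂ) : ℂ := (z - w) / (1 - (starRingEnd ℂ) w * z)

theorem _root_.one_sub_conj_mul_ne_zero {w z : ℂ} (hw : ‖w‖ < 1) (hz : ‖z‖ < 1) :
    1 - (starRingEnd ℂ) w * z ≠ 0 := by
  intro h
  have h1 : ‖(starRingEnd ℂ) w * z‖ = 1 := by rw [← sub_eq_zero.1 h]; simp
  rw [norm_mul, RCLike.norm_conj] at h1
  nlinarith [norm_nonneg w, norm_nonneg z]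

theorem _root_.differentiableOn_blaschke {w : ℂ} (hw : ‖w‖ < 1) :
    DifferentiableOn ℂ (blaschke w) unitDisc := by
  intro z hz
  have h := one_sub_conj_mul_ne_zero hw (mem_ball_zero_iff.1 hz)
  unfold blaschke
  exact ((by fun_prop : DifferentiableAt ℂ (fun z : ℂ => z - w) z).div
      (by fun_prop) h).differentiableWithinAt

theorem _root_.blaschke_eq_zero_iff {w z : ℂ} (hw : ‖w‖ < 1) (hz : ‖z‖ < 1) :
    blaschke w z = 0 ↔ z = w := by
  rw [blaschke, div_eq_zero_iff, or_iff_left (one_sub_conj_mul_ne_zero hw hz), sub_eq_zero]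

theorem _root_.measurable_blaschke : Measurable fun p : ℂ × ℂ => blaschke p.1 p.2 := by
  unfold blaschke
  exact (measurable_snd.sub measurable_fst).div (measurable_const.sub
    ((Complex.continuous_conj.measurable.comp measurable_fst).mul measurable_snd))

open Classical in
/-- The product of an analytic function with a Blaschke factor. -/
def blaschkeMul (w : ℂ) (H : AnalyticDisc) : AnalyticDisc :=
  if h : ‖w‖ < 1 then ofDifferentiableOn (fun z => blaschke w z * H.extend z)
    ((differentiableOn_blaschke h).mul H.differentiableOn_extend) else 0

theorem blaschkeMul_apply {w : ℂ} (hw : ‖w‖ < 1) (H : AnalyticDisc) (z : unitDisc) :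
    blaschkeMul w H z = blaschke w z * H z := by
  rw [← extend_coe H, blaschkeMul, dif_pos hw]; rfl

theorem extend_blaschkeMul {w : ℂ} (hw : ‖w‖ < 1) (H : AnalyticDisc) {z : ℂ} (hz : z ∈ unitDisc) :
    (blaschkeMul w H).extend z = blaschke w z * H.extend z := by
  rw [extend_of_mem _ hz, extend_of_mem _ hz, blaschkeMul_apply hw]

theorem measurable_blaschkeMul : Measurable fun p : ℂ × AnalyticDisc => blaschkeMul p.1 p.2 := by
  classical
  refine measurable_of_eval fun z => ?_
  have h : (fun p : ℂ × AnalyticDisc => blaschkeMul p.1 p.2 z) = fun p =>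
      if ‖p.1‖ < 1 then blaschke p.1 z * p.2 z else 0 := by
    ext p
    split_ifs with hp
    · exact blaschkeMul_apply hp _ _
    · rw [blaschkeMul, dif_neg hp]; rfl
  rw [h]
  refine Measurable.ite (measurableSet_lt (by fun_prop) measurable_const) ?_ measurable_const
  exact (measurable_blaschke.comp (measurable_fst.prodMk measurable_const)).mul
    ((measurable_eval_const z).comp measurable_snd)

theorem _root_.Measurable.discBlaschkeMul {β : Type*} [MeasurableSpace β] {F : β → AnalyticDisc}
    {w : β → ℂ} (hw : Measurable w) (hF : Measurable F) : Measurable fun b => blaschkeMul (w b)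
        (F b) :=
  measurable_blaschkeMul.comp (hw.prodMk hF)

theorem properZeros_blaschkeMul {w : ℂ} (hw : ‖w‖ < 1) (H : AnalyticDisc) {z : ℂ} (hzw : z ≠ w) :
    z ∈ (blaschkeMul w H).properZeros ↔ z ∈ H.properZeros := by
  by_cases hH : H = 0
  · have : blaschkeMul w H = 0 := ext fun z => by
      rw [blaschkeMul_apply hw, hH, zero_apply, mul_zero]
    rw [this, hH]
  · have : blaschkeMul w H ≠ 0 := by
      intro h
      apply hH
      have hc : IsPreconnected unitDisc := (convex_ball (0 : ℂ) 1).isPreconnected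
      have ha := H.differentiableOn_extend.analyticOnNhd Metric.isOpen_ball
      have hwD : w ∈ unitDisc := mem_ball_zero_iff.2 hw
      have h0 := ha.eqOn_zero_of_preconnected_of_frequently_eq_zero hc hwD (by
        refine Filter.Eventually.frequently ?_
        filter_upwards [self_mem_nhdsWithin,
          mem_nhdsWithin_of_mem_nhds (Metric.isOpen_ball.mem_nhds hwD)] with y hy hyD
        have h1 := extend_blaschkeMul hw H hyD
        rw [h, extend_of_mem _ hyD, zero_apply, eq_comm, mul_eq_zero,
          blaschke_eq_zero_iff hw (mem_ball_zero_iff.1 hyD)] at h1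
        exact h1.resolve_left hy)
      exact ext fun y => by rw [← extend_coe, h0 y.2]; rfl
    rw [properZeros_of_ne_zero hH, properZeros_of_ne_zero this, mem_zeros_iff, mem_zeros_iff]
    refine and_congr_right fun hz => ?_
    rw [extend_blaschkeMul hw H hz, mul_eq_zero, blaschke_eq_zero_iff hw (mem_ball_zero_iff.1 hz),
      or_iff_right hzw]

open Classical in
/-- The derivative, extended by zero. -/
def discDeriv (F : AnalyticDisc) (z : ℂ) : ℂ := if z ∈ unitDisc then deriv F.extend z else 0

theorem measurable_discDeriv : Measurable fun p : AnalyticDisc × ℂ => discDeriv p.1 p.2 := by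
  classical
  refine measurable_of_tendsto_metrizable (f := fun (n : ℕ) (p : AnalyticDisc × ℂ) =>
    if p.2 ∈ unitDisc then ((n : ℂ) + 1) * (p.1.extend (p.2 + 1 / ((n : ℂ) + 1)) -
        p.1.extend p.2) else 0)
    (fun n => ?_) ?_
  · refine Measurable.ite (measurable_snd Metric.isOpen_ball.measurableSet) ?_ measurable_const
    exact ((measurable_fst.discExtend (measurable_snd.add_const _)).sub
      (measurable_fst.discExtend measurable_snd)).const_mul _
  · rw [tendsto_pi_nhds]
    rintro ⟨F, z⟩
    by_cases hz : z ∈ unitDisc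
    · simp only [hz, if_true, discDeriv]
      have hd := (F.differentiableOn_extend.differentiableAt
          (Metric.isOpen_ball.mem_nhds hz)).hasDerivAt
      have ht := hd.tendsto_slope_zero
      have hseq : Filter.Tendsto (fun n : ℕ => 1 / ((n : ℂ) + 1)) Filter.atTop
          (nhdsWithin 0 {0}ᶜ) := by
        refine tendsto_nhdsWithin_iff.2 ⟨tendsto_one_div_add_atTop_nhds_zero_nat, ?_⟩
        exact Filter.Eventually.of_forall fun n => one_div_ne_zero (Nat.cast_add_one_ne_zero n)
      refine (ht.comp hseq).congr fun n => ?_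
      simp [smul_eq_mul]
    · simp only [hz, if_false, discDeriv]
      exact tendsto_const_nhds

theorem discDeriv_addMul (u : ℂ) (H : AnalyticDisc) {z : ℂ} (hz : z ∈ unitDisc) :
    discDeriv (addMul u H) z = deriv (fun z => z * H.extend z) z := by
  rw [discDeriv, if_pos hz]
  have h : (addMul u H).extend =ᶠ[nhds z] fun z => u + z * H.extend z := by
    filter_upwards [Metric.isOpen_ball.mem_nhds hz] with y hy
    exact extend_addMul u H hy
  rw [h.deriv_eq, deriv_const_add]

theorem discDeriv_blaschkeMul {w : ℂ} (hw : ‖w‖ < 1) (H : AnalyticDisc) :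
    discDeriv (blaschkeMul w H) w = H.extend w / (1 - (‖w‖ : ℂ) ^ 2) := by
  have hwD : w ∈ unitDisc := mem_ball_zero_iff.2 hw
  rw [discDeriv, if_pos hwD]
  have h : (blaschkeMul w H).extend =ᶠ[nhds w] fun z => blaschke w z * H.extend z := by
    filter_upwards [Metric.isOpen_ball.mem_nhds hwD] with y hy
    exact extend_blaschkeMul hw H hy
  have hne := one_sub_conj_mul_ne_zero hw hw
  have hb : HasDerivAt (blaschke w) (1 / (1 - (starRingEnd ℂ) w * w)) w := by
    have h1 : HasDerivAt (fun z => z - w) 1 w := (hasDerivAt_id w).sub_const w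
    have h2 : HasDerivAt (fun z => 1 - (starRingEnd ℂ) w * z) (-((starRingEnd ℂ) w * 1)) w :=
      ((hasDerivAt_id w).const_mul _).const_sub 1
    have := h1.div h2 hne
    refine this.congr_deriv ?_
    rw [sub_self, zero_mul, sub_zero, one_mul, div_eq_div_iff (pow_ne_zero 2 hne) hne]
    ring
  have hH := (H.differentiableOn_extend.differentiableAt
      (Metric.isOpen_ball.mem_nhds hwD)).hasDerivAt
  rw [h.deriv_eq, (hb.fun_mul hH).deriv, (blaschke_eq_zero_iff hw hw).2 rfl, Complex.conj_mul']
  ring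

end AnalyticDisc

/-! ### Two identities in law for the hyperbolic Gaussian analytic function with `α = 0` -/

/-- The Szegő kernel function `(zᵏ)ₖ` in `ℓ²`. -/
abbrev szegoVector (z : unitDisc) : EllTwo := discKernel (by norm_num : (-1 : ℝ) < 0) z

theorem inner_szegoVector (z w : unitDisc) : inner ℂ (szegoVector z) (szegoVector w) =
    1 / (1 - (starRingEnd ℂ) (z : ℂ) * w) := by
  have h := lp.hasSum_inner (𝕜 := ℂ) (szegoVector z) (szegoVector w)
  have hlt : ‖(starRingEnd ℂ) (z : ℂ) * w‖ < 1 := by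
    rw [norm_mul, RCLike.norm_conj]
    have h1 := mem_ball_zero_iff.1 z.2
    have h2 := mem_ball_zero_iff.1 w.2
    nlinarith [norm_nonneg (z : ℂ), norm_nonneg (w : ℂ)]
  refine h.unique ?_
  rw [one_div]
  refine (hasSum_geometric_of_norm_lt_one hlt).of_apply_eq fun k => ?_
  rw [discKernel_apply, discKernel_apply, gammaCoeff_zero]
  simp [mul_pow, mul_comm]

theorem norm_sum_smul_sq {E ι : Type*} [NormedAddCommGroup E] [InnerProductSpace ℂ E] [Fintype ι]
    (t : ι → ℂ) (v : ι → E) : ((‖∑ i, t i • v i‖ : ℂ)) ^ 2 =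
      ∑ i, ∑ j, (starRingEnd ℂ) (t i) * t j * inner ℂ (v i) (v j) := by
  have h : ∀ x : E, ((‖x‖ : ℂ)) ^ 2 = inner ℂ x x := fun x => by
    rw [inner_self_eq_norm_sq_to_K]; rfl
  rw [h, sum_inner]
  simp_rw [inner_sum, inner_smul_left, inner_smul_right]
  exact Finset.sum_congr rfl fun i _ => Finset.sum_congr rfl fun j _ => by ring

namespace AnalyticDisc

/-- The law of the hyperbolic Gaussian analytic function with `α = 0`. -/
abbrev gafLaw : Measure AnalyticDisc := hyperbolicGAFLaw 0

instance : IsProbabilityMeasure gafLaw :=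
  isProbabilityMeasure_hyperbolicGAFLaw (by norm_num)

theorem charFunctional_gafLaw {ι : Type*} [Fintype ι] (z : ι → unitDisc) (t : ι → ℂ) :
    charFunctional gafLaw z t = Complex.exp (-‖∑ i, t i • szegoVector (z i)‖ ^ 2 / 4) :=
  charFunctional_hyperbolicGAFLaw _ z t

theorem measurable_cexp_eval {ι : Type*} [Fintype ι] (z : ι → unitDisc) (t : ι → ℂ) :
    Measurable fun g : AnalyticDisc => Complex.exp (((∑ i, t i * g (z i)).re : ℝ) * Complex.I) := by
  have := fun i => AnalyticDisc.measurable_eval_const (z i)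
  fun_prop

theorem map_addMul_gafLaw :
    (stdComplexGaussian.prod gafLaw).map (fun p => addMul p.1 p.2) = gafLaw := by
  have hmeas := measurable_addMul
  have : IsProbabilityMeasure ((stdComplexGaussian.prod gafLaw).map fun p => addMul p.1 p.2) :=
    Measure.isProbabilityMeasure_map hmeas.aemeasurable
  refine measure_ext_of_charFunctional fun I z t => ?_
  rw [charFunctional_gafLaw, charFunctional, integral_map hmeas.aemeasurable
    (measurable_cexp_eval z t).aestronglyMeasurable]
  have h : ∀ p : ℂ × AnalyticDisc, Complex.exp (((∑ i, t i * addMul p.1 p.2 (z i)).re : ℝ) *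
      Complex.I) =
      Complex.exp ((((∑ i, t i) * p.1).re : ℝ) * Complex.I) *
      Complex.exp (((∑ i, (t i * z i) * p.2 (z i)).re : ℝ) * Complex.I) := fun p => by
    have h1 : ∑ i, t i * addMul p.1 p.2 (z i) =
        (∑ i, t i) * p.1 + ∑ i, (t i * z i) * p.2 (z i) := by
      rw [Finset.sum_mul, ← Finset.sum_add_distrib]
      exact Finset.sum_congr rfl fun i _ => by rw [addMul_apply]; ring
    rw [h1, ← Complex.exp_add, ← add_mul, ← Complex.ofReal_add, ← Complex.add_re]
  simp_rw [h]
  rw [integral_prod_mul (fun u : ℂ => Complex.exp ((((∑ i, t i) * u).re : ℝ) * Complex.I))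
    (fun g : AnalyticDisc => Complex.exp (((∑ i, (t i * z i) * g (z i)).re : ℝ) * Complex.I)),
    integral_cexp_re_mul_stdComplexGaussian]
  have h2 := charFunctional_gafLaw z (fun i => t i * z i)
  rw [charFunctional] at h2
  rw [h2, ← Complex.exp_add]
  congr 1
  rw [norm_sum_smul_sq, norm_sum_smul_sq, ← add_div, ← neg_add]
  congr 2
  have h3 : (‖∑ i, t i‖ : ℂ) ^ 2 = ∑ i, ∑ j, (starRingEnd ℂ) (t i) * t j := by
    rw [← Complex.conj_mul', map_sum, Finset.sum_mul_sum]
  rw [h3, ← Finset.sum_add_distrib]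
  refine Finset.sum_congr rfl fun i _ => ?_
  rw [← Finset.sum_add_distrib]
  refine Finset.sum_congr rfl fun j _ => ?_
  have hne := one_sub_conj_mul_ne_zero (mem_ball_zero_iff.1 (z i).2) (mem_ball_zero_iff.1 (z j).2)
  rw [inner_szegoVector, map_mul]
  field_simp
  ring

theorem integral_cexp_norm_add_smul_sq {E : Type*} [NormedAddCommGroup E] [InnerProductSpace ℂ E]
    (x y : E) :
    ∫ η, Complex.exp (-‖y + η • x‖ ^ 2 / 4) ∂stdComplexGaussian =
      1 / ((1 + ‖x‖ ^ 2 / 4 : ℝ) : ℂ) * Complex.exp (-(‖y‖ ^ 2 - ‖inner ℂ y x‖ ^ 2 /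
        (4 * (1 + ‖x‖ ^ 2 / 4)) : ℝ) / 4) := by
  set s : ℝ := 1 + ‖x‖ ^ 2 / 4 with hs
  have hs0 : 0 < s := by positivity
  rw [integral_stdComplexGaussian]
  have h : ∀ η : ℂ, (Real.exp (-‖η‖ ^ 2) / Real.pi) • Complex.exp (-‖y + η • x‖ ^ 2 / 4) =
      (1 / Real.pi * Complex.exp (-(‖y‖ : ℂ) ^ 2 / 4)) * Complex.exp (-s * (‖η‖ : ℂ) ^ 2 +
        (-1 / 2 : ℂ) * (inner ℝ ((starRingEnd ℂ) (inner ℂ y x)) η : ℝ)) := by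
    intro η
    have h1 : ‖y + η • x‖ ^ 2 = ‖y‖ ^ 2 + 2 * (inner ℝ ((starRingEnd ℂ) (inner ℂ y x)) η : ℝ) +
        ‖η‖ ^ 2 * ‖x‖ ^ 2 := by
      rw [@norm_add_sq ℂ, norm_smul, mul_pow, inner_smul_right, Complex.inner]
      simp [mul_comm]
    have h2 : ((‖y + η • x‖ : ℂ)) ^ 2 = (‖y‖ : ℂ) ^ 2 +
        2 * ((inner ℝ ((starRingEnd ℂ) (inner ℂ y x)) η : ℝ) : ℂ) + (‖η‖ : ℂ) ^ 2 *
            (‖x‖ : ℂ) ^ 2 := by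
      exact_mod_cast h1
    rw [h2, Complex.real_smul, hs]
    push_cast
    rw [div_mul_eq_mul_div, ← Complex.exp_add, one_div, mul_assoc, ← Complex.exp_add,
        div_eq_inv_mul]
    congr 2
    ring
  simp_rw [h]
  rw [integral_const_mul, integral_cexp_neg_norm_sq_add s hs0, RCLike.norm_conj]
  have hpi : (Real.pi : ℂ) ≠ 0 := Complex.ofReal_ne_zero.2 Real.pi_ne_zero
  have hsc : (s : ℂ) ≠ 0 := Complex.ofReal_ne_zero.2 hs0.ne'
  have h3 : Complex.exp (-(‖y‖ ^ 2 - ‖inner ℂ y x‖ ^ 2 / (4 * s) : ℝ) / 4) =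
      Complex.exp (-(‖y‖ : ℂ) ^ 2 / 4) *
        Complex.exp ((-1 / 2) ^ 2 * (‖inner ℂ y x‖ : ℂ) ^ 2 / (4 * s)) := by
    rw [← Complex.exp_add]
    congr 1
    push_cast
    field_simp
    ring
  rw [h3]
  field_simp

theorem szego_schur_complement {a b u w : ℂ} (h1 : 1 - a * b ≠ 0) (h2 : 1 - a * w ≠ 0)
    (h3 : 1 - u * b ≠ 0) (h4 : 1 - u * w ≠ 0) :
    (a * b * (1 / (1 - a * b)) - a * w * (1 / (1 - a * w)) - u * b * (1 / (1 - u * b)) +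
      u * w * (1 / (1 - u * w))) -
      (2 * w * (a * (1 / (1 - a * w)) - u * (1 / (1 - u * w)))) *
        (2 * u * (b * (1 / (1 - u * b)) - w * (1 / (1 - u * w)))) / (4 * (1 / (1 - u * w))) =
      (a - u) / (1 - a * w) * ((b - w) / (1 - u * b)) * (1 / (1 - a * b)) := by
  generalize hA : 1 - a * b = A at *
  generalize hB : 1 - a * w = B at *
  generalize hC : 1 - u * b = C at *
  generalize hD : 1 - u * w = D at *
  field_simp
  rw [← hA, ← hB, ← hC, ← hD]
  ring

theorem tilted_gafLaw {w : ℂ} (hw : ‖w‖ < 1) :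
    (gafLaw.withDensity fun H => ENNReal.ofReal (Real.exp (-‖w * H.extend w‖ ^ 2))).map
      (fun H => addMul (-(w * H.extend w)) H) =
    ENNReal.ofReal (1 - ‖w‖ ^ 2) • gafLaw.map (blaschkeMul w) := by
  have hX : Measurable fun H : AnalyticDisc => w * H.extend w :=
    (measurable_id.discExtend measurable_const).const_mul w
  have hA : Measurable fun H : AnalyticDisc => addMul (-(w * H.extend w)) H :=
    hX.neg.discAddMul measurable_id
  have hB : Measurable (blaschkeMul w) := measurable_const.discBlaschkeMul measurable_id
  have hdm : Measurable fun H : AnalyticDisc =>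
    ENNReal.ofReal (Real.exp (-‖w * H.extend w‖ ^ 2)) := by fun_prop
  have hw2 : 0 < 1 - ‖w‖ ^ 2 := by nlinarith [norm_nonneg w]
  have : IsFiniteMeasure (gafLaw.withDensity fun H : AnalyticDisc =>
      ENNReal.ofReal (Real.exp (-‖w * H.extend w‖ ^ 2))) := by
    refine isFiniteMeasure_withDensity_ofReal (Integrable.of_bound (C := 1) ?_ ?_).2
    · exact Measurable.aestronglyMeasurable (by fun_prop)
    · refine Filter.Eventually.of_forall fun H => ?_
      rw [Real.norm_eq_abs, Real.abs_exp, Real.exp_le_one_iff]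
      nlinarith [sq_nonneg ‖w * H.extend w‖]
  have := Measure.isFiniteMeasure_map (gafLaw.withDensity fun H : AnalyticDisc =>
      ENNReal.ofReal (Real.exp (-‖w * H.extend w‖ ^ 2))) (fun H => addMul (-(w * H.extend w)) H)
  have := Measure.isFiniteMeasure_map gafLaw (blaschkeMul w)
  have : IsFiniteMeasure (ENNReal.ofReal (1 - ‖w‖ ^ 2) • gafLaw.map (blaschkeMul w)) :=
    Measure.smul_finite _ ENNReal.ofReal_ne_top
  refine measure_ext_of_charFunctional fun I z t => ?_
  set w' : unitDisc := ⟨w, mem_ball_zero_iff.2 hw⟩ with hw'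
  have hext : ∀ H : AnalyticDisc, H.extend w = H w' := fun H => extend_coe H w'
  have R : charFunctional (ENNReal.ofReal (1 - ‖w‖ ^ 2) • gafLaw.map (blaschkeMul w)) z t =
      ((1 - ‖w‖ ^ 2 : ℝ) : ℂ) * Complex.exp (-(∑ i, ∑ j, (starRingEnd ℂ) (t i * blaschke w (z i)) *
        (t j * blaschke w (z j)) * inner ℂ (szegoVector (z i)) (szegoVector (z j))) / 4) := by
    rw [charFunctional, integral_smul_measure, integral_map hB.aemeasurable
      (measurable_cexp_eval z t).aestronglyMeasurable, ENNReal.toReal_ofReal hw2.le]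
    have h2 := charFunctional_gafLaw z (fun i => t i * blaschke w (z i))
    rw [charFunctional, norm_sum_smul_sq] at h2
    have h3 : ∀ g : AnalyticDisc, ∑ i, t i * blaschkeMul w g (z i) =
        ∑ i, t i * blaschke w (z i) * g (z i) := fun g =>
      Finset.sum_congr rfl fun i _ => by rw [blaschkeMul_apply hw, mul_assoc]
    simp_rw [h3]
    rw [h2, Complex.real_smul]
  set x : EllTwo := (2 * w) • szegoVector w' with hx
  set v : I → EllTwo := fun i => (z i : ℂ) • szegoVector (z i) - w • szegoVector w' with hv
  set y : EllTwo := ∑ i, t i • v i with hy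
  have hXf : ∀ H : AnalyticDisc, ((Real.exp (-‖w * H.extend w‖ ^ 2) : ℝ) : ℂ) =
      ∫ η, Complex.exp (((η * (2 * (w * H.extend w))).re : ℝ) * Complex.I) ∂stdComplexGaussian := by
    intro H
    simp_rw [mul_comm _ (2 * (w * H.extend w))]
    rw [integral_cexp_re_mul_stdComplexGaussian]
    push_cast
    congr 1
    rw [norm_mul]
    simp
    ring
  have L : charFunctional ((gafLaw.withDensity fun H =>
      ENNReal.ofReal (Real.exp (-‖w * H.extend w‖ ^ 2))).map
      (fun H => addMul (-(w * H.extend w)) H)) z t =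
      ∫ η, Complex.exp (-‖y + η • x‖ ^ 2 / 4) ∂stdComplexGaussian := by
    rw [charFunctional, integral_map hA.aemeasurable
        (measurable_cexp_eval z t).aestronglyMeasurable,
      integral_withDensity_eq_integral_toReal_smul hdm (by simp)]
    have h1 : ∀ H : AnalyticDisc, (ENNReal.ofReal (Real.exp (-‖w * H.extend w‖ ^ 2))).toReal •
        Complex.exp (((∑ i, t i * addMul (-(w * H.extend w)) H (z i)).re : ℝ) * Complex.I) =
        ∫ η, Complex.exp (((η * (2 * (w * H.extend w))).re : ℝ) * Complex.I) *
          Complex.exp (((∑ i, t i * addMul (-(w * H.extend w)) H (z i)).re : ℝ) * Complex.I)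
          ∂stdComplexGaussian := by
      intro H
      rw [integral_mul_const, ← hXf, ENNReal.toReal_ofReal (Real.exp_pos _).le, Complex.real_smul]
    simp_rw [h1]
    rw [integral_integral_swap]
    · refine integral_congr_ae (Filter.Eventually.of_forall fun η => ?_)
      dsimp only
      have h2 := charFunctional_gafLaw (fun o : Option I => o.elim w' z)
        (fun o : Option I => o.elim (-(∑ i, t i) * w + 2 * w * η) (fun i => t i * z i))
      rw [charFunctional] at h2
      simp only [Fintype.sum_option, Option.elim_none, Option.elim_some] at h2
      have h3 : y + η • x = (-(∑ i, t i) * w + 2 * w * η) • szegoVector w' +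
          ∑ i, (t i * z i) • szegoVector (z i) := by
        rw [hy, hx, hv]
        simp only [smul_sub, Finset.sum_sub_distrib, smul_smul, ← Finset.sum_smul, ← Finset.sum_mul]
        module
      rw [h3, ← h2]
      refine integral_congr_ae (Filter.Eventually.of_forall fun H => ?_)
      dsimp only
      rw [← Complex.exp_add, ← add_mul, ← Complex.ofReal_add, ← Complex.add_re]
      congr 4
      simp_rw [addMul_apply, mul_add, Finset.sum_add_distrib, ← Finset.sum_mul, hext, mul_assoc]
      ring
    · refine Integrable.of_bound (C := 1) (Measurable.aestronglyMeasurable ?_)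
        (Filter.Eventually.of_forall fun p => ?_)
      · have hm1 : Measurable fun p : AnalyticDisc × ℂ => w * p.1.extend w := hX.comp measurable_fst
        have hm2 : Measurable fun p : AnalyticDisc × ℂ =>
            Complex.exp (((∑ i, t i * addMul (-(w * p.1.extend w)) p.1 (z i)).re : ℝ) *
                Complex.I) :=
          (measurable_cexp_eval z t).comp (hA.comp measurable_fst)
        have hm3 : Measurable fun p : AnalyticDisc × ℂ => p.2 * (2 * (w * p.1.extend w)) :=
          measurable_snd.mul (hm1.const_mul 2)
        refine Measurable.mul ?_ hm2
        exact ((Complex.continuous_ofReal.measurable.comp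
          (Complex.continuous_re.measurable.comp hm3)).mul_const _).cexp
      · simp only [Function.uncurry]
        rw [norm_mul, Complex.norm_exp_ofReal_mul_I, Complex.norm_exp_ofReal_mul_I, one_mul]
  rw [L, R, integral_cexp_norm_add_smul_sq]
  have hww := one_sub_conj_mul_ne_zero hw hw
  have hwc : ((1 - ‖w‖ ^ 2 : ℝ) : ℂ) = 1 - (starRingEnd ℂ) w * w := by
    rw [Complex.conj_mul']; push_cast; rfl
  have hnx : ((‖x‖ ^ 2 : ℝ) : ℂ) = 4 * ((starRingEnd ℂ) w * w) / (1 - (starRingEnd ℂ) w * w) := by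
    have h1 : ((‖x‖ ^ 2 : ℝ) : ℂ) = inner ℂ x x := by
      rw [inner_self_eq_norm_sq_to_K]; push_cast; rfl
    rw [h1, hx, inner_smul_left, inner_smul_right, inner_szegoVector, map_mul]
    simp only [hw', Complex.conj_ofNat]
    ring
  have hsx : ((1 + ‖x‖ ^ 2 / 4 : ℝ) : ℂ) = 1 / (1 - (starRingEnd ℂ) w * w) := by
    rw [Complex.ofReal_add, Complex.ofReal_div, hnx]
    field_simp
    push_cast
    ring
  have hin : (‖inner ℂ y x‖ : ℂ) ^ 2 = ∑ i, ∑ j, (starRingEnd ℂ) (t i) * t j *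
      (inner ℂ (v i) x * inner ℂ x (v j)) := by
    rw [← Complex.mul_conj', inner_conj_symm, hy, sum_inner, inner_sum, Finset.sum_mul_sum]
    simp_rw [inner_smul_left, inner_smul_right]
    exact Finset.sum_congr rfl fun i _ => Finset.sum_congr rfl fun j _ => by ring
  have hyn : (‖y‖ : ℂ) ^ 2 = ∑ i, ∑ j, (starRingEnd ℂ) (t i) * t j * inner ℂ (v i) (v j) :=
    norm_sum_smul_sq t v
  rw [hsx, hwc, one_div_one_div]
  congr 3
  have h4 : ((4 * (1 + ‖x‖ ^ 2 / 4) : ℝ) : ℂ) = 4 * (1 / (1 - (starRingEnd ℂ) w * w)) := by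
    rw [Complex.ofReal_mul, hsx]; push_cast; rfl
  rw [Complex.ofReal_sub, Complex.ofReal_div, h4, Complex.ofReal_pow, Complex.ofReal_pow, hyn, hin]
  rw [Finset.sum_div, ← Finset.sum_sub_distrib]
  congr 1
  refine Finset.sum_congr rfl fun i _ => ?_
  rw [Finset.sum_div, ← Finset.sum_sub_distrib]
  refine Finset.sum_congr rfl fun j _ => ?_
  have n1 := one_sub_conj_mul_ne_zero hw (mem_ball_zero_iff.1 (z j).2)
  have n2 := one_sub_conj_mul_ne_zero (mem_ball_zero_iff.1 (z i).2) hw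
  have n3 := one_sub_conj_mul_ne_zero (mem_ball_zero_iff.1 (z i).2) (mem_ball_zero_iff.1 (z j).2)
  have e1 : inner ℂ (v i) (v j) =
      (starRingEnd ℂ) (z i : ℂ) * z j * (1 / (1 - (starRingEnd ℂ) (z i : ℂ) * z j)) -
      (starRingEnd ℂ) (z i : ℂ) * w * (1 / (1 - (starRingEnd ℂ) (z i : ℂ) * w)) -
      (starRingEnd ℂ) w * z j * (1 / (1 - (starRingEnd ℂ) w * z j)) +
      (starRingEnd ℂ) w * w * (1 / (1 - (starRingEnd ℂ) w * w)) := by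
    simp only [hv, inner_sub_left, inner_sub_right, inner_smul_left, inner_smul_right,
      inner_szegoVector, hw']
    ring
  have e2 : inner ℂ (v i) x = 2 * w * ((starRingEnd ℂ) (z i : ℂ) *
      (1 / (1 - (starRingEnd ℂ) (z i : ℂ) * w)) -
      (starRingEnd ℂ) w * (1 / (1 - (starRingEnd ℂ) w * w))) := by
    simp only [hv, hx, inner_sub_left, inner_smul_left, inner_smul_right, inner_szegoVector, hw']
  have e3 : inner ℂ x (v j) = 2 * (starRingEnd ℂ) w * (z j *
      (1 / (1 - (starRingEnd ℂ) w * z j)) - w * (1 / (1 - (starRingEnd ℂ) w * w))) := by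
    simp only [hv, hx, inner_sub_right, inner_smul_left, inner_smul_right, inner_szegoVector, hw',
      map_mul, Complex.conj_ofNat]
    ring
  have e4 : (starRingEnd ℂ) (blaschke w (z i)) = ((starRingEnd ℂ) (z i : ℂ) - (starRingEnd ℂ) w) /
      (1 - (starRingEnd ℂ) (z i : ℂ) * w) := by
    simp only [blaschke, map_div₀, map_sub, map_mul, map_one, Complex.conj_conj]
    rw [mul_comm w]
  rw [e1, e2, e3, map_mul, e4, inner_szegoVector, blaschke]
  have := szego_schur_complement n3 n2 n1 hww
  linear_combination ((starRingEnd ℂ) (t i) * t j) * this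

end AnalyticDisc

/-! ### The Palm formula -/

namespace AnalyticDisc

theorem properZeros_addMul {u : ℂ} (hu : u ≠ 0) (H : AnalyticDisc) :
    (addMul u H).properZeros = unitDisc ∩ (fun z => z * H.extend z) ⁻¹' {-u} := by
  have h0 : addMul u H ≠ 0 := by
    intro h
    apply hu
    have h1 := addMul_apply u H ⟨0, Metric.mem_ball_self one_pos⟩
    rw [h, zero_apply, zero_mul, add_zero] at h1
    exact h1.symm
  ext z
  rw [properZeros_of_ne_zero h0, mem_zeros_iff, Set.mem_inter_iff]
  refine and_congr_right fun hz => ?_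
  rw [extend_addMul u H hz, Set.mem_preimage, Set.mem_singleton_iff, add_comm,
      add_eq_zero_iff_eq_neg]

theorem lintegral_sum_properZeros_addMul (H : AnalyticDisc) {Ψ : ℂ × AnalyticDisc → ℝ≥0∞}
    (hΨ : Measurable Ψ) :
    ∫⁻ u, ∑' z, (addMul u H).properZeros.indicator (fun z => Ψ (z, addMul u H)) z
      ∂stdComplexGaussian =
    ∫⁻ z in unitDisc, ENNReal.ofReal (‖discDeriv (addMul (-(z * H.extend z)) H) z‖ ^ 2) *
      (ENNReal.ofReal (Real.exp (-‖z * H.extend z‖ ^ 2) / Real.pi) *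
        Ψ (z, addMul (-(z * H.extend z)) H)) := by
  set g : ℂ → ℂ := fun z => z * H.extend z with hg
  have hgd : DifferentiableOn ℂ g unitDisc := differentiableOn_id.mul H.differentiableOn_extend
  have hgm : Measurable g := measurable_id.mul (measurable_const.discExtend measurable_id)
  have hAm : Measurable fun z : ℂ => addMul (-g z) H := hgm.neg.discAddMul measurable_const
  have hm : Measurable fun u : ℂ => ∑' z, (addMul u H).properZeros.indicator
      (fun z => Ψ (z, addMul u H)) z := by
    have h1 := measurable_tsum_properZeros (β := Unit)
      (Ψ := fun p : (Unit × AnalyticDisc) × ℂ => Ψ (p.2, p.1.2)) (by fun_prop)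
    have h2 : Measurable fun u : ℂ => ((), addMul u H) :=
      measurable_const.prodMk (measurable_id.discAddMul measurable_const)
    exact h1.comp h2
  set Φ : ℂ → ℝ≥0∞ := fun z => ENNReal.ofReal (Real.exp (-‖g z‖ ^ 2) / Real.pi) *
        Ψ (z, addMul (-g z) H) with hΦ
  have hΦm : Measurable Φ := by
    refine Measurable.mul (by fun_prop) (hΨ.comp (measurable_id.prodMk hAm))
  have harea := lintegral_sum_fiber Metric.isOpen_ball hgd hΦm
  rw [lintegral_stdComplexGaussian hm, ← lintegral_neg_eq_self]
  have h1 : ∫⁻ u : ℂ, ENNReal.ofReal (Real.exp (-‖-u‖ ^ 2) / Real.pi) *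
      ∑' z, (addMul (-u) H).properZeros.indicator (fun z => Ψ (z, addMul (-u) H)) z =
      ∫⁻ u, ∑' x, (unitDisc ∩ g ⁻¹' {u}).indicator Φ x := by
    refine lintegral_congr_ae ?_
    filter_upwards [compl_mem_ae_iff.2 (measure_singleton (μ := (volume : Measure ℂ)) 0)] with u hu
    rw [← ENNReal.tsum_mul_left]
    refine tsum_congr fun z => ?_
    rw [properZeros_addMul (neg_ne_zero.2 hu), neg_neg]
    by_cases hz : z ∈ unitDisc ∩ g ⁻¹' {u}
    · rw [Set.indicator_of_mem hz, Set.indicator_of_mem hz]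
      have : g z = u := hz.2
      rw [hΦ]
      simp only [this, norm_neg]
    · rw [Set.indicator_of_notMem hz, Set.indicator_of_notMem hz, mul_zero]
  rw [h1, harea]
  refine setLIntegral_congr_fun Metric.isOpen_ball.measurableSet fun z hz => ?_
  rw [discDeriv_addMul _ H hz]

theorem lintegral_sum_properZeros {Ψ : ℂ × AnalyticDisc → ℝ≥0∞} (hΨ : Measurable Ψ) :
    ∫⁻ F, ∑' z, F.properZeros.indicator (fun z => Ψ (z, F)) z ∂gafLaw =
    ∫⁻ w in unitDisc, ENNReal.ofReal (1 / (Real.pi * (1 - ‖w‖ ^ 2))) *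
      ∫⁻ H, ENNReal.ofReal (‖H.extend w‖ ^ 2) * Ψ (w, blaschkeMul w H) ∂gafLaw := by
  have hm : Measurable fun F : AnalyticDisc => ∑' z, F.properZeros.indicator
      (fun z => Ψ (z, F)) z := by
    have h1 := measurable_tsum_properZeros (β := Unit)
      (Ψ := fun p : (Unit × AnalyticDisc) × ℂ => Ψ (p.2, p.1.2)) (by fun_prop)
    exact h1.comp (measurable_const.prodMk measurable_id : Measurable fun F : AnalyticDisc =>
        ((), F))
  conv_lhs => rw [← map_addMul_gafLaw]
  rw [lintegral_map hm measurable_addMul]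
  have hm2 : Measurable fun p : ℂ × AnalyticDisc => ∑' z, (addMul p.1 p.2).properZeros.indicator
      (fun z => Ψ (z, addMul p.1 p.2)) z := hm.comp measurable_addMul
  rw [lintegral_prod_symm' _ hm2]
  simp_rw [lintegral_sum_properZeros_addMul _ hΨ]
  have hX : Measurable fun p : AnalyticDisc × ℂ => p.2 * p.1.extend p.2 :=
    measurable_snd.mul (measurable_fst.discExtend measurable_snd)
  have hA : Measurable fun p : AnalyticDisc × ℂ => addMul (-(p.2 * p.1.extend p.2)) p.1 :=
    hX.neg.discAddMul measurable_fst
  have hD : Measurable fun p : AnalyticDisc × ℂ =>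
      discDeriv (addMul (-(p.2 * p.1.extend p.2)) p.1) p.2 :=
    measurable_discDeriv.comp (hA.prodMk measurable_snd)
  rw [lintegral_lintegral_swap]
  swap
  · refine Measurable.aemeasurable (Measurable.mul (by fun_prop) (Measurable.mul (by fun_prop) ?_))
    exact hΨ.comp (measurable_snd.prodMk hA)
  refine setLIntegral_congr_fun Metric.isOpen_ball.measurableSet fun w hw => ?_
  have hw1 : ‖w‖ < 1 := mem_ball_zero_iff.1 hw
  have hw2 : 0 < 1 - ‖w‖ ^ 2 := by nlinarith [norm_nonneg w]
  have hXw : Measurable fun H : AnalyticDisc => w * H.extend w :=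
    (measurable_id.discExtend measurable_const).const_mul w
  have hAw : Measurable fun H : AnalyticDisc => addMul (-(w * H.extend w)) H :=
    hXw.neg.discAddMul measurable_id
  set Φ : AnalyticDisc → ℝ≥0∞ := fun F =>
    ENNReal.ofReal (‖discDeriv F w‖ ^ 2) * Ψ (w, F) with hΦ
  have hΦm : Measurable Φ := by
    have : Measurable fun F : AnalyticDisc => discDeriv F w :=
      measurable_discDeriv.comp (measurable_id.prodMk measurable_const)
    exact Measurable.mul (by fun_prop) (hΨ.comp (measurable_const.prodMk measurable_id))
  have htilt := congrArg (fun ν => ∫⁻ F, Φ F ∂ν) (tilted_gafLaw hw1)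
  have hBw : Measurable (blaschkeMul w) := measurable_const.discBlaschkeMul measurable_id
  have hΦB : Measurable fun H : AnalyticDisc => Φ (blaschkeMul w H) := hΦm.comp hBw
  have hΦA : Measurable fun H : AnalyticDisc => Φ (addMul (-(w * H.extend w)) H) := hΦm.comp hAw
  rw [lintegral_map hΦm hAw, lintegral_withDensity_eq_lintegral_mul _ (by fun_prop) hΦA,
    lintegral_smul_measure, lintegral_map hΦm hBw] at htilt
  have h1 : ∀ H : AnalyticDisc, ENNReal.ofReal (‖discDeriv (addMul (-(w * H.extend w)) H) w‖ ^ 2) *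
      (ENNReal.ofReal (Real.exp (-‖w * H.extend w‖ ^ 2) / Real.pi) *
        Ψ (w, addMul (-(w * H.extend w)) H)) = ENNReal.ofReal (1 / Real.pi) *
      (((fun H : AnalyticDisc => ENNReal.ofReal (Real.exp (-‖w * H.extend w‖ ^ 2))) *
        fun H => Φ (addMul (-(w * H.extend w)) H)) H) := by
    intro H
    rw [Pi.mul_apply, hΦ, div_eq_mul_one_div,
      ENNReal.ofReal_mul (Real.exp_pos _).le]
    ring
  simp_rw [h1]
  rw [lintegral_const_mul _ (Measurable.mul (by fun_prop) hΦA), htilt, smul_eq_mul, ← mul_assoc,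
      ← ENNReal.ofReal_mul (by positivity), ← lintegral_const_mul,
    ← lintegral_const_mul]
  · refine lintegral_congr fun H => ?_
    rw [hΦ]
    dsimp only
    rw [discDeriv_blaschkeMul hw1, ← mul_assoc, ← mul_assoc, ← ENNReal.ofReal_mul (by positivity),
      ← ENNReal.ofReal_mul (by positivity)]
    congr 2
    rw [norm_div, div_pow]
    have : ‖(1 - (‖w‖ : ℂ) ^ 2)‖ = 1 - ‖w‖ ^ 2 := by
      rw [← Complex.ofReal_pow, ← Complex.ofReal_one, ← Complex.ofReal_sub, Complex.norm_real,
        Real.norm_of_nonneg hw2.le]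
    rw [this]
    have := Real.pi_pos.ne'
    field_simp
  · refine Measurable.mul ?_ (hΨ.comp (measurable_const.prodMk hBw))
    have : Measurable fun H : AnalyticDisc => H.extend w :=
      measurable_id.discExtend measurable_const
    fun_prop
  · exact hΦB

end AnalyticDisc

/-! ### The Palm formula for several zeros -/

/-- The injective `k`-tuples of elements of a set. -/
def injectiveTuples (k : ℕ) (S : Set ℂ) : Set (Fin k → ℂ) := {x | Function.Injective x ∧ ∀ i,
    x i ∈ S}

/-- The density, with respect to Lebesgue measure, in the Palm formula for several zeros. -/
def palmDensity : (k : ℕ) → (Fin k → ℂ) → ℝ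
  | 0, _ => 1
  | k + 1, w => palmDensity k (Fin.tail w) *
      (1 / (Real.pi * (1 - ‖w 0‖ ^ 2)) * ∏ j, ‖blaschke (w 0) (Fin.tail w j)‖ ^ 2)

theorem palmDensity_nonneg : ∀ (k : ℕ) (w : Fin k → ℂ), (∀ i, w i ∈ unitDisc) → 0 ≤ palmDensity k w
  | 0, _, _ => zero_le_one
  | k + 1, w, hw => by
    have h0 : 0 < 1 - ‖w 0‖ ^ 2 := by
      have := mem_ball_zero_iff.1 (hw 0)
      nlinarith [norm_nonneg (w 0)]
    have := palmDensity_nonneg k (Fin.tail w) fun i => hw i.succ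
    rw [palmDensity]
    positivity

theorem measurable_palmDensity : ∀ k : ℕ, Measurable (palmDensity k)
  | 0 => measurable_const
  | k + 1 => by
    have ht : Measurable fun w : Fin (k + 1) → ℂ => Fin.tail w :=
      measurable_pi_lambda _ fun i => measurable_pi_apply i.succ
    have h0 : Measurable fun w : Fin (k + 1) → ℂ => w 0 := measurable_pi_apply 0
    have hj : ∀ j : Fin k, Measurable fun w : Fin (k + 1) → ℂ => blaschke (w 0) (Fin.tail w j) :=
      fun j => measurable_blaschke.comp (h0.prodMk (measurable_pi_apply j.succ))
    have h := (measurable_palmDensity k).comp ht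
    show Measurable fun w : Fin (k + 1) → ℂ => palmDensity k (Fin.tail w) *
      (1 / (Real.pi * (1 - ‖w 0‖ ^ 2)) * ∏ j, ‖blaschke (w 0) (Fin.tail w j)‖ ^ 2)
    refine Measurable.mul h (Measurable.mul (by fun_prop) ?_)
    exact Finset.measurable_prod _ fun j _ => (hj j).norm.pow_const 2

theorem lintegral_piFin_succ {k : ℕ} {s : Set ℂ} (hs : MeasurableSet s)
    {G : (Fin (k + 1) → ℂ) → ℝ≥0∞} (hG : Measurable G) :
    ∫⁻ w in {w | ∀ i, w i ∈ s}, G w =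
      ∫⁻ x in {x : Fin k → ℂ | ∀ i, x i ∈ s}, ∫⁻ z in s, G (Fin.cons z x) := by
  have hms : ∀ n : ℕ, MeasurableSet {w : Fin n → ℂ | ∀ i, w i ∈ s} := fun n => by
    rw [Set.ofPred_forall]
    exact MeasurableSet.iInter fun i => measurable_pi_apply i hs
  have hmp := (volume_preserving_piFinSuccAbove (fun _ : Fin (k + 1) => ℂ) 0).symm
  have hGi := (hG.indicator (hms (k + 1))).comp
    (MeasurableEquiv.piFinSuccAbove (fun _ : Fin (k + 1) => ℂ) 0).symm.measurable
  have hprod := lintegral_prod_symm' (μ := (volume : Measure ℂ))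
    (ν := (volume : Measure (Fin k → ℂ))) _ hGi
  simp only [Function.comp_apply] at hprod
  rw [← lintegral_indicator (hms _), ← hmp.lintegral_comp (hG.indicator (hms _)),
    Measure.volume_eq_prod, hprod, ← lintegral_indicator (hms _)]
  refine lintegral_congr fun x => ?_
  have hc : ∀ z, (MeasurableEquiv.piFinSuccAbove (fun _ : Fin (k + 1) => ℂ) 0).symm (z, x) =
      Fin.cons z x := fun z => by
    rw [MeasurableEquiv.piFinSuccAbove_symm_apply]
    exact Fin.insertNth_zero' _ _
  simp_rw [hc]
  by_cases hx : ∀ i, x i ∈ s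
  · rw [Set.indicator_of_mem (by exact hx), ← lintegral_indicator hs]
    refine lintegral_congr fun z => ?_
    by_cases hz : z ∈ s
    · rw [Set.indicator_of_mem hz, Set.indicator_of_mem]
      exact Fin.cases hz hx
    · rw [Set.indicator_of_notMem hz, Set.indicator_of_notMem]
      exact fun h => hz (h 0)
  · rw [Set.indicator_of_notMem (by exact hx), ← lintegral_zero]
    refine lintegral_congr fun z => ?_
    rw [Set.indicator_of_notMem]
    exact fun h => hx fun i => h i.succ

theorem tsum_injectiveTuples_succ (k : ℕ) (S : Set ℂ) (Φ : (Fin (k + 1) → ℂ) → ℝ≥0∞) :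
    ∑' x, (injectiveTuples (k + 1) S).indicator Φ x =
      ∑' x, (injectiveTuples k S).indicator (fun x => ∑' z, S.indicator
        (fun z => (Set.range x)ᶜ.indicator (fun z => Φ (Fin.cons z x)) z) z) x := by
  rw [← (Fin.consEquiv fun _ => ℂ).tsum_eq, ENNReal.tsum_prod', ENNReal.tsum_comm]
  refine tsum_congr fun x => ?_
  by_cases hx : x ∈ injectiveTuples k S
  · rw [Set.indicator_of_mem hx]
    refine tsum_congr fun z => ?_
    rw [Set.indicator_indicator]
    by_cases hz : z ∈ S ∩ (Set.range x)ᶜ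
    · rw [Set.indicator_of_mem hz, Set.indicator_of_mem]
      · rfl
      · exact ⟨Fin.cons_injective_iff.2 ⟨hz.2, hx.1⟩, Fin.cases hz.1 hx.2⟩
    · rw [Set.indicator_of_notMem hz, Set.indicator_of_notMem]
      rintro ⟨h1, h2⟩
      exact hz ⟨h2 0, (Fin.cons_injective_iff.1 h1).1⟩
  · rw [Set.indicator_of_notMem hx, ENNReal.tsum_eq_zero]
    intro z
    rw [Set.indicator_of_notMem]
    rintro ⟨h1, h2⟩
    exact hx ⟨(Fin.cons_injective_iff.1 h1).2, fun i => h2 i.succ⟩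

theorem measurableSet_notMem_range (k : ℕ) :
    MeasurableSet {p : (Fin k → ℂ) × ℂ | p.2 ∉ Set.range p.1} := by
  have h : {p : (Fin k → ℂ) × ℂ | p.2 ∉ Set.range p.1} = ⋂ i, {p | p.1 i = p.2}ᶜ := by
    ext p; simp
  rw [h]
  refine MeasurableSet.iInter fun i => MeasurableSet.compl ?_
  exact measurableSet_eq_fun ((measurable_pi_apply i).comp measurable_fst) measurable_snd

theorem measurable_finCons {β : Type*} [MeasurableSpace β] {k : ℕ} {z : β → ℂ} {x : β → Fin k → ℂ}
    (hz : Measurable z) (hx : Measurable x) :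
    Measurable fun b => (Fin.cons (z b) (x b) : Fin (k + 1) → ℂ) :=
  measurable_pi_lambda _ (Fin.cases hz fun i => (measurable_pi_apply i).comp hx)

namespace AnalyticDisc

/-- The product of an analytic function with several Blaschke factors. -/
def blaschkeProd : (k : ℕ) → (Fin k → ℂ) → AnalyticDisc → AnalyticDisc
  | 0, _, H => H
  | k + 1, w, H => blaschkeProd k (Fin.tail w) (blaschkeMul (w 0) H)

theorem measurable_blaschkeProd : ∀ k : ℕ,
    Measurable fun p : (Fin k → ℂ) × AnalyticDisc => blaschkeProd k p.1 p.2
  | 0 => measurable_snd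
  | k + 1 => by
    have h1 : Measurable fun p : (Fin (k + 1) → ℂ) × AnalyticDisc => Fin.tail p.1 :=
      measurable_pi_lambda _ fun i => (measurable_pi_apply i.succ).comp measurable_fst
    have h2 : Measurable fun p : (Fin (k + 1) → ℂ) × AnalyticDisc => blaschkeMul (p.1 0) p.2 :=
      ((measurable_pi_apply 0).comp measurable_fst).discBlaschkeMul measurable_snd
    exact (measurable_blaschkeProd k).comp (h1.prodMk h2)

theorem properZeros_blaschkeProd : ∀ (k : ℕ) (w : Fin k → ℂ) (H : AnalyticDisc),
    (∀ i, w i ∈ unitDisc) → ∀ z, z ∉ Set.range w →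
      (z ∈ (blaschkeProd k w H).properZeros ↔ z ∈ H.properZeros)
  | 0, _, _, _, _, _ => Iff.rfl
  | k + 1, w, H, hw, z, hz => by
    rw [blaschkeProd, properZeros_blaschkeProd k (Fin.tail w) _ (fun i => hw i.succ) z
      (fun ⟨i, hi⟩ => hz ⟨i.succ, hi⟩),
      properZeros_blaschkeMul (mem_ball_zero_iff.1 (hw 0)) H fun h => hz ⟨0, h.symm⟩]

/-- The sum of `Ψ (cons z x, F)` over the zeros `z` of `F` that are not in the tuple `x`. -/
def sumNewZeros {k : ℕ} (Ψ : (Fin (k + 1) → ℂ) × AnalyticDisc → ℝ≥0∞)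
    (p : (Fin k → ℂ) × AnalyticDisc) : ℝ≥0∞ :=
  ∑' z, p.2.properZeros.indicator
    (fun z => (Set.range p.1)ᶜ.indicator (fun z => Ψ (Fin.cons z p.1, p.2)) z) z

theorem measurable_sumNewZeros {k : ℕ} {Ψ : (Fin (k + 1) → ℂ) × AnalyticDisc → ℝ≥0∞}
    (hΨ : Measurable Ψ) : Measurable (sumNewZeros Ψ) := by
  refine measurable_tsum_properZeros (Ψ := fun q : ((Fin k → ℂ) × AnalyticDisc) × ℂ =>
    (Set.range q.1.1)ᶜ.indicator (fun z => Ψ (Fin.cons z q.1.1, q.1.2)) q.2) ?_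
  have h : (fun q : ((Fin k → ℂ) × AnalyticDisc) × ℂ =>
      (Set.range q.1.1)ᶜ.indicator (fun z => Ψ (Fin.cons z q.1.1, q.1.2)) q.2) =
      ((fun q : ((Fin k → ℂ) × AnalyticDisc) × ℂ => (q.1.1, q.2)) ⁻¹'
        {p : (Fin k → ℂ) × ℂ | p.2 ∉ Set.range p.1}).indicator
        (fun q => Ψ (Fin.cons q.2 q.1.1, q.1.2)) := by
    rfl
  rw [h]
  refine Measurable.indicator ?_ ((by fun_prop : Measurable fun q : ((Fin k → ℂ) × AnalyticDisc) × ℂ =>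
    (q.1.1, q.2)) (measurableSet_notMem_range k))
  exact hΨ.comp ((measurable_finCons measurable_snd (measurable_fst.comp measurable_fst)).prodMk
    (measurable_snd.comp measurable_fst))

theorem measurable_tsum_injectiveTuples : ∀ (k : ℕ) {Ψ : (Fin k → ℂ) × AnalyticDisc → ℝ≥0∞},
    Measurable Ψ → Measurable fun F : AnalyticDisc =>
      ∑' x, (injectiveTuples k F.properZeros).indicator (fun x => Ψ (x, F)) x
  | 0, Ψ, hΨ => by
    have h : ∀ F : AnalyticDisc, ∑' x, (injectiveTuples 0 F.properZeros).indicator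
        (fun x => Ψ (x, F)) x = Ψ (default, F) := fun F => by
      rw [tsum_eq_single default fun x hx => absurd (Subsingleton.elim x default) hx,
        Set.indicator_of_mem]
      exact ⟨Function.injective_of_subsingleton _, fun i => i.elim0⟩
    simp_rw [h]
    exact hΨ.comp (measurable_const.prodMk measurable_id)
  | k + 1, Ψ, hΨ => by
    simp_rw [tsum_injectiveTuples_succ]
    exact measurable_tsum_injectiveTuples k (measurable_sumNewZeros hΨ)

theorem lintegral_sum_injectiveTuples : ∀ (k : ℕ) {Ψ : (Fin k → ℂ) × AnalyticDisc → ℝ≥0∞},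
    Measurable Ψ →
    ∫⁻ F, ∑' x, (injectiveTuples k F.properZeros).indicator (fun x => Ψ (x, F)) x ∂gafLaw =
      ∫⁻ w in {w | ∀ i, w i ∈ unitDisc}, ENNReal.ofReal (palmDensity k w) *
        ∫⁻ H, ENNReal.ofReal (∏ i, ‖H.extend (w i)‖ ^ 2) * Ψ (w, blaschkeProd k w H) ∂gafLaw
  | 0, Ψ, hΨ => by
    have h : ∀ F : AnalyticDisc, ∑' x, (injectiveTuples 0 F.properZeros).indicator
        (fun x => Ψ (x, F)) x = Ψ (default, F) := fun F => by
      rw [tsum_eq_single default fun x hx => absurd (Subsingleton.elim x default) hx,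
        Set.indicator_of_mem]
      exact ⟨Function.injective_of_subsingleton _, fun i => i.elim0⟩
    have huniv : {w : Fin 0 → ℂ | ∀ i, w i ∈ unitDisc} = Set.univ := by
      ext w; simp
    simp_rw [h]
    rw [huniv, Measure.restrict_univ, Measure.volume_pi_eq_dirac default, lintegral_dirac]
    simp [palmDensity, blaschkeProd]
  | k + 1, Ψ, hΨ => by
    have hmD : MeasurableSet unitDisc := Metric.isOpen_ball.measurableSet
    simp_rw [tsum_injectiveTuples_succ]
    refine (lintegral_sum_injectiveTuples k (measurable_sumNewZeros hΨ)).trans ?_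
    have hGm : Measurable fun w : Fin (k + 1) → ℂ => ENNReal.ofReal (palmDensity (k + 1) w) *
        ∫⁻ H, ENNReal.ofReal (∏ i, ‖H.extend (w i)‖ ^ 2) *
          Ψ (w, blaschkeProd (k + 1) w H) ∂gafLaw := by
      refine Measurable.mul (measurable_palmDensity _).ennreal_ofReal
        (Measurable.lintegral_prod_right' (f := fun p : (Fin (k + 1) → ℂ) × AnalyticDisc =>
          ENNReal.ofReal (∏ i, ‖p.2.extend (p.1 i)‖ ^ 2) *
              Ψ (p.1, blaschkeProd (k + 1) p.1 p.2)) ?_)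
      refine Measurable.mul (Measurable.ennreal_ofReal (Finset.measurable_prod _ fun i _ => ?_))
        (hΨ.comp (measurable_fst.prodMk (measurable_blaschkeProd _)))
      exact (measurable_snd.discExtend
        ((measurable_pi_apply i).comp measurable_fst)).norm.pow_const 2
    rw [lintegral_piFin_succ hmD hGm]
    have hms : MeasurableSet {w : Fin k → ℂ | ∀ i, w i ∈ unitDisc} := by
      rw [Set.ofPred_forall]
      exact MeasurableSet.iInter fun i => measurable_pi_apply i hmD
    refine setLIntegral_congr_fun hms fun x hx => ?_
    set Φ : ℂ × AnalyticDisc → ℝ≥0∞ := fun p => (Set.range x)ᶜ.indicator (fun z =>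
      ENNReal.ofReal (∏ i, ‖p.2.extend (x i)‖ ^ 2) *
        Ψ (Fin.cons z x, blaschkeProd k x p.2)) p.1 with hΦ
    have hΦm : Measurable Φ := by
      have h : Φ = (Prod.fst ⁻¹' (Set.range x)ᶜ).indicator fun p : ℂ × AnalyticDisc =>
          ENNReal.ofReal (∏ i, ‖p.2.extend (x i)‖ ^ 2) *
            Ψ (Fin.cons p.1 x, blaschkeProd k x p.2) := by
        rfl
      rw [h]
      refine Measurable.indicator (Measurable.mul (Measurable.ennreal_ofReal
        (Finset.measurable_prod _ fun i _ => ?_)) (hΨ.comp (Measurable.prodMk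
          (measurable_finCons measurable_fst measurable_const)
          ((measurable_blaschkeProd k).comp (measurable_const.prodMk measurable_snd)))))
        (measurable_fst (Set.finite_range x).measurableSet.compl)
      exact (measurable_snd.discExtend measurable_const).norm.pow_const 2
    have h1 : ∀ H : AnalyticDisc, ENNReal.ofReal (∏ i, ‖H.extend (x i)‖ ^ 2) *
        sumNewZeros Ψ (x, blaschkeProd k x H) =
        ∑' z, H.properZeros.indicator (fun z => Φ (z, H)) z := by
      intro H
      rw [sumNewZeros, ← ENNReal.tsum_mul_left]
      refine tsum_congr fun z => ?_
      classical
      simp only [hΦ, Set.indicator_apply]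
      by_cases hz : z ∈ Set.range x
      · have hz' : z ∉ (Set.range x)ᶜ := fun h => h hz
        simp only [if_neg hz', ite_self, mul_zero]
      · have hz' : z ∈ (Set.range x)ᶜ := hz
        simp only [if_pos hz', properZeros_blaschkeProd k x H hx z hz, mul_ite, mul_zero]
    simp_rw [h1]
    rw [lintegral_sum_properZeros hΦm, ← lintegral_const_mul]
    · refine setLIntegral_congr_fun hmD fun z hz => ?_
      have hz1 : ‖z‖ < 1 := mem_ball_zero_iff.1 hz
      have hz2 : 0 < 1 - ‖z‖ ^ 2 := by nlinarith [norm_nonneg z]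
      have hden : palmDensity (k + 1) (Fin.cons z x) = palmDensity k x *
          (1 / (Real.pi * (1 - ‖z‖ ^ 2)) * ∏ j, ‖blaschke z (x j)‖ ^ 2) := by
        rw [palmDensity]; simp
      rw [hden]
      by_cases hzx : z ∈ Set.range x
      · obtain ⟨i, rfl⟩ := hzx
        have h2 : ∏ j, ‖blaschke (x i) (x j)‖ ^ 2 = 0 :=
          Finset.prod_eq_zero (Finset.mem_univ i) (by
            rw [(blaschke_eq_zero_iff hz1 hz1).2 rfl]; simp)
        have h3 : x i ∉ (Set.range x)ᶜ := fun h => h ⟨i, rfl⟩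
        simp only [h2, hΦ, Set.indicator_of_notMem h3]
        simp
      · have hz' : z ∈ (Set.range x)ᶜ := hzx
        simp only [hΦ, Set.indicator_of_mem hz']
        have hp : 0 ≤ palmDensity k x := palmDensity_nonneg k x hx
        rw [ENNReal.ofReal_mul hp, ENNReal.ofReal_mul (by positivity), mul_assoc, mul_assoc]
        congr 2
        rw [← lintegral_const_mul]
        · refine lintegral_congr fun H => ?_
          rw [← mul_assoc, ← mul_assoc, ← ENNReal.ofReal_mul (by positivity),
            ← ENNReal.ofReal_mul (by positivity)]
          congr 2
          rw [Fin.prod_univ_succ, Fin.cons_zero]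
          simp only [Fin.cons_succ]
          simp_rw [fun i => extend_blaschkeMul hz1 H (hx i), norm_mul, mul_pow,
            Finset.prod_mul_distrib]
          ring
        · have hb : Measurable (blaschkeProd (k + 1) (Fin.cons z x)) :=
            (measurable_blaschkeProd (k + 1)).comp (measurable_const.prodMk measurable_id)
          refine Measurable.mul (Measurable.ennreal_ofReal (Finset.measurable_prod _ fun i _ => ?_))
            (hΨ.comp (measurable_const.prodMk hb))
          exact (measurable_id.discExtend measurable_const).norm.pow_const 2
    · refine Measurable.mul (by fun_prop) (Measurable.lintegral_prod_right'
        (f := fun p : ℂ × AnalyticDisc =>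
          ENNReal.ofReal (‖p.2.extend p.1‖ ^ 2) * Φ (p.1, blaschkeMul p.1 p.2)) ?_)
      refine Measurable.mul ?_ (hΦm.comp (measurable_fst.prodMk
        (measurable_fst.discBlaschkeMul measurable_snd)))
      exact ((measurable_snd.discExtend measurable_fst).norm.pow_const 2).ennreal_ofReal

end AnalyticDisc

/-! ### Determinants and permanents of the Szegő kernel -/

/-- The matrix of the Szegő kernel. -/
def szegoMatrix {k : ℕ} (w : Fin k → ℂ) : Matrix (Fin k) (Fin k) ℂ :=
  Matrix.of fun i j => 1 / (1 - w i * (starRingEnd ℂ) (w j))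

theorem one_sub_mul_conj_ne_zero {w z : ℂ} (hw : ‖w‖ < 1) (hz : ‖z‖ < 1) :
    1 - w * (starRingEnd ℂ) z ≠ 0 := by
  rw [mul_comm]
  exact one_sub_conj_mul_ne_zero hz hw

theorem szegoMatrix_sub_eq {a b u v : ℂ} (h1 : 1 - a * b ≠ 0) (h2 : 1 - a * v ≠ 0)
    (h3 : 1 - u * b ≠ 0) :
    1 / (1 - a * b) - 1 / (1 - a * v) / (1 / (1 - u * v)) * (1 / (1 - u * b)) =
      (a - u) / (1 - a * v) * ((b - v) / (1 - u * b) * (1 / (1 - a * b))) := by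
  generalize hA : 1 - a * b = A at *
  generalize hB : 1 - a * v = B at *
  generalize hC : 1 - u * b = C at *
  generalize hD : 1 - u * v = D at *
  field_simp
  rw [← hA, ← hB, ← hC, ← hD]
  ring

theorem Matrix.det_succ_eq_mul_det_schur {K : Type*} [Field K] {k : ℕ}
    (A : Matrix (Fin (k + 1)) (Fin (k + 1)) K) (h : A 0 0 ≠ 0) :
    A.det = A 0 0 * (Matrix.of fun i j : Fin k =>
      A i.succ j.succ - A i.succ 0 / A 0 0 * A 0 j.succ).det := by
  set B : Matrix (Fin (k + 1)) (Fin (k + 1)) K := Matrix.of fun i j =>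
    A i j - (Fin.cons 0 (fun i : Fin k => A i.succ 0 / A 0 0) : Fin (k + 1) → K) i * A 0 j with hB
  have h0 : ∀ j, B 0 j = A 0 j := fun j => by simp [hB]
  have hs : ∀ i j, B (Fin.succ i) j = A i.succ j - A i.succ 0 / A 0 0 * A 0 j := fun i j => by
    simp [hB]
  rw [Matrix.det_eq_of_forall_row_eq_smul_add_const (B := B)
    (Fin.cons 0 (fun i : Fin k => A i.succ 0 / A 0 0)) 0 (by simp)
    (fun i j => by rw [h0]; simp [hB]), Matrix.det_succ_column_zero, Fin.sum_univ_succ,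
    Finset.sum_eq_zero, add_zero]
  · rw [h0]
    simp only [Fin.val_zero, pow_zero, one_mul]
    congr 2
  · intro i _
    rw [hs, div_mul_cancel₀ _ h, sub_self, mul_zero, zero_mul]

theorem palmDensity_eq_det : ∀ (k : ℕ) (w : Fin k → ℂ), (∀ i, w i ∈ unitDisc) →
    (palmDensity k w : ℂ) = (szegoMatrix w).det / Real.pi ^ k
  | 0, _, _ => by simp [palmDensity]
  | k + 1, w, hw => by
    have hn : ∀ i, ‖w i‖ < 1 := fun i => mem_ball_zero_iff.1 (hw i)
    have h0 : (szegoMatrix w) 0 0 = 1 / ((1 - ‖w 0‖ ^ 2 : ℝ) : ℂ) := by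
      rw [szegoMatrix, Matrix.of_apply, Complex.mul_conj']
      push_cast
      rfl
    have hne : (szegoMatrix w) 0 0 ≠ 0 := one_div_ne_zero (one_sub_mul_conj_ne_zero (hn 0) (hn 0))
    have hs : (Matrix.of fun i j : Fin k => szegoMatrix w i.succ j.succ -
        szegoMatrix w i.succ 0 / szegoMatrix w 0 0 * szegoMatrix w 0 j.succ) =
        Matrix.of fun i j : Fin k => blaschke (w 0) (Fin.tail w i) *
          (Matrix.of fun i j : Fin k => (starRingEnd ℂ) (blaschke (w 0) (Fin.tail w j)) *
            szegoMatrix (Fin.tail w) i j) i j := by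
      ext i j
      simp only [Matrix.of_apply, szegoMatrix, Fin.tail, blaschke, map_div₀, map_sub, map_one,
          map_mul,
        Complex.conj_conj]
      rw [szegoMatrix_sub_eq (one_sub_mul_conj_ne_zero (hn _) (hn _))
        (one_sub_mul_conj_ne_zero (hn _) (hn _)) (one_sub_mul_conj_ne_zero (hn _) (hn _)),
            mul_comm ((starRingEnd ℂ) (w 0)) (w i.succ)]
    have hd : (Matrix.of fun i j : Fin k => szegoMatrix w i.succ j.succ -
        szegoMatrix w i.succ 0 / szegoMatrix w 0 0 * szegoMatrix w 0 j.succ).det =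
        (∏ i, blaschke (w 0) (Fin.tail w i)) *
          ((∏ i, (starRingEnd ℂ) (blaschke (w 0) (Fin.tail w i))) *
            (szegoMatrix (Fin.tail w)).det) := by
      rw [hs, Matrix.det_mul_column, Matrix.det_mul_row]
    rw [Matrix.det_succ_eq_mul_det_schur _ hne, hd, h0, palmDensity, Complex.ofReal_mul,
      palmDensity_eq_det k (Fin.tail w) fun i => hw i.succ, ← mul_assoc (∏ i, blaschke _ _),
      ← Finset.prod_mul_distrib]
    simp_rw [Complex.mul_conj']
    push_cast
    have hpi : (Real.pi : ℂ) ≠ 0 := Complex.ofReal_ne_zero.2 Real.pi_ne_zero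
    have hd2 : (1 - (‖w 0‖ : ℂ) ^ 2) ≠ 0 := by
      rw [← Complex.mul_conj']
      exact one_sub_mul_conj_ne_zero (hn 0) (hn 0)
    field_simp
    ring

theorem Matrix.permanent_mul_det {R : Type*} [CommRing R] {k : ℕ} (A : Matrix (Fin k) (Fin k) R) :
    A.permanent * A.det =
      ∑ π : Equiv.Perm (Fin k), (Matrix.of fun i j => A i j * A i (π j)).det := by
  have h1 : ∀ σ : Equiv.Perm (Fin k), A.permanent = ∑ π : Equiv.Perm (Fin k), ∏ j,
      A (σ j) (π j) := by
    intro σ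
    rw [← Matrix.permanent_transpose, Matrix.permanent,
      ← Equiv.sum_comp (Equiv.mulRight σ⁻¹)]
    refine Finset.sum_congr rfl fun π _ => ?_
    rw [← Equiv.prod_comp σ]
    refine Finset.prod_congr rfl fun j _ => ?_
    simp [Matrix.transpose_apply]
  simp_rw [Matrix.det_apply']
  rw [Finset.sum_comm, Finset.mul_sum]
  refine Finset.sum_congr rfl fun σ _ => ?_
  rw [h1 σ, Finset.sum_mul]
  refine Finset.sum_congr rfl fun π _ => ?_
  simp_rw [Matrix.of_apply, Finset.prod_mul_distrib]
  ring

theorem szegoMatrix_permanent_mul_det {k : ℕ} (w : Fin k → ℂ) (hw : ∀ i, w i ∈ unitDisc) :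
    (szegoMatrix w).permanent * (szegoMatrix w).det =
      (Matrix.of fun i j => szegoMatrix w i j ^ 2).det := by
  have hn : ∀ i, ‖w i‖ < 1 := fun i => mem_ball_zero_iff.1 (hw i)
  by_cases hinj : Function.Injective w
  · rw [Matrix.permanent_mul_det, Finset.sum_eq_single 1]
    · simp [sq]
    · intro π _ hπ
      obtain ⟨i₀, hi₀⟩ : ∃ i, π i ≠ i := by
        by_contra! h
        exact hπ (Equiv.ext h)
      rw [← Matrix.exists_mulVec_eq_zero_iff]
      refine ⟨fun j => (starRingEnd ℂ) (w j) - (starRingEnd ℂ) (w (π j)), fun h => ?_, ?_⟩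
      · have h1 := congrFun h i₀
        rw [Pi.zero_apply, sub_eq_zero] at h1
        exact hi₀ (hinj ((starRingEnd ℂ).injective h1)).symm
      · ext i
        simp only [Matrix.mulVec, dotProduct, Matrix.of_apply, Pi.zero_apply]
        have h2 : ∀ j, szegoMatrix w i j * szegoMatrix w i (π j) *
            ((starRingEnd ℂ) (w j) - (starRingEnd ℂ) (w (π j))) =
            (starRingEnd ℂ) (w j) * szegoMatrix w i j -
              (starRingEnd ℂ) (w (π j)) * szegoMatrix w i (π j) := by
          intro j
          have n1 := one_sub_mul_conj_ne_zero (hn i) (hn j)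
          have n2 := one_sub_mul_conj_ne_zero (hn i) (hn (π j))
          simp only [szegoMatrix, Matrix.of_apply]
          field_simp
          ring
        simp_rw [h2]
        rw [Finset.sum_sub_distrib,
          Equiv.sum_comp π fun j => (starRingEnd ℂ) (w j) * szegoMatrix w i j, sub_self]
    · simp
  · obtain ⟨i, j, hij, hne⟩ : ∃ i j, w i = w j ∧ i ≠ j := by
      simpa [Function.Injective] using hinj
    have h1 : szegoMatrix w i = szegoMatrix w j := by
      ext l
      simp [szegoMatrix, hij]
    rw [Matrix.det_zero_of_row_eq hne h1, mul_zero, Matrix.det_zero_of_row_eq hne]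
    ext l
    simp [h1]

theorem palmDensity_mul_permanent {k : ℕ} (w : Fin k → ℂ) (hw : ∀ i, w i ∈ unitDisc) :
    (palmDensity k w : ℂ) * (szegoMatrix w).permanent =
      (Matrix.of fun i j => bergmanKernel (w i) (w j)).det := by
  rw [palmDensity_eq_det k w hw, div_mul_eq_mul_div, mul_comm, szegoMatrix_permanent_mul_det w hw]
  have h : (Matrix.of fun i j => bergmanKernel (w i) (w j)) =
      (1 / (Real.pi : ℂ)) • Matrix.of fun i j => szegoMatrix w i j ^ 2 := by
    ext i j
    simp [bergmanKernel, szegoMatrix, mul_comm]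
  rw [h, Matrix.det_smul, Fintype.card_fin, one_div_pow,
    one_div, div_eq_inv_mul]

/-! ### The Wick formula -/

open Classical in
theorem card_perm_comp_eq {ι κ : Type*} [Fintype ι] [DecidableEq ι] [Fintype κ] (p q : ι → κ) :
    Fintype.card {σ : Equiv.Perm ι // p ∘ σ = q} =
      ∏ m, if Fintype.card {i // p i = m} = Fintype.card {i // q i = m} then
        (Fintype.card {i // p i = m}).factorial else 0 := by
  by_cases h : ∀ m, Fintype.card {i // p i = m} = Fintype.card {i // q i = m}
  · simp_rw [h, if_true, ← h]
    rw [← DomMulAct.stabilizer_card p]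
    set τ : Equiv.Perm ι := (Equiv.sigmaFiberEquiv q).symm.trans
      ((Equiv.sigmaCongrRight fun m => Fintype.equivOfCardEq (h m).symm).trans
        (Equiv.sigmaFiberEquiv p)) with hτ
    have hpτ : p ∘ τ = q := by
      ext i
      exact ((Fintype.equivOfCardEq (h (q i)).symm) ⟨i, rfl⟩).2
    refine Fintype.card_congr ((Equiv.mulRight τ⁻¹).subtypeEquiv fun σ => ?_)
    rw [← hpτ]
    constructor
    · intro hσ
      ext i
      have := congrFun hσ (τ⁻¹ i)
      simpa using this
    · intro hσ
      ext i
      have := congrFun hσ (τ i)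
      simpa using this
  · push Not at h
    obtain ⟨m, hm⟩ := h
    rw [Finset.prod_eq_zero (Finset.mem_univ m) (if_neg hm), Fintype.card_eq_zero_iff]
    refine ⟨fun ⟨σ, hσ⟩ => hm (Fintype.card_congr (σ.subtypeEquiv fun i => ?_)).symm⟩
    rw [← hσ, Function.comp_apply]

open Classical in
theorem prod_comp_eq_prod_pow {ι κ R : Type*} [Fintype ι] [Fintype κ] [CommMonoid R] (p : ι → κ)
    (f : κ → R) : ∏ i, f (p i) = ∏ m, f m ^ Fintype.card {i // p i = m} := by
  rw [← Fintype.prod_fiberwise' p f]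
  exact Finset.prod_congr rfl fun m _ => by rw [Finset.prod_const, Finset.card_univ]

theorem integrable_pow_mul_conj_pow_stdComplexGaussian (a b : ℕ) :
    Integrable (fun z : ℂ => z ^ a * (starRingEnd ℂ) z ^ b) stdComplexGaussian := by
  refine ((integrable_norm_pow_stdComplexGaussian (a + b)).add (integrable_const 1)).mono'
    (Continuous.aestronglyMeasurable (by fun_prop)) (Filter.Eventually.of_forall fun z => ?_)
  rw [norm_mul, norm_pow, norm_pow, RCLike.norm_conj, ← pow_add, Pi.add_apply, mul_comm 2, pow_mul]
  nlinarith [sq_nonneg (‖z‖ ^ (a + b) - 1)]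

/-- The law of a family of i.i.d. standard complex Gaussian variables. -/
abbrev stdComplexGaussianPi (κ : Type*) [Fintype κ] : Measure (κ → ℂ) :=
  Measure.pi fun _ : κ => stdComplexGaussian

theorem monomial_eq_prod {ι κ : Type*} [Fintype ι] [Fintype κ] [DecidableEq κ] (p q : ι → κ)
    (z : κ → ℂ) : (∏ i, z (p i)) * ∏ i, (starRingEnd ℂ) (z (q i)) =
      ∏ m, (z m ^ Fintype.card {i // p i = m} *
        (starRingEnd ℂ) (z m) ^ Fintype.card {i // q i = m}) := by
  rw [Finset.prod_mul_distrib, prod_comp_eq_prod_pow p z,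
    prod_comp_eq_prod_pow q fun m => (starRingEnd ℂ) (z m)]
  congr!

theorem integrable_monomial {ι κ : Type*} [Fintype ι] [Fintype κ] (p q : ι → κ) :
    Integrable (fun z : κ → ℂ => (∏ i, z (p i)) * ∏ i, (starRingEnd ℂ) (z (q i)))
      (stdComplexGaussianPi κ) := by
  classical
  simp_rw [monomial_eq_prod p q]
  exact Integrable.fintype_prod_dep fun m => integrable_pow_mul_conj_pow_stdComplexGaussian _ _

open Classical in
theorem integral_monomial {ι κ : Type*} [Fintype ι] [DecidableEq ι] [Fintype κ] (p q : ι → κ) :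
    ∫ z, (∏ i, z (p i)) * ∏ i, (starRingEnd ℂ) (z (q i)) ∂(stdComplexGaussianPi κ) =
      ∑ σ : Equiv.Perm ι, if p ∘ σ = q then 1 else 0 := by
  simp_rw [monomial_eq_prod p q]
  rw [integral_fintype_prod_eq_prod (fun m (z : ℂ) => z ^ Fintype.card {i // p i = m} *
        (starRingEnd ℂ) z ^ Fintype.card {i // q i = m})]
  simp_rw [integral_pow_mul_conj_pow_stdComplexGaussian]
  rw [Finset.sum_boole, ← Fintype.card_subtype, card_perm_comp_eq]
  push_cast
  rfl

theorem norm_prod_sq_eq {ι κ : Type*} [Fintype ι] [Fintype κ] [DecidableEq ι] (B : κ → ι → ℂ)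
    (z : κ → ℂ) :
    ((∏ i, ‖∑ m, B m i * z m‖ ^ 2 : ℝ) : ℂ) = ∑ p : ι → κ, ∑ q : ι → κ,
      ((∏ i, B (p i) i) * ∏ i, (starRingEnd ℂ) (B (q i) i)) *
        ((∏ i, z (p i)) * ∏ i, (starRingEnd ℂ) (z (q i))) := by
  push_cast
  simp_rw [← Complex.mul_conj', map_sum, Finset.prod_mul_distrib, map_mul]
  rw [Finset.prod_univ_sum, Finset.prod_univ_sum, Finset.sum_mul_sum]
  simp_rw [Fintype.piFinset_univ, Finset.prod_mul_distrib]
  exact Finset.sum_congr rfl fun p _ => Finset.sum_congr rfl fun q _ => by ring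

theorem integrable_norm_prod_sq {ι κ : Type*} [Fintype ι] [Fintype κ] (B : κ → ι → ℂ) :
    Integrable (fun z : κ → ℂ => ((∏ i, ‖∑ m, B m i * z m‖ ^ 2 : ℝ) : ℂ))
      (stdComplexGaussianPi κ) := by
  classical
  simp_rw [norm_prod_sq_eq]
  exact integrable_finsetSum _ fun p _ => integrable_finsetSum _ fun q _ =>
    (integrable_monomial p q).const_mul _

theorem integral_norm_prod_sq {ι κ : Type*} [Fintype ι] [Fintype κ] [DecidableEq ι]
    (B : κ → ι → ℂ) :
    ∫ z : κ → ℂ, ((∏ i, ‖∑ m, B m i * z m‖ ^ 2 : ℝ) : ℂ) ∂(stdComplexGaussianPi κ) =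
      ∑ σ : Equiv.Perm ι, ∏ i, ∑ m, (starRingEnd ℂ) (B m i) * B m (σ i) := by
  classical
  simp_rw [norm_prod_sq_eq]
  rw [integral_finsetSum _ fun p _ => integrable_finsetSum _ fun q _ =>
    (integrable_monomial p q).const_mul _]
  have h1 : ∀ p : ι → κ, ∫ z : κ → ℂ, ∑ q : ι → κ,
      ((∏ i, B (p i) i) * ∏ i, (starRingEnd ℂ) (B (q i) i)) *
        ((∏ i, z (p i)) * ∏ i, (starRingEnd ℂ) (z (q i))) ∂(stdComplexGaussianPi κ) =
      ∑ σ : Equiv.Perm ι, ∏ i, (starRingEnd ℂ) (B (p (σ i)) i) * B (p (σ i)) (σ i) := by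
    intro p
    rw [integral_finsetSum _ fun q _ => (integrable_monomial p q).const_mul _]
    simp_rw [integral_const_mul, integral_monomial, Finset.mul_sum]
    rw [Finset.sum_comm]
    refine Finset.sum_congr rfl fun σ _ => ?_
    rw [Finset.sum_eq_single (p ∘ σ) (fun q _ hq => by rw [if_neg hq.symm, mul_zero]) (by simp),
      if_pos rfl, mul_one, Finset.prod_mul_distrib, mul_comm]
    congr 1
    exact (Equiv.prod_comp σ fun i => B (p i) i).symm
  simp_rw [h1]
  rw [Finset.sum_comm]
  refine Finset.sum_congr rfl fun σ _ => ?_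
  rw [Finset.prod_univ_sum, Fintype.piFinset_univ,
    ← Equiv.sum_comp (Equiv.arrowCongr σ (Equiv.refl κ))]
  simp

theorem integral_cexp_pi {ι κ : Type*} [Fintype ι] [Fintype κ] (B : κ → ι → ℂ) (t : ι → ℂ) :
    ∫ z : κ → ℂ, Complex.exp (((∑ i, t i * ∑ m, B m i * z m).re : ℝ) * Complex.I)
      ∂(stdComplexGaussianPi κ) = Complex.exp (-(∑ i, ∑ j, (starRingEnd ℂ) (t i) * t j *
        ∑ m, (starRingEnd ℂ) (B m i) * B m j) / 4) := by
  have h : ∀ z : κ → ℂ, Complex.exp (((∑ i, t i * ∑ m, B m i * z m).re : ℝ) * Complex.I) =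
      ∏ m, Complex.exp ((((∑ i, t i * B m i) * z m).re : ℝ) * Complex.I) := by
    intro z
    have h1 : ∑ i, t i * ∑ m, B m i * z m = ∑ m, (∑ i, t i * B m i) * z m := by
      simp_rw [Finset.mul_sum, Finset.sum_mul]
      rw [Finset.sum_comm]
      exact Finset.sum_congr rfl fun m _ => Finset.sum_congr rfl fun i _ => by ring
    rw [h1, Complex.re_sum, Complex.ofReal_sum, Finset.sum_mul, Complex.exp_sum]
  simp_rw [h]
  rw [integral_fintype_prod_eq_prod
    (fun m (z : ℂ) => Complex.exp ((((∑ i, t i * B m i) * z).re : ℝ) * Complex.I))]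
  simp_rw [integral_cexp_re_mul_stdComplexGaussian]
  rw [← Complex.exp_sum, ← Finset.sum_div, Finset.sum_neg_distrib]
  congr 3
  simp_rw [← Complex.conj_mul', map_sum, Finset.sum_mul_sum, Finset.mul_sum, map_mul]
  rw [Finset.sum_comm]
  refine Finset.sum_congr rfl fun i _ => ?_
  rw [Finset.sum_comm]
  exact Finset.sum_congr rfl fun j _ => Finset.sum_congr rfl fun m _ => by ring

namespace AnalyticDisc

theorem exists_map_eval_gafLaw {k : ℕ} (w : Fin k → unitDisc) :
    ∃ (n : ℕ) (B : Fin n → Fin k → ℂ),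
      (∀ i j, inner ℂ (szegoVector (w i)) (szegoVector (w j)) =
        ∑ m, (starRingEnd ℂ) (B m i) * B m j) ∧
      gafLaw.map (fun H i => H (w i)) =
        (stdComplexGaussianPi (Fin n)).map fun z i => ∑ m, B m i * z m := by
  obtain ⟨n, u, hu⟩ := Matrix.posSemidef_iff_eq_sum_vecMulVec.1
    (Matrix.posSemidef_gram ℂ fun i => szegoVector (w i))
  have hB : ∀ i j, inner ℂ (szegoVector (w i)) (szegoVector (w j)) =
      ∑ m, (starRingEnd ℂ) (star (u m i)) * star (u m j) := fun i j => by
    have := congrFun (congrFun hu i) j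
    rw [Matrix.gram_apply, Matrix.sum_apply] at this
    rw [this]
    simp [Matrix.vecMulVec_apply]
  refine ⟨n, fun m i => star (u m i), hB, ?_⟩
  have hm1 : Measurable fun (H : AnalyticDisc) i => H (w i) :=
    measurable_pi_lambda _ fun i => measurable_eval_const _
  have hm2 : Measurable fun (z : Fin n → ℂ) (i : Fin k) => ∑ m, star (u m i) * z m := by fun_prop
  have := Measure.isFiniteMeasure_map gafLaw fun (H : AnalyticDisc) i => H (w i)
  have := Measure.isFiniteMeasure_map (stdComplexGaussianPi (Fin n))
    fun (z : Fin n → ℂ) (i : Fin k) => ∑ m, star (u m i) * z m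
  refine Measure.ext_of_integral_cexp_re_sum fun t => ?_
  rw [integral_map hm1.aemeasurable (Continuous.aestronglyMeasurable (by fun_prop)),
    integral_map hm2.aemeasurable (Continuous.aestronglyMeasurable (by fun_prop)),
    integral_cexp_pi (fun m i => star (u m i))]
  have h := charFunctional_gafLaw w t
  rw [charFunctional, norm_sum_smul_sq] at h
  rw [h]
  simp_rw [hB]

theorem lintegral_prod_norm_sq {k : ℕ} (w : Fin k → ℂ) (hw : ∀ i, w i ∈ unitDisc) :
    ∃ r : ℝ, 0 ≤ r ∧ (r : ℂ) = (szegoMatrix w).permanent ∧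
      ∫⁻ H, ENNReal.ofReal (∏ i, ‖H.extend (w i)‖ ^ 2) ∂gafLaw = ENNReal.ofReal r := by
  obtain ⟨n, B, hB, hmap⟩ := exists_map_eval_gafLaw fun i => (⟨w i, hw i⟩ : unitDisc)
  have hint : Integrable (fun z : Fin n → ℂ => ∏ i, ‖∑ m, B m i * z m‖ ^ 2)
      (stdComplexGaussianPi (Fin n)) := by
    have := (integrable_norm_prod_sq B).re
    simpa only [RCLike.re_to_complex, Complex.ofReal_re] using this
  refine ⟨∫ z : Fin n → ℂ, ∏ i, ‖∑ m, B m i * z m‖ ^ 2 ∂(stdComplexGaussianPi (Fin n)),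
    integral_nonneg fun z => Finset.prod_nonneg fun i _ => sq_nonneg _, ?_, ?_⟩
  · rw [← integral_complex_ofReal, integral_norm_prod_sq, Matrix.permanent]
    refine Finset.sum_congr rfl fun σ _ => Finset.prod_congr rfl fun i _ => ?_
    rw [← hB, inner_szegoVector, szegoMatrix, Matrix.of_apply, mul_comm]
  · have hm1 : Measurable fun (H : AnalyticDisc) i => H (⟨w i, hw i⟩ : unitDisc) :=
      measurable_pi_lambda _ fun i => measurable_eval_const _
    have hf : Measurable fun x : Fin k → ℂ => ENNReal.ofReal (∏ i, ‖x i‖ ^ 2) := by fun_prop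
    have h1 : ∀ H : AnalyticDisc, ENNReal.ofReal (∏ i, ‖H.extend (w i)‖ ^ 2) =
        (fun x : Fin k → ℂ => ENNReal.ofReal (∏ i, ‖x i‖ ^ 2))
          ((fun (H : AnalyticDisc) i => H (⟨w i, hw i⟩ : unitDisc)) H) := fun H => by
      simp only [fun i => extend_of_mem H (hw i)]
    simp_rw [h1]
    rw [← lintegral_map hf hm1, hmap, lintegral_map hf (by fun_prop),
      ofReal_integral_eq_lintegral_ofReal hint (Filter.Eventually.of_forall fun z =>
        Finset.prod_nonneg fun i _ => sq_nonneg _)]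

/-- The intensities of the zeros of the Gaussian analytic function. -/
theorem lintegral_sum_injectiveTuples_eq (k : ℕ) {ψ : (Fin k → ℂ) → ℝ≥0∞} (hψ : Measurable ψ) :
    ∫⁻ F, ∑' x, (injectiveTuples k F.properZeros).indicator ψ x ∂gafLaw =
      ∫⁻ w in {w | ∀ i, w i ∈ unitDisc},
        ENNReal.ofReal (Matrix.of fun i j => bergmanKernel (w i) (w j)).det.re * ψ w := by
  refine (lintegral_sum_injectiveTuples k (hψ.comp measurable_fst)).trans ?_
  have hms : MeasurableSet {w : Fin k → ℂ | ∀ i, w i ∈ unitDisc} := by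
    rw [Set.ofPred_forall]
    exact MeasurableSet.iInter fun i => measurable_pi_apply i Metric.isOpen_ball.measurableSet
  refine setLIntegral_congr_fun hms fun w hw => ?_
  obtain ⟨r, hr, hrp, hri⟩ := lintegral_prod_norm_sq w hw
  simp only [Function.comp_apply]
  rw [lintegral_mul_const, hri, ← palmDensity_mul_permanent w hw, ← hrp, ← Complex.ofReal_mul,
    Complex.ofReal_re, ENNReal.ofReal_mul (palmDensity_nonneg k w hw), mul_assoc]
  refine Measurable.ennreal_ofReal (Finset.measurable_prod _ fun i _ => ?_)
  exact (measurable_id.discExtend measurable_const).norm.pow_const 2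

theorem det_bergmanKernel_eq_ofReal {k : ℕ} (w : Fin k → ℂ) (hw : ∀ i, w i ∈ unitDisc) :
    ∃ r : ℝ, 0 ≤ r ∧ (Matrix.of fun i j => bergmanKernel (w i) (w j)).det = r := by
  obtain ⟨r, hr, hrp, -⟩ := lintegral_prod_norm_sq w hw
  refine ⟨palmDensity k w * r, mul_nonneg (palmDensity_nonneg k w hw) hr, ?_⟩
  rw [← palmDensity_mul_permanent w hw, ← hrp, Complex.ofReal_mul]

end AnalyticDisc

/-! ### The zeros of the Gaussian analytic function -/

namespace AnalyticDisc

theorem ae_ne_zero_gafLaw : ∀ᵐ F ∂gafLaw, F ≠ 0 := by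
  have hms : MeasurableSet {F : AnalyticDisc | F ≠ 0} := (measurableSet_singleton 0).compl
  rw [← map_addMul_gafLaw, ae_map_iff measurable_addMul.aemeasurable hms]
  have h : ∀ᵐ u : ℂ ∂stdComplexGaussian, u ≠ 0 :=
    compl_mem_ae_iff.2 (measure_singleton (0 : ℂ))
  filter_upwards [Measure.quasiMeasurePreserving_fst.ae h] with p hp h0
  apply hp
  have h1 := addMul_apply p.1 p.2 ⟨0, Metric.mem_ball_self one_pos⟩
  rw [h0, zero_apply, zero_mul, add_zero] at h1
  exact h1.symm

theorem finite_tuples_zeros {F : AnalyticDisc} (hF : F ≠ 0) {k : ℕ} {C : Set (Fin k → ℂ)}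
    (hC : IsCompact C) (hCD : C ⊆ {z | ∀ i, z i ∈ unitDisc}) :
    {x : Fin k → ℂ | (∀ i, x i ∈ F.zeros) ∧ x ∈ C}.Finite := by
  have h : ∀ i, (F.zeros ∩ (fun x : Fin k → ℂ => x i) '' C).Finite := fun i =>
    finite_zeros_inter hF (hC.image (continuous_apply i)) (by
      rintro _ ⟨x, hx, rfl⟩
      exact hCD hx i)
  refine (Set.Finite.pi' h).subset ?_
  rintro x ⟨hx, hxC⟩ i
  exact ⟨hx i, x, hxC, rfl⟩

theorem summable_tuples_zeros {F : AnalyticDisc} (hF : F ≠ 0) {k : ℕ} {C : Set (Fin k → ℂ)}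
    (hC : IsCompact C) (hCD : C ⊆ {z | ∀ i, z i ∈ unitDisc}) {f : (Fin k → ℂ) → ℝ}
    (hf : ∀ z, z ∉ C → f z = 0) :
    Summable fun x : {x : Fin k → ℂ // Function.Injective x ∧ ∀ i, x i ∈ F.zeros} => f x.1 := by
  refine summable_of_hasFiniteSupport (((finite_tuples_zeros hF hC hCD).preimage
    Subtype.val_injective.injOn).subset fun x hx => ⟨x.2.2, ?_⟩)
  by_contra h
  exact hx (hf _ h)

theorem continuousOn_det_bergmanKernel (k : ℕ) : ContinuousOn (fun w : Fin k → ℂ =>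
    (Matrix.of fun i j => bergmanKernel (w i) (w j)).det.re) {z | ∀ i, z i ∈ unitDisc} := by
  refine Complex.continuous_re.comp_continuousOn ?_
  simp_rw [Matrix.det_apply', Matrix.of_apply]
  refine continuousOn_finsetSum _ fun σ _ => continuousOn_const.mul
    (continuousOn_finsetProd _ fun i _ => ?_)
  unfold bergmanKernel
  refine continuousOn_const.div (Continuous.continuousOn (by fun_prop)) fun w hw => ?_
  exact mul_ne_zero (Complex.ofReal_ne_zero.2 Real.pi_ne_zero) (pow_ne_zero 2
    (one_sub_mul_conj_ne_zero (mem_ball_zero_iff.1 (hw _)) (mem_ball_zero_iff.1 (hw _))))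

theorem integral_sum_tuples_zeros {Ω : Type*} [MeasurableSpace Ω] {P : Measure Ω}
    {G : Ω → AnalyticDisc} (hG : AEMeasurable G P) (hlaw : P.map G = gafLaw) {k : ℕ}
    {C : Set (Fin k → ℂ)} (hC : IsCompact C) (hCD : C ⊆ {z | ∀ i, z i ∈ unitDisc})
    {f : (Fin k → ℂ) → ℝ} (hfm : Measurable f) (hf0 : ∀ z, 0 ≤ f z) {M : ℝ} (hfM : ∀ z, f z ≤ M)
    (hfC : ∀ z, z ∉ C → f z = 0) :
    IntegrableOn (fun w => (Matrix.of fun i j => bergmanKernel (w i) (w j)).det.re * f w)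
        {z | ∀ i, z i ∈ unitDisc} ∧
      Integrable (fun ω => ∑' x : {x : Fin k → ℂ // Function.Injective x ∧
        ∀ i, x i ∈ (G ω).zeros}, f x.1) P ∧
      ∫ ω, ∑' x : {x : Fin k → ℂ // Function.Injective x ∧ ∀ i, x i ∈ (G ω).zeros}, f x.1 ∂P =
        ∫ w in {z | ∀ i, z i ∈ unitDisc},
          (Matrix.of fun i j => bergmanKernel (w i) (w j)).det.re * f w := by
  set d : (Fin k → ℂ) → ℝ := fun w => (Matrix.of fun i j => bergmanKernel (w i)
      (w j)).det.re with hd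
  have hms : MeasurableSet {w : Fin k → ℂ | ∀ i, w i ∈ unitDisc} := by
    rw [Set.ofPred_forall]
    exact MeasurableSet.iInter fun i => measurable_pi_apply i Metric.isOpen_ball.measurableSet
  have hd0 : ∀ w : Fin k → ℂ, (∀ i, w i ∈ unitDisc) → 0 ≤ d w := fun w hw => by
    obtain ⟨r, hr, hdr⟩ := det_bergmanKernel_eq_ofReal w hw
    rw [hd]
    simp only [hdr, Complex.ofReal_re, hr]
  have hint : IntegrableOn (fun w => d w * f w) {z | ∀ i, z i ∈ unitDisc} := by
    refine IntegrableOn.of_forall_sdiff_eq_zero (s := C) ?_ hms fun w hw => by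
      rw [hfC w hw.2, mul_zero]
    refine Integrable.mul_bdd (c := M)
      (((continuousOn_det_bergmanKernel k).mono hCD).integrableOn_compact hC)
      hfm.aestronglyMeasurable (Filter.Eventually.of_forall fun w => ?_)
    rw [Real.norm_of_nonneg (hf0 w)]
    exact hfM w
  have hdf : 0 ≤ᵐ[volume.restrict {z : Fin k → ℂ | ∀ i, z i ∈ unitDisc}] fun w => d w * f w :=
    (ae_restrict_iff' hms).2 (Filter.Eventually.of_forall fun w hw => mul_nonneg (hd0 w hw) (hf0 w))
  set S : AnalyticDisc → ℝ≥0∞ := fun F => ∑' x, (injectiveTuples k F.properZeros).indicator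
    (fun x => ENNReal.ofReal (f x)) x with hS
  have hSm : Measurable S := measurable_tsum_injectiveTuples k
    (Ψ := fun p : (Fin k → ℂ) × AnalyticDisc => ENNReal.ofReal (f p.1)) (by fun_prop)
  have hSi : ∫⁻ ω, S (G ω) ∂P =
      ∫⁻ w in {z : Fin k → ℂ | ∀ i, z i ∈ unitDisc}, ENNReal.ofReal (d w * f w) := by
    rw [← lintegral_map' hSm.aemeasurable hG, hlaw, lintegral_sum_injectiveTuples_eq k
        (by fun_prop)]
    exact setLIntegral_congr_fun hms fun w hw => (ENNReal.ofReal_mul (hd0 w hw)).symm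
  have hae : ∀ᵐ ω ∂P, G ω ≠ 0 := ae_of_ae_map hG (hlaw ▸ ae_ne_zero_gafLaw)
  have hT : (fun ω => ∑' x : {x : Fin k → ℂ // Function.Injective x ∧ ∀ i, x i ∈ (G ω).zeros},
      f x.1) =ᵐ[P] fun ω => (S (G ω)).toReal := by
    filter_upwards [hae] with ω hω
    rw [hS]
    dsimp only
    rw [properZeros_of_ne_zero hω, ← tsum_subtype, injectiveTuples]
    have := ENNReal.ofReal_tsum_of_nonneg (fun x => hf0 _) (summable_tuples_zeros hω hC hCD hfC)
    refine Eq.trans ?_ (congrArg ENNReal.toReal this)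
    rw [ENNReal.toReal_ofReal (tsum_nonneg fun x => hf0 _)]
  have hfin : ∫⁻ ω, S (G ω) ∂P ≠ ⊤ := by
    rw [hSi, ← ofReal_integral_eq_lintegral_ofReal hint hdf]
    exact ENNReal.ofReal_ne_top
  have hSG : AEMeasurable (fun ω => S (G ω)) P := hSm.comp_aemeasurable hG
  refine ⟨hint, (integrable_toReal_of_lintegral_ne_top hSG hfin).congr hT.symm, ?_⟩
  rw [integral_congr_ae hT, integral_toReal hSG (ae_lt_top' hSG hfin), hSi,
    ← ofReal_integral_eq_lintegral_ofReal hint hdf, ENNReal.toReal_ofReal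
        (integral_nonneg_of_ae hdf)]

theorem isDeterminantalPointProcess_zeros {Ω : Type*} [MeasurableSpace Ω] {P : Measure Ω}
    {G : Ω → AnalyticDisc} (hG : AEMeasurable G P) (hlaw : P.map G = gafLaw) :
    IsDeterminantalPointProcess P unitDisc bergmanKernel fun ω => (G ω).zeros := by
  have hae : ∀ᵐ ω ∂P, G ω ≠ 0 := ae_of_ae_map hG (hlaw ▸ ae_ne_zero_gafLaw)
  refine ⟨Filter.Eventually.of_forall fun ω z hz => (mem_zeros_iff.1 hz).1, ?_, ?_⟩
  · filter_upwards [hae] with ω hω C hC hCD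
    exact finite_zeros_inter hω hC hCD
  · rintro k - ψ hψ ⟨M, hM⟩ ⟨C, hC, hCD, hψC⟩
    obtain ⟨hi1, hs1, he1⟩ := integral_sum_tuples_zeros hG hlaw hC hCD (f := fun z => max (ψ z) 0)
      (M := max M 0) (by fun_prop) (fun z => le_max_right _ _)
      (fun z => max_le_max_right 0 ((le_abs_self _).trans (hM z)))
      fun z hz => by rw [hψC z hz, max_self]
    obtain ⟨hi2, hs2, he2⟩ := integral_sum_tuples_zeros hG hlaw hC hCD (f := fun z => max (-ψ z) 0)
      (M := max M 0) (by fun_prop) (fun z => le_max_right _ _)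
      (fun z => max_le_max_right 0 ((neg_le_abs _).trans (hM z)))
      fun z hz => by rw [hψC z hz, neg_zero, max_self]
    have hT : (fun ω => ∑' x : {x : Fin k → ℂ // Function.Injective x ∧ ∀ i, x i ∈ (G ω).zeros},
        ψ x.1) =ᵐ[P] fun ω =>
        (∑' x : {x : Fin k → ℂ // Function.Injective x ∧ ∀ i, x i ∈ (G ω).zeros}, max (ψ x.1) 0) -
        ∑' x : {x : Fin k → ℂ // Function.Injective x ∧ ∀ i, x i ∈ (G ω).zeros},
            max (-ψ x.1) 0 := by
      filter_upwards [hae] with ω hω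
      rw [← Summable.tsum_sub
        (summable_tuples_zeros hω hC hCD (f := fun z => max (ψ z) 0) fun z hz => by
          rw [hψC z hz, max_self])
        (summable_tuples_zeros hω hC hCD (f := fun z => max (-ψ z) 0) fun z hz => by
          rw [hψC z hz, neg_zero, max_self])]
      exact tsum_congr fun x => (max_zero_sub_max_neg_zero_eq_self (ψ x.1)).symm
    refine ⟨(hs1.sub hs2).congr hT.symm, ?_⟩
    rw [integral_congr_ae hT, integral_sub hs1 hs2, he1, he2, ← integral_sub hi1 hi2,
      ← integral_complex_ofReal]
    have hms : MeasurableSet {w : Fin k → ℂ | ∀ i, w i ∈ unitDisc} := by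
      rw [Set.ofPred_forall]
      exact MeasurableSet.iInter fun i => measurable_pi_apply i Metric.isOpen_ball.measurableSet
    refine setIntegral_congr_fun hms fun w hw => ?_
    obtain ⟨r, -, hdr⟩ := det_bergmanKernel_eq_ofReal w hw
    rw [hdr, Complex.ofReal_re, ← mul_sub, max_zero_sub_max_neg_zero_eq_self, Complex.ofReal_mul,
      mul_comm]

end AnalyticDisc

end

theorem theoremt (α c : ℝ) (hα : -1 < α) (hc0 : 0 < c) (hc1 : c < 1) :
    -- the series of the transform converges on the disc for every square-summable signal
    (∀ (f : EllTwo) (z : ℂ), z ∈ unitDisc → Summable (diskTransformTerm α (fun x => f x) z)) ∧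
    -- the transforms of the Meixner functions
    (∀ (k : ℕ) (z : ℂ), z ∈ unitDisc →
      diskTransform α (fun x => (meixnerFunction α c k x : ℂ)) z =
        (gammaCoeff α k : ℂ) * (((1 - c) ^ ((α + 1) / 2) : ℝ) : ℂ) *
          ((Real.sqrt c : ℝ) - z) ^ k * (1 - (Real.sqrt c : ℝ) * z) ^ (-(α : ℂ) - 1 - (k : ℂ))) ∧
    -- the Meixner functions form an orthonormal basis; the transform extends in a unique way to a
    -- continuous map on the space of the associated white noise
    ∃ b : HilbertBasis ℕ ℂ EllTwo, (∀ k x : ℕ, b k x = (meixnerFunction α c k x : ℂ)) ∧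
    ∃ L : NoiseSpace → AnalyticDisc, IsTransformExtension α b L ∧
      (∀ L' : NoiseSpace → AnalyticDisc, IsTransformExtension α b L' → L' = L) ∧
      -- the law of the transform of white noise, and its zeros for `α = 0`
      ∀ (Ω : Type*) [MeasurableSpace Ω] (P : Measure Ω) [IsProbabilityMeasure P]
        (ξ : Ω → NoiseSpace), IsWhiteNoise b P ξ →
        (AEMeasurable (fun ω => L (ξ ω)) P ∧ P.map (fun ω => L (ξ ω)) = hyperbolicGAFLaw α) ∧
        (α = 0 → IsDeterminantalPointProcess P unitDisc bergmanKernel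
          (fun ω => (L (ξ ω)).zeros)) := by
  refine ⟨fun f z hz => (hasSum_diskTransformTerm hα f (mem_ball_zero_iff.1 hz)).summable,
    fun k z hz => (diskTransform_meixnerFunction hα hc0 hc1 k (mem_ball_zero_iff.1 hz)).trans
      (gammaCoeff_mul_discInvolution_pow hc0 hc1 k (mem_ball_zero_iff.1 hz)),
    meixnerBasis hα hc0 hc1, meixnerBasis_apply hα hc0 hc1, noiseTransform hα hc0 hc1,
    isTransformExtension_noiseTransform hα hc0 hc1,
    fun L' h => (isTransformExtension_noiseTransform hα hc0 hc1).unique h,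
    fun Ω _ P _ ξ hξ => ⟨⟨aemeasurable_noiseTransform hα hc0 hc1 hξ,
      map_noiseTransform hα hc0 hc1 hξ⟩, ?_⟩⟩
  rintro rfl
  exact AnalyticDisc.isDeterminantalPointProcess_zeros (aemeasurable_noiseTransform hα hc0 hc1 hξ)
    (map_noiseTransform hα hc0 hc1 hξ)
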